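/- **Proposition (Drinfeld–Sokolov).** Let $n\ge 2$, $G=\mathrm{SL}(n,\mathbb R)$, and let $\mathsf C$ be a compact, connected, oriented smooth 1-manifold (a circle without preferred coordinate). Let $Q\to\mathsf C$ be a smooth principal $G$-bundle, with a smooth $G$-equivariant map $\tau\colon Q\to S^{n-1}=(\mathbb R^n-\{0\})/\mathbb R_{>0}$ and a smooth $G$-equivariant lift $\widehat\tau\colon Q\to \mathrm{Fl}^+(\mathbb R^n)=G/B$ of $\tau$ to the manifold of oriented flags; here $B\subset G$ is the group of upper triangular matrices with positive diagonal entries, the stabilizer of the standard oriented flag $\widehat v_0$. Equivariance refers to the right action on $Q$: $\tau(qg)=g^{-1}\tau(q)$, $\widehat\tau(qg)=g^{-1}\widehat\tau(q)$. *Positive connections.* A smooth curve in $S^{n-1}$ is (positive) nondegenerate if it lifts to a curve $\tilde\gamma$ in $\mathbb R^n-\{0\}$ such that in oriented local coordinates $\tilde\gamma,\tilde\gamma',\dots,\tilde\gamma^{(n-1)}$ is an oriented basis of $\mathbb R^n$; it then lifts to $\mathrm{Fl}^+(\mathbb R^n)$, the $i$-th oriented subspace being spanned by the derivatives of order $<i$.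 If $\theta$ is a principal connection on $Q$ such that $\tau\circ s$ is nondegenerate for all $\theta$-horizontal local sections $s$, these flags define a $G$-equivariant lift $\widehat\tau_\theta\colon Q\to\mathrm{Fl}^+(\mathbb R^n)$ of $\tau$. The connection is $\widehat\tau$-positive if moreover $\widehat\tau_\theta$ is homotopic to $\widehat\tau$ through smooth $G$-equivariant lifts of $\tau$. Let $\mathcal A^{\widehat\tau}(Q)$ be the set of $\widehat\tau$-positive connections. *Operators.* Let $\mathcal R_n(\mathsf C)$ be the space of linear differential operators $L$ of order $n$ from $\tfrac{1-n}2$-densities to $\tfrac{1+n}2$-densities on $\mathsf C$ with principal symbol $1$ and subprincipal symbol $0$; in every oriented local coordinate, $L=\frac{d^n}{dt^n}+\sum_{i=0}^{n-2}a_i(t)\frac{d^i}{dt^i}$. *Gauge group.* Let $\mathrm{Gau}(Q,\tau)$ be the group of smooth gauge transformations $u$ of $Q$ with $\tau\circ u^{-1}=\tau$, acting on connections by $u\cdot\theta=(u^{-1})^*\theta$, and let $\mathrm{Gau}_{\mathsf o}(Q,\tau)$ be its identity component (the elements connected to $1$ by a smooth path in $\mathrm{Gau}(Q,\tau)$). Then: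 1. $\mathrm{Gau}_{\mathsf o}(Q,\tau)$ preserves $\mathcal A^{\widehat\tau}(Q)$ and acts freely on it. 2. For every $\theta\in\mathcal A^{\widehat\tau}(Q)$ there is a unique $p(\theta)=L\in\mathcal R_n(\mathsf C)$ such that, whenever $\tau\circ s=(u_1:\cdots:u_n)$ for a $\theta$-horizontal local section $s$, written in an oriented local coordinate with constant Wronskian $W_n(u_1,\dots,u_n)>0$, one has $$L(u)=(-1)^n\,\frac{W_{n+1}(u,u_1,\dots,u_n)}{W_n(u_1,\dots,u_n)}.$$ The map $p\colon\mathcal A^{\widehat\tau}(Q)\to\mathcal R_n(\mathsf C)$ is the quotient map for the action of $\mathrm{Gau}_{\mathsf o}(Q,\tau)$: it is surjective, and its fibres are exactly the orbits. 3. The action admits a global section. There exist an oriented coordinate $\mathsf C\cong\mathbb R/\mathbb Z$, given by a map $t\mapsto c(t)$, and a global smooth section $e$ of $Q$ with $\widehat\tau\circ e=\widehat v_0$. For every such $c$ and $e$ there is a map $\sigma\colon\mathcal R_n(\mathsf C)\to\mathcal A^{\widehat\tau}(Q)$ with $p\circ\sigma=\mathrm{id}$ such that, for $L=\frac{d^n}{dt^n}+\sum_{i=0}^{n-2}a_i(t)\frac{d^i}{dt^i}$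 in the coordinate $t$, $$e^*\sigma(L)=\begin{pmatrix}0&\cdots&\cdots&0&-a_0\\1&\cdots&\cdots&0&-a_1\\0&1&\cdots&0&-a_2\\ \cdots&\cdots&\cdots&\cdots&\cdots\\0&0&\cdots&0&-a_{n-2}\\0&0&\cdots&1&0\end{pmatrix}dt ,$$ and the image of $\sigma$ consists of all connections whose connection form $e^*\theta$ is of this companion form. -/

import Mathlib

open scoped Manifold ContDiff RightActions

noncomputable section

namespace DrinfeldSokolov

/-! ## Linear algebra: the group, the sphere, oriented flags -/

/-- The group `SL(n, ℝ)`. -/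
abbrev SL (n : ℕ) := Matrix.SpecialLinearGroup (Fin n) ℝ

/-- The sphere `S^{n-1}`: nonzero vectors of `ℝⁿ` modulo multiplication by positive scalars. -/
abbrev Sphere (n : ℕ) := Module.Ray ℝ (Fin n → ℝ)

/-- The action of `SL(n, ℝ)` on `S^{n-1}`. -/
def sphereAct {n : ℕ} (g : SL n) (x : Sphere n) : Sphere n :=
  Module.Ray.map (Matrix.SpecialLinearGroup.toLin' g) x

/-- `v` is a nonzero vector representing the point `x` of the sphere. -/
def Represents {n : ℕ} (v : Fin n → ℝ) (x : Sphere n) : Prop :=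
  ∃ h : v ≠ 0, rayOfNeZero ℝ v h = x

/-- Upper triangular matrices with positive diagonal entries. -/
def IsPosUpper {n : ℕ} (b : Matrix (Fin n) (Fin n) ℝ) : Prop :=
  (∀ i j, j < i → b i j = 0) ∧ ∀ i, 0 < b i i

lemma IsPosUpper.mul {n : ℕ} {a b : Matrix (Fin n) (Fin n) ℝ} (ha : IsPosUpper a)
    (hb : IsPosUpper b) : IsPosUpper (a * b) := by
  refine ⟨fun i j hij => ?_, fun i => ?_⟩
  · rw [Matrix.mul_apply]
    refine Finset.sum_eq_zero fun k _ => ?_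
    by_cases hki : k < i
    · rw [ha.1 i k hki, zero_mul]
    · rw [hb.1 k j (lt_of_lt_of_le hij (not_lt.mp hki)), mul_zero]
  · rw [Matrix.mul_apply, Finset.sum_eq_single i]
    · exact mul_pos (ha.2 i) (hb.2 i)
    · intro k _ hk
      rcases lt_or_gt_of_ne hk with h | h
      · rw [ha.1 i k h, zero_mul]
      · rw [hb.1 k i h, mul_zero]
    · intro h
      exact absurd (Finset.mem_univ i) h

lemma IsPosUpper.inv {n : ℕ} {b : SL n} (hb : IsPosUpper b.1) : IsPosUpper (b⁻¹).1 := by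
  have htri : Matrix.BlockTriangular b.1 id := fun i j hij => hb.1 i j hij
  have hmul : b.1 * (b⁻¹).1 = 1 := by
    rw [← Matrix.SpecialLinearGroup.coe_mul, mul_inv_cancel, Matrix.SpecialLinearGroup.coe_one]
  have hinv : (b.1)⁻¹ = (b⁻¹).1 := Matrix.inv_eq_right_inv hmul
  have : Invertible b.1 := invertibleOfRightInverse _ _ hmul
  have htri' : Matrix.BlockTriangular (b⁻¹).1 id := by
    rw [← hinv]
    exact Matrix.blockTriangular_inv_of_blockTriangular htri
  refine ⟨fun i j hij => htri' hij, fun i => ?_⟩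
  have hii : b.1 i i * (b⁻¹).1 i i = 1 := by
    have h1 := congrFun (congrFun hmul i) i
    rw [Matrix.mul_apply, Finset.sum_eq_single i] at h1
    · simpa using h1
    · intro k _ hk
      rcases lt_or_gt_of_ne hk with h | h
      · rw [hb.1 i k h, zero_mul]
      · rw [htri' h, mul_zero]
    · intro h
      exact absurd (Finset.mem_univ i) h
  exact pos_of_mul_pos_right (by rw [hii]; exact one_pos) (hb.2 i).le

/-- The group `B = AN` of upper triangular matrices in `SL(n, ℝ)` with positive diagonal: the
stabilizer of the standard oriented flag. -/
def borel (n : ℕ) : Subgroup (SL n) where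
  carrier := {b | IsPosUpper b.1}
  mul_mem' ha hb := by
    rw [Set.mem_ofPred_eq, Matrix.SpecialLinearGroup.coe_mul]
    exact IsPosUpper.mul ha hb
  one_mem' := by
    refine ⟨fun i j hij => ?_, fun i => ?_⟩
    · rw [Matrix.SpecialLinearGroup.coe_one, Matrix.one_apply_ne (ne_of_gt hij)]
    · rw [Matrix.SpecialLinearGroup.coe_one, Matrix.one_apply_eq]
      exact one_pos
  inv_mem' hb := IsPosUpper.inv hb

/-- The manifold `Fl⁺(ℝⁿ) = G / B` of oriented flags in `ℝⁿ` (with the standard orientation of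
`ℝⁿ`). The class of `g` is the flag whose `i`-th oriented subspace has the first `i` columns of `g`
as an oriented basis. -/
abbrev OrientedFlag (n : ℕ) := SL n ⧸ borel n

/-- The standard flag, with `i`-th subspace spanned by `e₁, …, eᵢ`. -/
def standardFlag (n : ℕ) : OrientedFlag n := ((1 : SL n) : OrientedFlag n)

/-- The flag `F` has as its `i`-th oriented subspace the one with the first `i` columns of the
matrix `W` as an oriented basis. -/
def SpansFlag {n : ℕ} (W : Matrix (Fin n) (Fin n) ℝ) (F : OrientedFlag n) : Prop :=
  ∃ g : SL n, ∃ b : Matrix (Fin n) (Fin n) ℝ, IsPosUpper b ∧ W = g.1 * b ∧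
    (g : OrientedFlag n) = F

/-- The projection `Fl⁺(ℝⁿ) → S^{n-1}`, as a relation: `x` is the ray which is the first oriented
subspace of the flag `F`. -/
def FlagOver {n : ℕ} (F : OrientedFlag n) (x : Sphere n) : Prop :=
  ∃ g : SL n, (g : OrientedFlag n) = F ∧ ∀ i : Fin n, i.1 = 0 → Represents (fun k => g.1 k i) x

/-! ## Oriented one-dimensional manifolds, densities, differential operators -/

section Manifolds

variable {E H M : Type*} [NormedAddCommGroup E] [NormedSpace ℝ E] [TopologicalSpace H]
  [TopologicalSpace M] [ChartedSpace H M]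

/-- Smoothness on `S` of a map into `SL(n, ℝ)`. -/
def SmoothSLOn (I : ModelWithCorners ℝ E H) {n : ℕ} (g : M → SL n) (S : Set M) : Prop :=
  ∀ i j, ContMDiffOn I 𝓘(ℝ, ℝ) ∞ (fun x => (g x).1 i j) S

/-- Smoothness on `S` of a map into the manifold of oriented flags `G / B`: it lifts to a smooth map
into `G` (the projection `G → G / B` has a global smooth section, given by Gram-Schmidt). -/
def SmoothFlagOn (I : ModelWithCorners ℝ E H) {n : ℕ} (F : M → OrientedFlag n) (S : Set M) :
    Prop :=
  ∃ g : M → SL n, SmoothSLOn I g S ∧ ∀ x ∈ S, (g x : OrientedFlag n) = F x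

/-- `v` is a smooth lift on `S`, to `ℝⁿ - {0}`, of the map `f` into the sphere. -/
def IsLiftOn (I : ModelWithCorners ℝ E H) {n : ℕ} (f : M → Sphere n) (v : M → Fin n → ℝ)
    (S : Set M) : Prop :=
  (∀ i, ContMDiffOn I 𝓘(ℝ, ℝ) ∞ (fun x => v x i) S) ∧ ∀ x ∈ S, Represents (v x) (f x)

lemma SmoothSLOn.mul {I : ModelWithCorners ℝ E H} {n : ℕ} {g h : M → SL n} {S : Set M}
    (hg : SmoothSLOn I g S) (hh : SmoothSLOn I h S) :
    SmoothSLOn I (fun x => g x * h x) S := by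
  intro i j
  have : (fun x => (g x * h x).1 i j) = fun x => ∑ k, (g x).1 i k * (h x).1 k j := by
    funext x
    rw [Matrix.SpecialLinearGroup.coe_mul, Matrix.mul_apply]
  rw [this]
  exact contMDiffOn_finsetSum fun k _ => (hg i k).mul (hh k j)

lemma SmoothSLOn.inv {I : ModelWithCorners ℝ E H} {n : ℕ} {g : M → SL n} {S : Set M}
    (hg : SmoothSLOn I g S) : SmoothSLOn I (fun x => (g x)⁻¹) S := by
  intro i j
  have : (fun x => ((g x)⁻¹).1 i j) = fun x =>
      ∑ σ : Equiv.Perm (Fin n), ((Equiv.Perm.sign σ : ℤ) : ℝ) *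
        ∏ k, ((g x).1.updateRow j (Pi.single i 1)) (σ k) k := by
    funext x
    rw [Matrix.SpecialLinearGroup.coe_inv, Matrix.adjugate_apply, Matrix.det_apply']
  rw [this]
  refine contMDiffOn_finsetSum fun σ _ => contMDiffOn_const.mul ?_
  refine contMDiffOn_finsetProd fun k _ => ?_
  by_cases h : σ k = j
  · simp only [h, Matrix.updateRow_self]
    exact contMDiffOn_const
  · simp only [Matrix.updateRow_ne h]
    exact hg _ _

end Manifolds

section Circle

variable (C : Type*) [TopologicalSpace C] [ChartedSpace ℝ C]

/-- An orientation of the smooth one-dimensional manifold `C`: a maximal set of smooth charts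
covering `C` (the oriented local coordinates) with orientation preserving changes of coordinates. -/
structure Orientation where
  charts : Set (OpenPartialHomeomorph C ℝ)
  smooth : charts ⊆ IsManifold.maximalAtlas 𝓘(ℝ, ℝ) ∞ C
  cover : ∀ x : C, ∃ φ ∈ charts, x ∈ φ.source
  pos : ∀ φ ∈ charts, ∀ ψ ∈ charts, ∀ x ∈ φ.source ∩ ψ.source, 0 < deriv (ψ ∘ φ.symm) (φ x)
  maximal : ∀ φ ∈ IsManifold.maximalAtlas 𝓘(ℝ, ℝ) ∞ C,
    (∀ ψ ∈ charts, ∀ x ∈ φ.source ∩ ψ.source, 0 < deriv (ψ ∘ φ.symm) (φ x)) → φ ∈ charts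

variable {C}

/-- The space of smooth `r`-densities on `C`. A density is given by its coefficient functions `f φ`,
on the range of each oriented chart `φ`, representing `f φ |dφ|^r`; these are extended by zero to
all of `ℝ`. -/
def Density (o : Orientation C) (r : ℝ) : Submodule ℝ (o.charts → ℝ → ℝ) where
  carrier := {f |
    (∀ φ, ContDiffOn ℝ ∞ (f φ) φ.1.target) ∧
    (∀ φ, ∀ t ∉ φ.1.target, f φ t = 0) ∧
    ∀ φ ψ : o.charts, ∀ x ∈ φ.1.source ∩ ψ.1.source,
      f φ (φ.1 x) = f ψ (ψ.1 x) * |deriv (ψ.1 ∘ φ.1.symm) (φ.1 x)| ^ r}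
  add_mem' := by
    rintro f g ⟨hf1, hf2, hf3⟩ ⟨hg1, hg2, hg3⟩
    refine ⟨fun φ => (hf1 φ).add (hg1 φ), fun φ t ht => ?_, fun φ ψ x hx => ?_⟩
    · simp [hf2 φ t ht, hg2 φ t ht]
    · simp only [Pi.add_apply, hf3 φ ψ x hx, hg3 φ ψ x hx]
      ring
  zero_mem' := by
    refine ⟨fun φ => contDiffOn_const, fun φ t ht => rfl, fun φ ψ x hx => ?_⟩
    simp
  smul_mem' := by
    rintro c f ⟨hf1, hf2, hf3⟩
    refine ⟨fun φ => (hf1 φ).const_smul c, fun φ t ht => ?_, fun φ ψ x hx => ?_⟩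
    · simp [hf2 φ t ht]
    · simp only [Pi.smul_apply, smul_eq_mul, hf3 φ ψ x hx]
      ring

/-- In the local coordinate `φ`, the operator `L` between densities is the differential operator
`∑_{i ≤ n} aᵢ(t) dⁱ/dtⁱ`. -/
def HasLocalForm {o : Orientation C} {r s : ℝ} (L : Density o r →ₗ[ℝ] Density o s) (n : ℕ)
    (φ : o.charts) (a : ℕ → ℝ → ℝ) : Prop :=
  ∀ u : Density o r, ∀ t ∈ φ.1.target,
    (L u).1 φ t = ∑ i ∈ Finset.range (n + 1), a i t * iteratedDeriv i (u.1 φ) t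

/-- The Adler-Gelfand-Dikii space `R_n(C)`: differential operators of order `n` from
`(1-n)/2`-densities to `(1+n)/2`-densities, with principal symbol `1` and subprincipal symbol `0`.
Since the leading coefficient is the constant `1`, and `L` and its adjoint act between the same
spaces, the subprincipal symbol is the coefficient of order `n - 1` in any local coordinate. -/
def AGD (n : ℕ) (o : Orientation C) : Set
    (Density o ((1 - (n : ℝ)) / 2) →ₗ[ℝ] Density o ((1 + (n : ℝ)) / 2)) :=
  {L | ∀ φ : o.charts, ∃ a : ℕ → ℝ → ℝ,
    (∀ i ≤ n, ContDiffOn ℝ ∞ (a i) φ.1.target) ∧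
    (∀ t ∈ φ.1.target, a n t = 1) ∧ (∀ t ∈ φ.1.target, a (n - 1) t = 0) ∧
    HasLocalForm L n φ a}

/-- The matrix with columns `w, w', …, w^{(m-1)}` at `t`. -/
def jet {m : ℕ} (w : ℝ → Fin m → ℝ) (t : ℝ) : Matrix (Fin m) (Fin m) ℝ :=
  Matrix.of fun i k => iteratedDeriv k.1 (fun s => w s i) t

/-- The Wronskian determinant `W_m(w₁, …, w_m)` at `t`. -/
def wronskian {m : ℕ} (w : ℝ → Fin m → ℝ) (t : ℝ) : ℝ := (jet w t).det

/-- A global oriented coordinate `C ≅ ℝ / ℤ`, given as a map `c : ℝ → C`: surjective, with fibres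
the classes modulo `ℤ`, and locally the inverse of oriented charts. -/
structure IsCoordinate (o : Orientation C) (c : ℝ → C) : Prop where
  surjective : Function.Surjective c
  eq_iff : ∀ t t', c t = c t' ↔ ∃ k : ℤ, t' = t + k
  local_inverse : ∀ t, ∃ φ ∈ o.charts, t ∈ φ.target ∧ ∀ t' ∈ φ.target, φ.symm t' = c t'

/-- The functions `a₀, …, a_n` are the coefficients of the operator `L` in the global oriented
coordinate `c`. -/
def HasCoefficients {o : Orientation C} {r s : ℝ} (L : Density o r →ₗ[ℝ] Density o s) (n : ℕ)
    (c : ℝ → C) (a : ℕ → ℝ → ℝ) : Prop :=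
  ∀ φ : o.charts, (∀ t ∈ φ.1.target, φ.1.symm t = c t) → HasLocalForm L n φ a

end Circle

/-- The Drinfeld-Sokolov normal form: the companion matrix with `1` below the diagonal, last column
`-a₀, …, -a_{n-2}, 0`, and all other entries zero. -/
def companion (n : ℕ) (a : ℕ → ℝ) : Matrix (Fin n) (Fin n) ℝ :=
  Matrix.of fun i j =>
    if i.1 = j.1 + 1 then 1 else if j.1 + 1 = n ∧ i.1 + 1 < n then -a i.1 else 0

/-! ## Principal bundles, connections, gauge transformations -/

variable {n : ℕ} {C : Type*} [TopologicalSpace C] [ChartedSpace ℝ C] {Q : Type*}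

open Classical in
/-- The element `g` with `q' = q g`, for points `q, q'` in the same fibre. -/
def translation [MulAction (SL n)ᵐᵒᵖ Q] (q q' : Q) : SL n :=
  if h : ∃ g : SL n, q' = q <• g then h.choose else 1

lemma perm_apply_inv (u : Equiv.Perm Q) (q : Q) : u (u⁻¹ q) = q :=
  u.apply_symm_apply q

/-- The gauge transformation formula: the value at `x` of the 1-form `g⁻¹ A g + g⁻¹ dg`. -/
def gaugeTransform (g : C → SL n) (x : C)
    (A : TangentSpace 𝓘(ℝ, ℝ) x →ₗ[ℝ] Matrix (Fin n) (Fin n) ℝ) (X : TangentSpace 𝓘(ℝ, ℝ) x) :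
    Matrix (Fin n) (Fin n) ℝ :=
  (g x)⁻¹.1 * A X * (g x).1 +
    (g x)⁻¹.1 * Matrix.of fun i j => mfderiv 𝓘(ℝ, ℝ) 𝓘(ℝ, ℝ) (fun y => (g y).1 i j) x X

/-- A smooth principal `SL(n, ℝ)`-bundle with total space `Q` over `C`. The group acts on the right
on `Q`, simply transitively on the fibres of the projection; the smooth structure is given by an
atlas of local sections (equivalently, local trivializations) with smooth transition functions. -/
structure PrincipalBundle (n : ℕ) (C Q : Type*) [TopologicalSpace C] [ChartedSpace ℝ C]
    [MulAction (SL n)ᵐᵒᵖ Q] where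
  proj : Q → C
  proj_smul : ∀ q (g : SL n), proj (q <• g) = proj q
  existsUnique_smul : ∀ q q' : Q, proj q = proj q' → ∃! g : SL n, q' = q <• g
  atlas : Set (Set C × (C → Q))
  isOpen : ∀ e ∈ atlas, IsOpen e.1
  proj_section : ∀ e ∈ atlas, ∀ x ∈ e.1, proj (e.2 x) = x
  cover : ∀ x : C, ∃ e ∈ atlas, x ∈ e.1
  smooth : ∀ e ∈ atlas, ∀ e' ∈ atlas,
    SmoothSLOn 𝓘(ℝ, ℝ) (fun x => translation (n := n) (e.2 x) (e'.2 x)) (e.1 ∩ e'.1)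

namespace PrincipalBundle

variable [MulAction (SL n)ᵐᵒᵖ Q] (P : PrincipalBundle n C Q)

/-- `s` is a smooth section of the bundle over the open set `U`. -/
structure IsSmoothSection (U : Set C) (s : C → Q) : Prop where
  isOpen : IsOpen U
  proj : ∀ x ∈ U, P.proj (s x) = x
  smooth : ∀ e ∈ P.atlas,
    SmoothSLOn 𝓘(ℝ, ℝ) (fun x => translation (n := n) (e.2 x) (s x)) (U ∩ e.1)

/-- Smooth local sections of the bundle. (The values of the function `val` outside of the open set
`dom` are irrelevant.) -/
structure LocalSection where
  dom : Set C
  val : C → Q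
  isSmooth : P.IsSmoothSection dom val

/-- Smooth `G`-equivariant maps `τ : Q → S^{n-1}`; for the right action on `Q` equivariance reads
`τ(q g) = g⁻¹ · τ(q)`. -/
structure IsSphereMap (τ : Q → Sphere n) : Prop where
  equivariant : ∀ q (g : SL n), τ (q <• g) = sphereAct g⁻¹ (τ q)
  smooth : ∀ s : P.LocalSection, ∃ v : C → Fin n → ℝ,
    IsLiftOn 𝓘(ℝ, ℝ) (fun x => τ (s.val x)) v s.dom

/-- Smooth `G`-equivariant lifts `Q → Fl⁺(ℝⁿ)` of `τ : Q → S^{n-1}`. -/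
structure IsFlagLift (τ : Q → Sphere n) (T : Q → OrientedFlag n) : Prop where
  equivariant : ∀ q (g : SL n), T (q <• g) = g⁻¹ • T q
  smooth : ∀ s : P.LocalSection, SmoothFlagOn 𝓘(ℝ, ℝ) (fun x => T (s.val x)) s.dom
  lift : ∀ q, FlagOver (T q) (τ q)

/-- Homotopy of lifts of `τ`: there is a smooth family, parametrized by `ℝ`, of smooth
`G`-equivariant lifts of `τ`, equal to the two given ones at the parameter values `0` and `1`. -/
def LiftHomotopic (τ : Q → Sphere n) (T₀ T₁ : Q → OrientedFlag n) : Prop :=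
  ∃ F : ℝ → Q → OrientedFlag n, F 0 = T₀ ∧ F 1 = T₁ ∧ (∀ l, P.IsFlagLift τ (F l)) ∧
    ∀ s : P.LocalSection, SmoothFlagOn (𝓘(ℝ, ℝ).prod 𝓘(ℝ, ℝ))
      (fun z : ℝ × C => F z.1 (s.val z.2)) (Set.univ ×ˢ s.dom)

/-- Principal connections `θ`, given by the `sl(n, ℝ)`-valued 1-forms `s^*θ` on the domains of the
smooth local sections `s`, subject to `(s g)^*θ = g⁻¹ (s^*θ) g + g⁻¹ dg`. (The form is extended by
zero outside of the domain of `s`.) -/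
@[ext]
structure Connection where
  form : P.LocalSection → ∀ x : C,
    TangentSpace 𝓘(ℝ, ℝ) x →ₗ[ℝ] Matrix (Fin n) (Fin n) ℝ
  form_of_notMem : ∀ s, ∀ x ∉ s.dom, form s x = 0
  trace_form : ∀ s x X, (form s x X).trace = 0
  smooth : ∀ s, ∀ φ ∈ IsManifold.maximalAtlas 𝓘(ℝ, ℝ) ∞ C, ∀ i j,
    ContDiffOn ℝ ∞
      (fun t : ℝ => form s (φ.symm t) (mfderiv 𝓘(ℝ, ℝ) 𝓘(ℝ, ℝ) φ.symm t (1 : ℝ)) i j)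
      (φ.target ∩ φ.symm ⁻¹' s.dom)
  transform : ∀ s s' : P.LocalSection, ∀ x ∈ s.dom ∩ s'.dom, ∀ X : TangentSpace 𝓘(ℝ, ℝ) x,
    form s' x X =
      gaugeTransform (fun y => translation (n := n) (s.val y) (s'.val y)) x (form s x) X

/-- The group `Gau(Q)` of gauge transformations: `G`-equivariant bijections of `Q` covering the
identity of `C`, smooth together with their inverses. -/
def gauge : Subgroup (Equiv.Perm Q) where
  carrier := {u | (∀ q (g : SL n), u (q <• g) = u q <• g) ∧ (∀ q, P.proj (u q) = P.proj q) ∧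
    ∀ U s, P.IsSmoothSection U s →
      P.IsSmoothSection U (fun x => u (s x)) ∧ P.IsSmoothSection U (fun x => u⁻¹ (s x))}
  mul_mem' := by
    rintro u v ⟨hu1, hu2, hu3⟩ ⟨hv1, hv2, hv3⟩
    refine ⟨fun q g => ?_, fun q => ?_, fun U s hs => ⟨?_, ?_⟩⟩
    · simp only [Equiv.Perm.mul_apply, hv1, hu1]
    · simp only [Equiv.Perm.mul_apply, hu2, hv2]
    · exact (hu3 U _ (hv3 U s hs).1).1
    · simp only [mul_inv_rev]
      exact (hv3 U _ (hu3 U s hs).2).2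
  one_mem' := by
    refine ⟨fun q g => rfl, fun q => rfl, fun U s hs => ⟨hs, ?_⟩⟩
    simpa using hs
  inv_mem' := by
    rintro u ⟨hu1, hu2, hu3⟩
    refine ⟨fun q g => ?_, fun q => ?_, fun U s hs => ⟨(hu3 U s hs).2, ?_⟩⟩
    · apply u.injective
      rw [hu1, perm_apply_inv, perm_apply_inv]
    · rw [← hu2 (u⁻¹ q), perm_apply_inv]
    · simpa using (hu3 U s hs).1

variable {P}

open Classical in
lemma translation_gauge (u : P.gauge) (q q' : Q) :
    translation (n := n) (u.1 q) (u.1 q') = translation (n := n) q q' := by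
  have h : ∀ g : SL n, u.1 q' = u.1 q <• g ↔ q' = q <• g := fun g => by
    rw [← u.2.1 q g, u.1.injective.eq_iff]
  unfold translation
  have h2 : (fun g : SL n => u.1 q' = u.1 q <• g) = fun g => q' = q <• g :=
    funext fun g => propext (h g)
  have aux : ∀ p p' : SL n → Prop, p = p' →
      (if h : ∃ g, p g then h.choose else 1) = (if h : ∃ g, p' g then h.choose else 1) := by
    rintro p _ rfl
    rfl
  exact aux _ _ h2

lemma smul_translation (q q' : Q) (h : P.proj q = P.proj q') :
    q' = q <• translation (n := n) q q' := by
  have hex : ∃ g : SL n, q' = q <• g := (P.existsUnique_smul q q' h).exists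
  unfold translation
  rw [dif_pos hex]
  exact hex.choose_spec

lemma translation_unique (P : PrincipalBundle n C Q) {q q' : Q} {g : SL n} (h : q' = q <• g) :
    translation (n := n) q q' = g := by
  have hp : P.proj q = P.proj q' := by rw [h, P.proj_smul]
  exact (P.existsUnique_smul q q' hp).unique (smul_translation q q' hp) h

/-- The local section `u ∘ s`. -/
def LocalSection.map (u : P.gauge) (s : P.LocalSection) : P.LocalSection where
  dom := s.dom
  val := fun x => u.1 (s.val x)
  isSmooth := (u.2.2.2 s.dom s.val s.isSmooth).1

/-- The action `u · θ = (u⁻¹)^*θ` of gauge transformations on connections. -/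
instance : MulAction P.gauge P.Connection where
  smul u θ :=
    { form := fun s => θ.form (s.map u⁻¹)
      form_of_notMem := fun s => θ.form_of_notMem (s.map u⁻¹)
      trace_form := fun s => θ.trace_form (s.map u⁻¹)
      smooth := fun s => θ.smooth (s.map u⁻¹)
      transform := fun s s' x hx X => by
        have h := θ.transform (s.map u⁻¹) (s'.map u⁻¹) x hx X
        have hT : (fun y => translation (n := n) ((s.map u⁻¹).val y) ((s'.map u⁻¹).val y)) =
            fun y => translation (n := n) (s.val y) (s'.val y) :=
          funext fun y => translation_gauge u⁻¹ _ _
        rw [hT] at h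
        exact h }
  one_smul θ := by
    apply Connection.ext
    funext s
    change θ.form (s.map (1 : P.gauge)⁻¹) = θ.form s
    rw [inv_one]
    rfl
  mul_smul u v θ := by
    apply Connection.ext
    funext s
    change θ.form (s.map (u * v)⁻¹) = θ.form ((s.map u⁻¹).map v⁻¹)
    rw [mul_inv_rev]
    rfl

variable (P)

/-- The group `Gau(Q, τ)` of gauge transformations fixing `τ`. -/
def gaugeFixing (τ : Q → Sphere n) : Subgroup P.gauge where
  carrier := {u | ∀ q, τ (u⁻¹.1 q) = τ q}
  mul_mem' := by
    intro u v hu hv q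
    rw [mul_inv_rev]
    exact (hv (u⁻¹.1 q)).trans (hu q)
  one_mem' := by
    intro q
    rw [inv_one]
    rfl
  inv_mem' := by
    intro u hu q
    rw [inv_inv]
    have h := hu (u.1 q)
    have h2 : u⁻¹.1 (u.1 q) = q := u.1.symm_apply_apply q
    rw [h2] at h
    exact h.symm

/-- Smooth paths of gauge transformations, parametrized by `ℝ`: relative to any smooth local
section `s`, the path is given by a jointly smooth function `g(l, x)` with
`u_l(s(x)) = s(x) g(l, x)`. -/
def IsSmoothPath (U : ℝ → P.gauge) : Prop :=
  ∀ s : P.LocalSection, SmoothSLOn (𝓘(ℝ, ℝ).prod 𝓘(ℝ, ℝ))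
    (fun z : ℝ × C => translation (n := n) (s.val z.2) ((U z.1).1 (s.val z.2)))
    (Set.univ ×ˢ s.dom)

/-- The identity component `Gau_o(Q, τ)` of the (infinite-dimensional Lie) group `Gau(Q, τ)`: the
elements which are connected to the identity by a smooth path in `Gau(Q, τ)`. -/
def gaugeFixingIdentity (τ : Q → Sphere n) : Subgroup P.gauge where
  carrier := {u | ∃ U : ℝ → P.gauge, U 0 = 1 ∧ U 1 = u ∧ (∀ l, U l ∈ P.gaugeFixing τ) ∧
    P.IsSmoothPath U}
  mul_mem' := by
    rintro u v ⟨U, hU0, hU1, hU2, hU3⟩ ⟨V, hV0, hV1, hV2, hV3⟩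
    refine ⟨fun l => U l * V l, by simp [hU0, hV0], by simp [hU1, hV1],
      fun l => mul_mem (hU2 l) (hV2 l), fun s => ?_⟩
    intro i j
    refine ((SmoothSLOn.mul (hU3 s) (hV3 s)) i j).congr fun z _ => ?_
    have hU := smul_translation (P := P) (s.val z.2) ((U z.1).1 (s.val z.2))
      ((U z.1).2.2.1 _).symm
    have hV := smul_translation (P := P) (s.val z.2) ((V z.1).1 (s.val z.2))
      ((V z.1).2.2.1 _).symm
    have key : (U z.1 * V z.1).1 (s.val z.2) = s.val z.2 <•
        (translation (n := n) (s.val z.2) ((U z.1).1 (s.val z.2)) *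
          translation (n := n) (s.val z.2) ((V z.1).1 (s.val z.2))) := by
      change (U z.1).1 ((V z.1).1 (s.val z.2)) = _
      rw [MulOpposite.op_mul, mul_smul, ← hU, ← (U z.1).2.1, ← hV]
    exact congrArg (fun g : SL n => g.1 i j) (translation_unique P key)
  one_mem' := by
    refine ⟨fun _ => 1, rfl, rfl, fun _ => one_mem _, fun s i j => ?_⟩
    have : ∀ q : Q, translation (n := n) q ((1 : P.gauge).1 q) = 1 := fun q =>
      translation_unique P (by
        rw [MulOpposite.op_one, one_smul]
        rfl)
    simp only [this]
    exact contMDiffOn_const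
  inv_mem' := by
    rintro u ⟨U, hU0, hU1, hU2, hU3⟩
    refine ⟨fun l => (U l)⁻¹, by simp [hU0], by simp [hU1], fun l => inv_mem (hU2 l),
      fun s => ?_⟩
    intro i j
    refine ((SmoothSLOn.inv (hU3 s)) i j).congr fun z _ => ?_
    have hU := smul_translation (P := P) (s.val z.2) ((U z.1).1 (s.val z.2))
      ((U z.1).2.2.1 _).symm
    have key : (U z.1)⁻¹.1 (s.val z.2) = s.val z.2 <•
        (translation (n := n) (s.val z.2) ((U z.1).1 (s.val z.2)))⁻¹ := by
      apply (U z.1).1.injective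
      rw [(U z.1).2.1]
      have h1 : (U z.1).1 ((U z.1)⁻¹.1 (s.val z.2)) = s.val z.2 :=
        perm_apply_inv (U z.1).1 _
      rw [h1, eq_comm, MulOpposite.op_inv, inv_smul_eq_iff]
      exact hU
    exact congrArg (fun g : SL n => g.1 i j) (translation_unique P key)

/-! ## Positive connections and their differential operators -/

variable {P}

/-- The local section `s` is `θ`-horizontal. -/
def Connection.IsHorizontal (θ : P.Connection) (s : P.LocalSection) : Prop :=
  ∀ x ∈ s.dom, θ.form s x = 0

/-- The map `τ` restricts to (positive) nondegenerate curves `γ = τ ∘ s` on the horizontal leaves of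
`θ`: `γ` lifts to a curve `v` in `ℝⁿ - {0}` such that, in any oriented local coordinate, the
derivatives `v, v', …, v^{(n-1)}` form an oriented basis. -/
def Connection.IsNondegenerate (o : Orientation C) (τ : Q → Sphere n) (θ : P.Connection) : Prop :=
  ∀ s : P.LocalSection, θ.IsHorizontal s →
    ∃ v : C → Fin n → ℝ, IsLiftOn 𝓘(ℝ, ℝ) (fun x => τ (s.val x)) v s.dom ∧
      ∀ φ ∈ o.charts, ∀ x ∈ s.dom ∩ φ.source, 0 < (jet (fun t => v (φ.symm t)) (φ x)).det

/-- `T : Q → Fl⁺(ℝⁿ)` is the lift of `τ` determined by `θ`: along horizontal sections `s` the `i`-th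
subspace of the flag is spanned by the derivatives up to order `i - 1` of the curve `τ ∘ s`. -/
def Connection.IsDerivedLift (o : Orientation C) (τ : Q → Sphere n) (θ : P.Connection)
    (T : Q → OrientedFlag n) : Prop :=
  ∀ s : P.LocalSection, θ.IsHorizontal s →
    ∀ v : C → Fin n → ℝ, IsLiftOn 𝓘(ℝ, ℝ) (fun x => τ (s.val x)) v s.dom →
      ∀ φ ∈ o.charts, ∀ x ∈ s.dom ∩ φ.source,
        SpansFlag (jet (fun t => v (φ.symm t)) (φ x)) (T (s.val x))

variable (P)

/-- The space of connections which are positive relative to the lift `T` of `τ`: nondegenerate, and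
such that the lift of `τ` determined by the connection is homotopic to `T`. -/
def positiveConnections (o : Orientation C) (τ : Q → Sphere n) (T : Q → OrientedFlag n) :
    Set P.Connection :=
  {θ | θ.IsNondegenerate o τ ∧ ∃ T' : Q → OrientedFlag n, θ.IsDerivedLift o τ T' ∧
    P.LiftHomotopic τ T' T}

variable {P}

/-- `L` is the operator determined by `θ`: if `γ = (w₁ : … : w_n)` is the curve in the sphere given
by a horizontal section, written in an oriented local coordinate with constant Wronskian
`W_n(w₁, …, w_n) > 0`, then `L(u) = (-1)^n W_{n+1}(u, w₁, …, w_n) / W_n(w₁, …, w_n)`. -/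
def Connection.IsOperator {o : Orientation C} (τ : Q → Sphere n) (θ : P.Connection)
    (L : AGD n o) : Prop :=
  ∀ s : P.LocalSection, θ.IsHorizontal s → ∀ φ : o.charts, ∀ w : ℝ → Fin n → ℝ,
    IsLiftOn 𝓘(ℝ, ℝ) (fun t => τ (s.val (φ.1.symm t))) w (φ.1.target ∩ φ.1.symm ⁻¹' s.dom) →
    (∃ k : ℝ, 0 < k ∧ ∀ t ∈ φ.1.target ∩ φ.1.symm ⁻¹' s.dom, wronskian w t = k) →
    ∀ u : Density o ((1 - (n : ℝ)) / 2), ∀ t ∈ φ.1.target ∩ φ.1.symm ⁻¹' s.dom,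
      (L.1 u).1 φ t = (-1) ^ n *
        wronskian (fun t' => (Fin.cons (u.1 φ t') (w t') : Fin (n + 1) → ℝ)) t / wronskian w t

/-- A global smooth section of `Q` along which `T` is the standard flag; that is, a trivialization
of the reduction `Q_B ⊂ Q` of the structure group defined by `T`. -/
def LocalSection.IsFlagFrame (e : P.LocalSection) (T : Q → OrientedFlag n) : Prop :=
  e.dom = Set.univ ∧ ∀ x, T (e.val x) = standardFlag n

/-- The matrix function `ξ` for which `e^*θ = ξ(t) dt`, in the coordinate `c` on the base. -/
def Connection.matrix (θ : P.Connection) (e : P.LocalSection) (c : ℝ → C) (t : ℝ) :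
    Matrix (Fin n) (Fin n) ℝ :=
  θ.form e (c t) (mfderiv 𝓘(ℝ, ℝ) 𝓘(ℝ, ℝ) c t (1 : ℝ))

end PrincipalBundle

end DrinfeldSokolov

end

open DrinfeldSokolov

noncomputable section

open scoped Matrix

namespace DrinfeldSokolov

/-! ## Iterated covariant derivatives on the line -/

section Line

/-! Fix a global coordinate c of the circle and a global frame e along which the given flag lift is
standard. A connection becomes a periodic trace-free matrix function A(t), and τ is the ray of e₁
along e. Everything is then read off from the Krylov matrix K with columns (A + d/dt)^k e₁. In a
horizontal section the connection matrix is 0, so K is, up to a factor in SL(n) on the left, the jet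
of the curve τ ∘ s (`Connection.jet_frameCurve`). Changing the chart or the lift of the curve
multiplies the jet on the right by an upper triangular matrix with positive diagonal (`jet_change`,
`chgMat_isPosUpper`). Hence nondegeneracy means det K > 0, and the derived flag along e is the one
spanned by the columns of K.

Normal form: rescaling e₁ by (det K)^(-1/n) turns the Krylov matrix into a periodic map k into
SL(n). In the frame e k the vector e₁ has covariant derivatives e₂, …, e_n, so the new connection
matrix has the first n - 1 columns of a companion matrix, and vanishing trace kills the corner entry
(`exists_smul_eq_companion`). The homotopy condition is what joins k to 1: the homotopy of flags
lifts to SL(n), its endpoints differ from k and 1 by elements of B, and elements of B are joined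
through convex combinations of positive triangular matrices (`frameGauge_mem_gaugeFixingIdentity`).
Freeness: if h fixes the ray of e₁ and commutes with A + d/dt, with h e₁ = r e₁, then h K is the
Krylov matrix of r e₁; determinants give r = 1, so h K = K and h = 1 (`eq_one_of_smul_eq`).

Operators: for a companion matrix K = 1, so the components of the horizontal curve have Wronskian 1
and solve L v = 0. A column operation evaluates the bordered Wronskian (`wronskian_cons`), and the
density weights make the result independent of the chart (`Connection.isOperator_of_companion`). A
gauge transformation fixing τ carries horizontal sections to horizontal sections with the same
curve, so the operator is constant on orbits; conversely an operator determines its coefficients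
(`coeff_eq_zero_of_periodic`), hence the companion matrix, hence the orbit.

The coordinate comes from the flow of a positive vector field (`exists_isCoordinate`), the frame
from averaging local frames with a partition of unity (`IsFlagLift.exists_isFlagFrame`). -/

lemma contDiffOn_deriv {F : Type*} [NormedAddCommGroup F] [NormedSpace ℝ F] {S : Set ℝ}
    (hS : IsOpen S) {f : ℝ → F} (hf : ContDiffOn ℝ ∞ f S) : ContDiffOn ℝ ∞ (deriv f) S :=
  ((contDiffOn_infty_iff_deriv_of_isOpen hS).1 hf).2

lemma _root_.ContDiffOn.diffAt {F : Type*} [NormedAddCommGroup F] [NormedSpace ℝ F] {S : Set ℝ}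
    (hS : IsOpen S) {f : ℝ → F} (hf : ContDiffOn ℝ ∞ f S) {t : ℝ} (ht : t ∈ S) :
    DifferentiableAt ℝ f t :=
  (hf.contDiffAt (hS.mem_nhds ht)).differentiableAt (by simp)

/-- Entrywise smoothness of a matrix valued function. -/
def SmoothMat {m : ℕ} (A : ℝ → Matrix (Fin m) (Fin m) ℝ) (S : Set ℝ) : Prop :=
  ∀ i j, ContDiffOn ℝ ∞ (fun t => A t i j) S

/-- Entrywise derivative of a matrix valued function. -/
def matDeriv {m : ℕ} (A : ℝ → Matrix (Fin m) (Fin m) ℝ) (t : ℝ) : Matrix (Fin m) (Fin m) ℝ :=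
  Matrix.of fun i j => deriv (fun s => A s i j) t

lemma SmoothMat.matDeriv {m : ℕ} {A : ℝ → Matrix (Fin m) (Fin m) ℝ} {S : Set ℝ} (hS : IsOpen S)
    (hA : SmoothMat A S) : SmoothMat (matDeriv A) S :=
  fun i j => contDiffOn_deriv hS (hA i j)

lemma SmoothMat.mul {m : ℕ} {A B : ℝ → Matrix (Fin m) (Fin m) ℝ} {S : Set ℝ}
    (hA : SmoothMat A S) (hB : SmoothMat B S) : SmoothMat (fun t => A t * B t) S := by
  intro i j
  simp only [Matrix.mul_apply]
  exact ContDiffOn.sum fun k _ => (hA i k).mul (hB k j)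

lemma SmoothMat.add {m : ℕ} {A B : ℝ → Matrix (Fin m) (Fin m) ℝ} {S : Set ℝ}
    (hA : SmoothMat A S) (hB : SmoothMat B S) : SmoothMat (fun t => A t + B t) S :=
  fun i j => (hA i j).add (hB i j)

lemma SmoothMat.mono {m : ℕ} {A : ℝ → Matrix (Fin m) (Fin m) ℝ} {S T : Set ℝ}
    (hA : SmoothMat A S) (h : T ⊆ S) : SmoothMat A T :=
  fun i j => (hA i j).mono h

lemma SmoothMat.const {m : ℕ} (M : Matrix (Fin m) (Fin m) ℝ) (S : Set ℝ) :
    SmoothMat (fun _ => M) S :=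
  fun _ _ => contDiffOn_const

lemma SmoothMat.mulVec {m : ℕ} {A : ℝ → Matrix (Fin m) (Fin m) ℝ} {v : ℝ → Fin m → ℝ} {S : Set ℝ}
    (hA : SmoothMat A S) (hv : ContDiffOn ℝ ∞ v S) :
    ContDiffOn ℝ ∞ (fun t => A t *ᵥ v t) S := by
  rw [contDiffOn_pi]
  intro i
  simp only [Matrix.mulVec, dotProduct]
  exact ContDiffOn.sum fun k _ => (hA i k).mul (contDiffOn_pi.1 hv k)

lemma matDeriv_mul {m : ℕ} {A B : ℝ → Matrix (Fin m) (Fin m) ℝ} {S : Set ℝ} (hS : IsOpen S)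
    (hA : SmoothMat A S) (hB : SmoothMat B S) {t : ℝ} (ht : t ∈ S) :
    matDeriv (fun t => A t * B t) t = matDeriv A t * B t + A t * matDeriv B t := by
  ext i j
  simp only [matDeriv, Matrix.of_apply, Matrix.mul_apply, Matrix.add_apply]
  rw [← Finset.sum_add_distrib]
  exact (HasDerivAt.fun_sum fun k _ => ((hA i k).diffAt hS ht).hasDerivAt.mul
    ((hB k j).diffAt hS ht).hasDerivAt).deriv

lemma matDeriv_const {m : ℕ} (M : Matrix (Fin m) (Fin m) ℝ) (t : ℝ) :
    matDeriv (fun _ => M) t = 0 := by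
  ext i j
  simp [matDeriv]

lemma matDeriv_congr {m : ℕ} {A B : ℝ → Matrix (Fin m) (Fin m) ℝ} {t : ℝ}
    (h : A =ᶠ[nhds t] B) : matDeriv A t = matDeriv B t := by
  ext i j
  exact Filter.EventuallyEq.deriv_eq (h.fun_comp fun M => M i j)

lemma deriv_mulVec {m : ℕ} {A : ℝ → Matrix (Fin m) (Fin m) ℝ} {v : ℝ → Fin m → ℝ} {S : Set ℝ}
    (hS : IsOpen S) (hA : SmoothMat A S) (hv : ContDiffOn ℝ ∞ v S) {t : ℝ} (ht : t ∈ S) :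
    deriv (fun t => A t *ᵥ v t) t = matDeriv A t *ᵥ v t + A t *ᵥ deriv v t := by
  have hv' := contDiffOn_pi.1 hv
  rw [deriv_pi fun i => (contDiffOn_pi.1 (hA.mulVec hv) i).diffAt hS ht]
  ext i
  rw [deriv_pi fun i => (hv' i).diffAt hS ht]
  simp only [Matrix.mulVec, dotProduct, Pi.add_apply, matDeriv, Matrix.of_apply]
  rw [← Finset.sum_add_distrib]
  exact (HasDerivAt.fun_sum fun k _ => ((hA i k).diffAt hS ht).hasDerivAt.mul
    ((hv' k).diffAt hS ht).hasDerivAt).deriv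

/-- The iterated covariant derivatives `(A + d/dt)ᵏ v`. -/
def kry {m : ℕ} (A : ℝ → Matrix (Fin m) (Fin m) ℝ) (v : ℝ → Fin m → ℝ) : ℕ → ℝ → Fin m → ℝ
  | 0 => v
  | k + 1 => fun t => A t *ᵥ kry A v k t + deriv (kry A v k) t

/-- The matrix with columns `v, (A + d/dt) v, …, (A + d/dt)^(m-1) v`. -/
def kryMat {m : ℕ} (A : ℝ → Matrix (Fin m) (Fin m) ℝ) (v : ℝ → Fin m → ℝ) (t : ℝ) :
    Matrix (Fin m) (Fin m) ℝ :=
  Matrix.of fun i k => kry A v k.1 t i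

lemma contDiffOn_kry {m : ℕ} {A : ℝ → Matrix (Fin m) (Fin m) ℝ} {v : ℝ → Fin m → ℝ} {S : Set ℝ}
    (hS : IsOpen S) (hA : SmoothMat A S) (hv : ContDiffOn ℝ ∞ v S) (k : ℕ) :
    ContDiffOn ℝ ∞ (kry A v k) S := by
  induction k with
  | zero => exact hv
  | succ k ih => exact (hA.mulVec ih).add (contDiffOn_deriv hS ih)

lemma smoothMat_kryMat {m : ℕ} {A : ℝ → Matrix (Fin m) (Fin m) ℝ} {v : ℝ → Fin m → ℝ} {S : Set ℝ}
    (hS : IsOpen S) (hA : SmoothMat A S) (hv : ContDiffOn ℝ ∞ v S) :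
    SmoothMat (kryMat A v) S :=
  fun i k => contDiffOn_pi.1 (contDiffOn_kry hS hA hv k.1) i

/-- The hypothesis A h + h' = h B says that h intertwines the operators A + d/dt and B + d/dt, so it
intertwines their powers. With B = 0 this is passage to a horizontal frame, with B = A it describes
a stabilizer. -/
lemma kry_intertwine {m : ℕ} {A B h : ℝ → Matrix (Fin m) (Fin m) ℝ} {v : ℝ → Fin m → ℝ}
    {S : Set ℝ} (hS : IsOpen S) (hB : SmoothMat B S) (hh : SmoothMat h S)
    (hv : ContDiffOn ℝ ∞ v S) (h_eq : ∀ t ∈ S, A t * h t + matDeriv h t = h t * B t) (k : ℕ) :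
    ∀ t ∈ S, kry A (fun t => h t *ᵥ v t) k t = h t *ᵥ kry B v k t := by
  induction k with
  | zero => exact fun t _ => rfl
  | succ k ih =>
    intro t ht
    have hev : kry A (fun t => h t *ᵥ v t) k =ᶠ[nhds t] fun t => h t *ᵥ kry B v k t :=
      Filter.eventuallyEq_of_mem (hS.mem_nhds ht) ih
    simp only [kry]
    rw [hev.deriv_eq, ih t ht, deriv_mulVec hS hh (contDiffOn_kry hS hB hv k) ht,
      Matrix.mulVec_add, Matrix.mulVec_mulVec, Matrix.mulVec_mulVec, ← h_eq t ht,
      Matrix.add_mulVec, add_assoc]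

lemma kryMat_intertwine {m : ℕ} {A B h : ℝ → Matrix (Fin m) (Fin m) ℝ} {v : ℝ → Fin m → ℝ}
    {S : Set ℝ} (hS : IsOpen S) (hB : SmoothMat B S) (hh : SmoothMat h S)
    (hv : ContDiffOn ℝ ∞ v S) (h_eq : ∀ t ∈ S, A t * h t + matDeriv h t = h t * B t)
    {t : ℝ} (ht : t ∈ S) : kryMat A (fun t => h t *ᵥ v t) t = h t * kryMat B v t := by
  ext i k
  simp only [kryMat, Matrix.of_apply]
  rw [kry_intertwine hS hB hh hv h_eq k.1 t ht]
  rfl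

lemma kry_congr {m : ℕ} {A B : ℝ → Matrix (Fin m) (Fin m) ℝ} {v w : ℝ → Fin m → ℝ} {S : Set ℝ}
    (hS : IsOpen S) (hAB : ∀ t ∈ S, A t = B t) (h : ∀ t ∈ S, v t = w t) (k : ℕ) :
    ∀ t ∈ S, kry A v k t = kry B w k t := by
  induction k with
  | zero => exact h
  | succ k ih =>
    intro t ht
    have hev : kry A v k =ᶠ[nhds t] kry B w k :=
      Filter.eventuallyEq_of_mem (hS.mem_nhds ht) ih
    simp only [kry]
    rw [hev.deriv_eq, ih t ht, hAB t ht]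

lemma kry_zero_apply {m : ℕ} {v : ℝ → Fin m → ℝ} {S : Set ℝ} (hS : IsOpen S)
    (hv : ContDiffOn ℝ ∞ v S) (k : ℕ) :
    ∀ t ∈ S, ∀ i, kry (fun _ => 0) v k t i = iteratedDeriv k (fun s => v s i) t := by
  induction k with
  | zero => exact fun t _ i => by simp [kry]
  | succ k ih =>
    intro t ht i
    have hd := contDiffOn_pi.1 (contDiffOn_kry hS (SmoothMat.const 0 S) hv k)
    rw [iteratedDeriv_succ]
    simp only [kry, Matrix.zero_mulVec, zero_add]
    rw [deriv_pi fun i => (hd i).diffAt hS ht]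
    exact Filter.EventuallyEq.deriv_eq
      (Filter.eventuallyEq_of_mem (hS.mem_nhds ht) fun s hs => ih s hs i)

lemma jet_eq_kryMat {m : ℕ} {v : ℝ → Fin m → ℝ} {S : Set ℝ} (hS : IsOpen S)
    (hv : ContDiffOn ℝ ∞ v S) {t : ℝ} (ht : t ∈ S) : jet v t = kryMat (fun _ => 0) v t := by
  ext i k
  exact (kry_zero_apply hS hv k.1 t ht i).symm

lemma jet_congr {m : ℕ} {v w : ℝ → Fin m → ℝ} {t : ℝ} (h : v =ᶠ[nhds t] w) : jet v t = jet w t := by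
  ext i k
  exact Filter.EventuallyEq.iteratedDeriv_eq k.1 (h.fun_comp fun v => v i)

/-! ### Change of coordinate and rescaling -/

/-- The coefficients `c k j` in `dᵏ/dtᵏ (lam · v ∘ f) = ∑ⱼ c k j · v⁽ʲ⁾ ∘ f`. -/
def chg (lam f : ℝ → ℝ) : ℕ → ℕ → ℝ → ℝ
  | 0, 0 => lam
  | 0, _ + 1 => fun _ => 0
  | k + 1, 0 => fun t => deriv (chg lam f k 0) t
  | k + 1, j + 1 => fun t => deriv (chg lam f k (j + 1)) t + deriv f t * chg lam f k j t

lemma chg_of_lt (lam f : ℝ → ℝ) {k j : ℕ} (h : k < j) : chg lam f k j = fun _ => 0 := by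
  induction k generalizing j with
  | zero =>
    obtain ⟨j, rfl⟩ := Nat.exists_eq_succ_of_ne_zero h.ne'
    rfl
  | succ k ih =>
    obtain ⟨j, rfl⟩ := Nat.exists_eq_succ_of_ne_zero (by omega : j ≠ 0)
    funext t
    simp only [chg, ih (show k < j + 1 by omega), ih (show k < j by omega)]
    simp

lemma chg_self (lam f : ℝ → ℝ) (k : ℕ) (t : ℝ) : chg lam f k k t = lam t * deriv f t ^ k := by
  induction k with
  | zero => simp [chg]
  | succ k ih =>
    simp only [chg, chg_of_lt lam f (show k < k + 1 by omega), ih]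
    simp [pow_succ]
    ring

lemma contDiffOn_chg {lam f : ℝ → ℝ} {S : Set ℝ} (hS : IsOpen S) (hl : ContDiffOn ℝ ∞ lam S)
    (hf : ContDiffOn ℝ ∞ f S) (k j : ℕ) : ContDiffOn ℝ ∞ (chg lam f k j) S := by
  induction k generalizing j with
  | zero =>
    cases j with
    | zero => exact hl
    | succ j => exact contDiffOn_const
  | succ k ih =>
    cases j with
    | zero => exact contDiffOn_deriv hS (ih 0)
    | succ j => exact (contDiffOn_deriv hS (ih (j + 1))).add ((contDiffOn_deriv hS hf).mul (ih j))

/-- The relation between A and B is the pullback of a connection form along f. The product and chain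
rules then produce exactly the recursion defining `chg`. -/
lemma kry_change {m : ℕ} {A B : ℝ → Matrix (Fin m) (Fin m) ℝ} {v : ℝ → Fin m → ℝ} {lam f : ℝ → ℝ}
    {S T : Set ℝ} (hS : IsOpen S) (hT : IsOpen T) (hfT : ∀ t ∈ S, f t ∈ T) (hB : SmoothMat B T)
    (hv : ContDiffOn ℝ ∞ v T) (hl : ContDiffOn ℝ ∞ lam S) (hf : ContDiffOn ℝ ∞ f S)
    (hA : ∀ t ∈ S, A t = deriv f t • B (f t)) (k : ℕ) :
    ∀ t ∈ S, kry A (fun t => lam t • v (f t)) k t =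
      ∑ j ∈ Finset.range (k + 1), chg lam f k j t • kry B v j (f t) := by
  induction k with
  | zero => exact fun t _ => by simp [kry, chg]
  | succ k ih =>
    intro t ht
    have hev : kry A (fun t => lam t • v (f t)) k =ᶠ[nhds t] fun t =>
        ∑ j ∈ Finset.range (k + 1), chg lam f k j t • kry B v j (f t) :=
      Filter.eventuallyEq_of_mem (hS.mem_nhds ht) ih
    have hd : HasDerivAt (fun t => ∑ j ∈ Finset.range (k + 1), chg lam f k j t • kry B v j (f t))
        (∑ j ∈ Finset.range (k + 1), (chg lam f k j t • (deriv f t • deriv (kry B v j) (f t)) +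
          deriv (chg lam f k j) t • kry B v j (f t))) t := by
      refine HasDerivAt.fun_sum fun j _ => ?_
      have h1 := ((contDiffOn_chg hS hl hf k j).diffAt hS ht).hasDerivAt
      have h2 := ((contDiffOn_kry hT hB hv j).diffAt hT (hfT t ht)).hasDerivAt
      exact h1.smul (h2.scomp t ((hf.diffAt hS ht).hasDerivAt))
    -- The coefficient of index k + 1 vanishes, so a zero term can be appended; the sums then have
    -- equal length and match the recursion once j = 0 is split off.
    have h0 : (∑ j ∈ Finset.range (k + 1), deriv (chg lam f k j) t • kry B v j (f t)) =
        ∑ j ∈ Finset.range (k + 2), deriv (chg lam f k j) t • kry B v j (f t) := by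
      rw [Finset.sum_range_succ _ (k + 1), chg_of_lt lam f (show k < k + 1 by omega)]
      simp
    simp only [kry]
    rw [hev.deriv_eq, hd.deriv, ih t ht, Finset.sum_add_distrib, h0,
      Finset.sum_range_succ' _ (k + 1), Finset.sum_range_succ' _ (k + 1), hA t ht]
    simp only [chg, kry, add_smul, Finset.sum_add_distrib, smul_add, mul_smul]
    rw [Matrix.mulVec_sum]
    simp only [Matrix.smul_mulVec, Matrix.mulVec_smul]
    simp only [smul_comm (deriv f t)]
    abel

end Line

/-! ### Change of coordinate for jets, Wronskians and densities -/

section Line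

/-- The upper triangular matrix of coefficients in the change of coordinate formula for jets. -/
def chgMat (m : ℕ) (lam f : ℝ → ℝ) (t : ℝ) : Matrix (Fin m) (Fin m) ℝ :=
  Matrix.of fun j k => chg lam f k.1 j.1 t

/-- The triangular factor acts on the right, so reparametrizing and rescaling change neither the
span of the first columns nor, with positive factors, the orientation. -/
lemma kryMat_change {m : ℕ} {A B : ℝ → Matrix (Fin m) (Fin m) ℝ} {v : ℝ → Fin m → ℝ}
    {lam f : ℝ → ℝ} {S T : Set ℝ} (hS : IsOpen S) (hT : IsOpen T) (hfT : ∀ t ∈ S, f t ∈ T)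
    (hB : SmoothMat B T) (hv : ContDiffOn ℝ ∞ v T) (hl : ContDiffOn ℝ ∞ lam S)
    (hf : ContDiffOn ℝ ∞ f S) (hA : ∀ t ∈ S, A t = deriv f t • B (f t)) {t : ℝ} (ht : t ∈ S) :
    kryMat A (fun t => lam t • v (f t)) t = kryMat B v (f t) * chgMat m lam f t := by
  ext i k
  simp only [kryMat, chgMat, Matrix.of_apply, Matrix.mul_apply]
  rw [kry_change hS hT hfT hB hv hl hf hA k.1 t ht, Finset.sum_apply,
    Fin.sum_univ_eq_sum_range (fun j => kry B v j (f t) i * chg lam f k.1 j t) m,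
    ← Finset.sum_subset (Finset.range_mono (show k.1 + 1 ≤ m from k.2))]
  · exact Finset.sum_congr rfl fun j _ => by simp [mul_comm]
  · intro j _ hj
    rw [chg_of_lt lam f (by simpa using hj), mul_zero]

lemma chgMat_isPosUpper {m : ℕ} {lam f : ℝ → ℝ} {t : ℝ} (hl : 0 < lam t) (hf : 0 < deriv f t) :
    IsPosUpper (chgMat m lam f t) := by
  refine ⟨fun i j hij => ?_, fun i => ?_⟩
  · simp only [chgMat, Matrix.of_apply]
    rw [chg_of_lt lam f (show j.1 < i.1 from hij)]
  · simp only [chgMat, Matrix.of_apply, chg_self]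
    positivity

lemma det_chgMat (m : ℕ) (lam f : ℝ → ℝ) (t : ℝ) :
    (chgMat m lam f t).det = ∏ k ∈ Finset.range m, (lam t * deriv f t ^ k) := by
  have h : (chgMat m lam f t).IsUpperTriangular := fun i j hij => by
    simp only [chgMat, Matrix.of_apply]
    rw [chg_of_lt lam f (show j.1 < i.1 from hij)]
  rw [Matrix.det_of_isUpperTriangular h,
    ← Fin.prod_univ_eq_prod_range (fun k => lam t * deriv f t ^ k) m]
  simp [chgMat, chg_self]

lemma jet_change {m : ℕ} {v : ℝ → Fin m → ℝ} {lam f : ℝ → ℝ} {S T : Set ℝ} (hS : IsOpen S)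
    (hT : IsOpen T) (hfT : ∀ t ∈ S, f t ∈ T) (hv : ContDiffOn ℝ ∞ v T)
    (hl : ContDiffOn ℝ ∞ lam S) (hf : ContDiffOn ℝ ∞ f S) {t : ℝ} (ht : t ∈ S) :
    jet (fun t => lam t • v (f t)) t = jet v (f t) * chgMat m lam f t := by
  have hvf : ContDiffOn ℝ ∞ (fun t => lam t • v (f t)) S := hl.smul (hv.comp hf hfT)
  rw [jet_eq_kryMat hS hvf ht, jet_eq_kryMat hT hv (hfT t ht)]
  exact kryMat_change hS hT hfT (SmoothMat.const 0 T) hv hl hf (fun t _ => by simp) ht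

lemma iteratedDeriv_change {u : ℝ → ℝ} {lam f : ℝ → ℝ} {S T : Set ℝ} (hS : IsOpen S)
    (hT : IsOpen T) (hfT : ∀ t ∈ S, f t ∈ T) (hu : ContDiffOn ℝ ∞ u T)
    (hl : ContDiffOn ℝ ∞ lam S) (hf : ContDiffOn ℝ ∞ f S) {t : ℝ} (ht : t ∈ S) (k : ℕ) :
    iteratedDeriv k (fun t => lam t * u (f t)) t =
      ∑ j ∈ Finset.range (k + 1), chg lam f k j t * iteratedDeriv j u (f t) := by
  -- A scalar function is treated as a curve in a one-dimensional space with zero connection.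
  have hu1 : ContDiffOn ℝ ∞ (fun t (_ : Fin 1) => u t) T := contDiffOn_pi.2 fun _ => hu
  have hv1 : ContDiffOn ℝ ∞ (fun t => lam t • (fun (_ : Fin 1) => u (f t))) S :=
    hl.smul (hu1.comp hf hfT)
  have h := kry_change hS hT hfT (SmoothMat.const 0 T) hu1 hl hf
    (A := fun _ => 0) (fun t _ => by simp) k t ht
  have h2 := kry_zero_apply hS hv1 k t ht 0
  rw [h] at h2
  refine h2.symm.trans ?_
  rw [Finset.sum_apply]
  refine Finset.sum_congr rfl fun j _ => ?_
  rw [Pi.smul_apply, kry_zero_apply hT hu1 j (f t) (hfT t ht) 0, smul_eq_mul]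

lemma kryMat_smul {m : ℕ} {A : ℝ → Matrix (Fin m) (Fin m) ℝ} {v : ℝ → Fin m → ℝ} {lam : ℝ → ℝ}
    {S : Set ℝ} (hS : IsOpen S) (hA : SmoothMat A S) (hv : ContDiffOn ℝ ∞ v S)
    (hl : ContDiffOn ℝ ∞ lam S) {t : ℝ} (ht : t ∈ S) :
    kryMat A (fun t => lam t • v t) t = kryMat A v t * chgMat m lam id t :=
  kryMat_change (f := id) hS hS (fun _ h => h) hA hv hl contDiffOn_id (fun t _ => by simp) ht

lemma det_chgMat_id (m : ℕ) (lam : ℝ → ℝ) (t : ℝ) : (chgMat m lam id t).det = lam t ^ m := by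
  rw [det_chgMat]
  simp

lemma det_kryMat_smul {m : ℕ} {A : ℝ → Matrix (Fin m) (Fin m) ℝ} {v : ℝ → Fin m → ℝ} {lam : ℝ → ℝ}
    {S : Set ℝ} (hS : IsOpen S) (hA : SmoothMat A S) (hv : ContDiffOn ℝ ∞ v S)
    (hl : ContDiffOn ℝ ∞ lam S) {t : ℝ} (ht : t ∈ S) :
    (kryMat A (fun t => lam t • v t) t).det = lam t ^ m * (kryMat A v t).det := by
  rw [kryMat_smul hS hA hv hl ht, Matrix.det_mul, det_chgMat_id, mul_comm]

lemma wronskian_smul {m : ℕ} {v : ℝ → Fin m → ℝ} {lam : ℝ → ℝ} {S : Set ℝ} (hS : IsOpen S)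
    (hv : ContDiffOn ℝ ∞ v S) (hl : ContDiffOn ℝ ∞ lam S) {t : ℝ} (ht : t ∈ S) :
    wronskian (fun t => lam t • v t) t = lam t ^ m * wronskian v t := by
  unfold wronskian
  have hlv : ContDiffOn ℝ ∞ (fun t => lam t • v t) S := hl.smul hv
  rw [jet_eq_kryMat hS hlv ht, jet_eq_kryMat hS hv ht]
  exact det_kryMat_smul hS (SmoothMat.const 0 S) hv hl ht

lemma wronskian_change {m : ℕ} {v : ℝ → Fin m → ℝ} {lam f : ℝ → ℝ} {S T : Set ℝ} (hS : IsOpen S)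
    (hT : IsOpen T) (hfT : ∀ t ∈ S, f t ∈ T) (hv : ContDiffOn ℝ ∞ v T)
    (hl : ContDiffOn ℝ ∞ lam S) (hf : ContDiffOn ℝ ∞ f S) {t : ℝ} (ht : t ∈ S) :
    wronskian (fun t => lam t • v (f t)) t =
      wronskian v (f t) * ∏ k ∈ Finset.range m, (lam t * deriv f t ^ k) := by
  unfold wronskian
  rw [jet_change hS hT hfT hv hl hf ht, Matrix.det_mul, det_chgMat]

/-- This computation explains the weights: for m = n the exponent is 0, so the Wronskian of n
densities of weight (1-n)/2 is a function; for m = n + 1 it is (1+n)/2, the weight of the target of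
the operator. -/
lemma prod_density_factor {n m : ℕ} {x : ℝ} (hx : 0 < x) :
    ∏ k ∈ Finset.range m, (x ^ ((1 - (n : ℝ)) / 2) * x ^ k) =
      x ^ ((m : ℝ) * ((m : ℝ) - n) / 2) := by
  induction m with
  | zero => simp
  | succ m ih =>
    rw [Finset.prod_range_succ, ih, ← Real.rpow_natCast, ← Real.rpow_add hx, ← Real.rpow_add hx]
    congr 1
    push_cast
    ring

/-- The subdiagonal coefficient in the change of coordinate formula for densities. -/
lemma chg_succ_self_density {α : ℝ} {f : ℝ → ℝ} {S : Set ℝ} (hS : IsOpen S)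
    (hf : ContDiffOn ℝ ∞ f S) (hpos : ∀ t ∈ S, 0 < deriv f t) (k : ℕ) :
    ∀ t ∈ S, chg (fun t => deriv f t ^ α) f (k + 1) k t =
      ((k + 1 : ℝ) * α + k * (k + 1) / 2) * deriv f t ^ (α - 1) * deriv f t ^ k *
        deriv (deriv f) t := by
  have hd : ∀ t ∈ S, DifferentiableAt ℝ (deriv f) t :=
    fun t ht => (contDiffOn_deriv hS hf).diffAt hS ht
  induction k with
  | zero =>
    intro t ht
    have h := ((hd t ht).hasDerivAt.rpow_const (p := α) (Or.inl (hpos t ht).ne')).deriv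
    simp only [chg]
    rw [h]
    simp
    ring
  | succ k ih =>
    intro t ht
    have h0 : chg (fun t => deriv f t ^ α) f (k + 1) (k + 1) =
        fun t => deriv f t ^ α * deriv f t ^ (k + 1) := funext fun t => chg_self _ _ _ t
    have h1 := ((hd t ht).hasDerivAt.rpow_const (p := α) (Or.inl (hpos t ht).ne')).fun_mul
      ((hd t ht).hasDerivAt.fun_pow (k + 1))
    have h2 : chg (fun t => deriv f t ^ α) f (k + 1 + 1) (k + 1) t =
      deriv (chg (fun t => deriv f t ^ α) f (k + 1) (k + 1)) t +
        deriv f t * chg (fun t => deriv f t ^ α) f (k + 1) k t := rfl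
    have h3 : deriv f t ^ α = deriv f t ^ (α - 1) * deriv f t := by
      rw [← Real.rpow_add_one (hpos t ht).ne']
      simp
    rw [h2, h0, h1.deriv, ih t ht, h3]
    push_cast
    ring

/-! ### Derivative of the determinant -/

/-- Jacobi's formula. By Cramer's rule the trace is the sum over k of the determinants with column k
differentiated, which is the Leibniz rule applied to the permutation expansion. -/
lemma hasDerivAt_det {m : ℕ} {M : ℝ → Matrix (Fin m) (Fin m) ℝ} {M' : Matrix (Fin m) (Fin m) ℝ}
    {t : ℝ} (h : ∀ i j, HasDerivAt (fun s => M s i j) (M' i j) t) :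
    HasDerivAt (fun s => (M s).det) ((M t).adjugate * M').trace t := by
  have h1 : HasDerivAt (fun s => (M s).det) (∑ σ : Equiv.Perm (Fin m),
      ((Equiv.Perm.sign σ : ℤ) : ℝ) *
        ∑ k, (∏ j ∈ Finset.univ.erase k, M t (σ j) j) • M' (σ k) k) t := by
    simp only [Matrix.det_apply']
    exact HasDerivAt.fun_sum fun σ _ =>
      (HasDerivAt.fun_finsetProd fun k _ => h (σ k) k).const_mul _
  convert h1 using 1
  have h2 : ((M t).adjugate * M').trace =
      ∑ k, ((M t).updateCol k (fun i => M' i k)).det := by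
    refine Finset.sum_congr rfl fun k _ => ?_
    rw [← Matrix.cramer_apply, Matrix.cramer_eq_adjugate_mulVec]
    rfl
  rw [h2]
  simp only [Matrix.det_apply', Finset.mul_sum]
  rw [Finset.sum_comm]
  refine Finset.sum_congr rfl fun σ _ => Finset.sum_congr rfl fun k _ => ?_
  rw [← Finset.mul_prod_erase Finset.univ _ (Finset.mem_univ k)]
  congr 1
  rw [Matrix.updateCol_self, smul_eq_mul, mul_comm]
  congr 1
  exact Finset.prod_congr rfl fun j hj => by
    rw [Matrix.updateCol_ne (Finset.ne_of_mem_erase hj)]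

lemma deriv_det {m : ℕ} {M : ℝ → Matrix (Fin m) (Fin m) ℝ} {S : Set ℝ} (hS : IsOpen S)
    (hM : SmoothMat M S) {t : ℝ} (ht : t ∈ S) :
    HasDerivAt (fun s => (M s).det) ((M t).adjugate * matDeriv M t).trace t :=
  hasDerivAt_det fun i j => ((hM i j).diffAt hS ht).hasDerivAt

lemma SmoothMat.det {m : ℕ} {M : ℝ → Matrix (Fin m) (Fin m) ℝ} {S : Set ℝ}
    (hM : SmoothMat M S) : ContDiffOn ℝ ∞ (fun s => (M s).det) S := by
  simp only [Matrix.det_apply']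
  exact ContDiffOn.sum fun σ _ => contDiffOn_const.mul (contDiffOn_prod fun k _ => hM (σ k) k)

/-- The adjugate is the inverse on SL(n), and the determinant is constant, so Jacobi's formula gives
0. -/
lemma trace_inv_mul_matDeriv {m : ℕ} {g : ℝ → SL m} {S : Set ℝ} (hS : IsOpen S)
    (hg : SmoothMat (fun t => (g t).1) S) {t : ℝ} (ht : t ∈ S) :
    ((g t)⁻¹.1 * matDeriv (fun t => (g t).1) t).trace = 0 := by
  have h := deriv_det hS hg ht
  rw [Matrix.SpecialLinearGroup.coe_inv]
  refine h.unique ?_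
  simp only [(g _).2]
  exact hasDerivAt_const t 1

/-! ### Ordinary differential equations -/

/-- Bootstrapping: if y is of class C^k, then so is y' = V ∘ y, and y is of class C^(k+1). -/
lemma contDiffOn_of_hasDerivAt {E : Type*} [NormedAddCommGroup E] [NormedSpace ℝ E] {y : ℝ → E}
    {V : E → E} {S : Set ℝ} {T : Set E} (hS : IsOpen S) (hV : ContDiffOn ℝ ∞ V T)
    (hyT : ∀ t ∈ S, y t ∈ T) (hy : ∀ t ∈ S, HasDerivAt y (V (y t)) t) : ContDiffOn ℝ ∞ y S := by
  rw [contDiffOn_infty]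
  intro k
  induction k with
  | zero =>
    rw [Nat.cast_zero, contDiffOn_zero]
    exact fun t ht => (hy t ht).continuousAt.continuousWithinAt
  | succ k ih =>
    rw [Nat.cast_succ, contDiffOn_succ_iff_deriv_of_isOpen hS]
    refine ⟨fun t ht => (hy t ht).differentiableAt.differentiableWithinAt, by simp, ?_⟩
    exact ((hV.of_le (by exact_mod_cast le_top)).comp ih hyT).congr fun t ht => (hy t ht).deriv

/-- Local solutions in `SL(n, ℝ)` of the linear equation `g' = - A g`. -/
lemma exists_horizontal {m : ℕ} {A : ℝ → Matrix (Fin m) (Fin m) ℝ} (hA : SmoothMat A Set.univ)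
    (htr : ∀ t, (A t).trace = 0) (t₀ : ℝ) :
    ∃ ε > 0, ∃ g : ℝ → SL m, SmoothMat (fun t => (g t).1) (Set.Ioo (t₀ - ε) (t₀ + ε)) ∧
      ∀ t ∈ Set.Ioo (t₀ - ε) (t₀ + ε), A t * (g t).1 + matDeriv (fun t => (g t).1) t = 0 := by
  -- Time is added as a first component to make the equation autonomous.
  let V : ℝ × (Fin m → Fin m → ℝ) → ℝ × (Fin m → Fin m → ℝ) :=
    fun p => (1, fun i j => -∑ k, A p.1 i k * p.2 k j)
  have hV : ContDiff ℝ ∞ V := by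
    refine contDiff_const.prodMk (contDiff_pi.2 fun i => contDiff_pi.2 fun j => ?_)
    refine ContDiff.neg (ContDiff.sum fun k _ => ?_)
    refine ((contDiffOn_univ.1 (hA i k)).comp contDiff_fst).mul ?_
    exact (contDiff_apply_apply ℝ ℝ k j).comp contDiff_snd
  obtain ⟨y, hy0, ε, hε, hy⟩ :=
    ContDiffAt.exists_forall_mem_closedBall_exists_eq_forall_mem_Ioo_hasDerivAt₀
      (hV.contDiffAt.of_le (by exact_mod_cast le_top) :
        ContDiffAt ℝ 1 V (t₀, fun i j => (1 : Matrix (Fin m) (Fin m) ℝ) i j)) t₀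
  have hsm : ContDiffOn ℝ ∞ y (Set.Ioo (t₀ - ε) (t₀ + ε)) :=
    contDiffOn_of_hasDerivAt isOpen_Ioo hV.contDiffOn (T := Set.univ) (fun _ _ => Set.mem_univ _) hy
  have ht₀ : t₀ ∈ Set.Ioo (t₀ - ε) (t₀ + ε) := ⟨by linarith, by linarith⟩
  have hconst : ∀ f : ℝ → ℝ, (∀ t ∈ Set.Ioo (t₀ - ε) (t₀ + ε), HasDerivAt f 0 t) →
      ∀ t ∈ Set.Ioo (t₀ - ε) (t₀ + ε), f t = f t₀ := fun f hf t ht =>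
    isOpen_Ioo.is_const_of_deriv_eq_zero isPreconnected_Ioo
      (fun s hs => (hf s hs).differentiableAt.differentiableWithinAt)
      (fun s hs => (hf s hs).deriv) ht ht₀
  have hfst : ∀ t ∈ Set.Ioo (t₀ - ε) (t₀ + ε), (y t).1 = t := by
    intro t ht
    have h := hconst (fun t => (y t).1 - t) (fun s hs => by
      have h1 := (hasFDerivAt_fst (𝕜 := ℝ) (p := y s)).comp_hasDerivAt s (hy s hs)
      have h2 := h1.sub (hasDerivAt_id s)
      simp only [V, ContinuousLinearMap.coe_fst', sub_self] at h2
      exact h2) t ht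
    simp only [hy0] at h
    linarith
  let M : ℝ → Matrix (Fin m) (Fin m) ℝ := fun t => Matrix.of (y t).2
  have hMsm : SmoothMat M (Set.Ioo (t₀ - ε) (t₀ + ε)) := fun i j =>
    (contDiff_apply_apply ℝ ℝ i j).comp_contDiffOn (contDiff_snd.comp_contDiffOn hsm)
  have hM : ∀ t ∈ Set.Ioo (t₀ - ε) (t₀ + ε), ∀ i j,
      HasDerivAt (fun s => M s i j) (-(A t * M t) i j) t := by
    intro t ht i j
    have h1 := (hasFDerivAt_snd (𝕜 := ℝ) (p := y t)).comp_hasDerivAt t (hy t ht)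
    have h2 := hasDerivAt_pi.1 (hasDerivAt_pi.1 h1 i) j
    refine h2.congr_deriv ?_
    simp [V, M, Matrix.mul_apply, hfst t ht]
  -- By Jacobi's formula (det M)' = - tr(A) det M = 0, and M starts at the identity.
  have hdet : ∀ t ∈ Set.Ioo (t₀ - ε) (t₀ + ε), (M t).det = 1 := by
    intro t ht
    have h := hconst (fun t => (M t).det) (fun s hs => by
      have h1 := hasDerivAt_det (M' := -(A s * M s)) (hM s hs)
      refine h1.congr_deriv ?_
      rw [mul_neg, Matrix.trace_neg, Matrix.trace_mul_comm, Matrix.mul_assoc, Matrix.mul_adjugate,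
        Matrix.mul_smul, Matrix.mul_one, Matrix.trace_smul, htr]
      simp) t ht
    rw [h]
    have : M t₀ = 1 := by
      ext i j
      simp [M, hy0]
    rw [this, Matrix.det_one]
  have hex : ∀ t, ∃ g : SL m, (M t).det = 1 → g.1 = M t := fun t => by
    by_cases h : (M t).det = 1
    · exact ⟨⟨M t, h⟩, fun _ => rfl⟩
    · exact ⟨1, fun h' => absurd h' h⟩
  choose g hg using hex
  refine ⟨ε, hε, g, fun i j => (hMsm i j).congr fun t ht =>
    congrFun (congrFun (hg t (hdet t ht)) i) j, ?_⟩
  intro t ht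
  have hev : (fun t => (g t).1) =ᶠ[nhds t] M :=
    Filter.eventuallyEq_of_mem (isOpen_Ioo.mem_nhds ht) fun s hs => hg s (hdet s hs)
  rw [matDeriv_congr hev, hg t (hdet t ht)]
  ext i j
  simp only [Matrix.add_apply, matDeriv, Matrix.of_apply, (hM t ht i j).deriv, Matrix.zero_apply]
  ring

/-! ### Periodic test functions -/

/-- The second derivative is the negative of the function, so only orders 0 and 1 need checking.
Unlike sine or cosine alone, the sum has no vanishing derivative at 0. -/
lemma iteratedDeriv_sin_add_cos_ne_zero (k : ℕ) :
    iteratedDeriv k (fun s => Real.cos s + Real.sin s) 0 ≠ 0 := by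
  induction k using Nat.twoStepInduction with
  | zero => simp
  | one => simp [iteratedDeriv_one]
  | more k ih _ =>
    have h1 : deriv (fun s => Real.cos s + Real.sin s) = fun s => -Real.sin s + Real.cos s := by
      funext s
      exact ((Real.hasDerivAt_cos s).add (Real.hasDerivAt_sin s)).deriv
    have h2 : deriv (fun s => -Real.sin s + Real.cos s) =
        -fun s => Real.cos s + Real.sin s := by
      funext s
      refine ((Real.hasDerivAt_sin s).neg.add (Real.hasDerivAt_cos s)).deriv.trans ?_
      simp
      ring
    rw [iteratedDeriv_succ', h1, iteratedDeriv_succ', h2, iteratedDeriv_neg]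
    simpa using ih

/-- A linear differential operator with constant coefficients which vanishes at a point on all
smooth periodic functions has zero coefficients. -/
lemma coeff_eq_zero_of_periodic {N : ℕ} {b : ℕ → ℝ} {T : ℝ}
    (h : ∀ q : ℝ → ℝ, ContDiff ℝ ∞ q → (∀ t, q (t + 1) = q t) →
      ∑ i ∈ Finset.range (N + 1), b i * iteratedDeriv i q T = 0) :
    ∀ i ≤ N, b i = 0 := by
  let F : ℝ → ℝ := fun s => Real.cos s + Real.sin s
  have hF : ContDiff ℝ ∞ F := Real.contDiff_cos.add Real.contDiff_sin
  -- Testing the operator on F(2πm(s - T)) gives the value of this polynomial at 2πm. It has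
  -- infinitely many roots, and its coefficients are the b i up to nonzero factors.
  let p : Polynomial ℝ := ∑ i ∈ Finset.range (N + 1),
    Polynomial.monomial i (b i * iteratedDeriv i F 0)
  have hroot : ∀ m : ℕ, p.eval (2 * Real.pi * m) = 0 := by
    intro m
    have h1 := h (fun s => F (2 * Real.pi * m * (s - T)))
      (hF.comp (contDiff_const.mul (contDiff_id.sub contDiff_const))) (fun t => by
        have : 2 * Real.pi * m * (t + 1 - T) = 2 * Real.pi * m * (t - T) + m * (2 * Real.pi) := by
          ring
        simp only [F, this, Real.cos_add_nat_mul_two_pi, Real.sin_add_nat_mul_two_pi])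
    rw [← h1]
    simp only [p, Polynomial.eval_finsetSum, Polynomial.eval_monomial]
    refine Finset.sum_congr rfl fun i _ => ?_
    have h2 := congrFun (iteratedDeriv_comp_sub_const i
      (fun s => F (2 * Real.pi * m * s)) T) T
    have h3 := congrFun (iteratedDeriv_comp_const_mul (n := i) (f := F)
      (hF.of_le (by exact_mod_cast le_top)) (2 * Real.pi * m)) 0
    simp only [sub_self] at h2
    rw [h2, h3]
    simp only [mul_zero]
    ring
  have hp : p = 0 := by
    refine Polynomial.eq_zero_of_infinite_isRoot p (Set.Infinite.mono
      (s := Set.range fun m : ℕ => 2 * Real.pi * (m : ℝ)) ?_ (Set.infinite_range_of_injective ?_))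
    · rintro _ ⟨m, rfl⟩
      exact hroot m
    · intro m m' hm
      have := mul_left_cancel₀ (by positivity) hm
      exact_mod_cast this
  intro i hi
  have hc : p.coeff i = b i * iteratedDeriv i F 0 := by
    simp only [p, Polynomial.finsetSum_coeff, Polynomial.coeff_monomial]
    rw [Finset.sum_ite_eq' _ i, if_pos (by simpa using Nat.lt_succ_of_le hi)]
  rw [hp, Polynomial.coeff_zero] at hc
  exact (mul_eq_zero.1 hc.symm).resolve_right (iteratedDeriv_sin_add_cos_ne_zero i)

end Line

/-! ## Existence of a global coordinate -/

section Coordinate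

lemma isOpen_transition {C : Type*} [TopologicalSpace C] (φ ψ : OpenPartialHomeomorph C ℝ) :
    IsOpen (φ.target ∩ φ.symm ⁻¹' ψ.source) :=
  φ.isOpen_inter_preimage_symm ψ.open_source

variable {C : Type*} [TopologicalSpace C] [ChartedSpace ℝ C]

lemma contDiffOn_transition {φ ψ : OpenPartialHomeomorph C ℝ}
    (hφ : φ ∈ IsManifold.maximalAtlas 𝓘(ℝ, ℝ) ∞ C) (hψ : ψ ∈ IsManifold.maximalAtlas 𝓘(ℝ, ℝ) ∞ C) :
    ContDiffOn ℝ ∞ (ψ ∘ φ.symm) (φ.target ∩ φ.symm ⁻¹' ψ.source) := by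
  rw [← contMDiffOn_iff_contDiffOn]
  exact (contMDiffOn_of_mem_maximalAtlas hψ).comp
    ((contMDiffOn_symm_of_mem_maximalAtlas hφ).mono Set.inter_subset_left) fun t ht => ht.2

lemma mfderiv_transition {φ ψ : OpenPartialHomeomorph C ℝ}
    (hφ : φ ∈ IsManifold.maximalAtlas 𝓘(ℝ, ℝ) ∞ C) (hψ : ψ ∈ IsManifold.maximalAtlas 𝓘(ℝ, ℝ) ∞ C)
    {x : C} (hx : x ∈ φ.source) (hx' : x ∈ ψ.source) :
    mfderiv 𝓘(ℝ, ℝ) 𝓘(ℝ, ℝ) ψ x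
      (mfderiv 𝓘(ℝ, ℝ) 𝓘(ℝ, ℝ) φ.symm (φ x) (1 : ℝ) : TangentSpace 𝓘(ℝ, ℝ) (φ.symm (φ x))) =
      deriv (ψ ∘ φ.symm) (φ x) := by
  have h1 : MDifferentiableAt 𝓘(ℝ, ℝ) 𝓘(ℝ, ℝ) φ.symm (φ x) :=
    (contMDiffAt_symm_of_mem_maximalAtlas hφ (φ.map_source hx)).mdifferentiableAt (by simp)
  have h2 : MDifferentiableAt 𝓘(ℝ, ℝ) 𝓘(ℝ, ℝ) ψ (φ.symm (φ x)) := by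
    rw [φ.left_inv hx]
    exact (contMDiffAt_of_mem_maximalAtlas hψ hx').mdifferentiableAt (by simp)
  have h3 := mfderiv_comp (φ x) h2 h1
  rw [φ.left_inv hx] at h3
  rw [← fderiv_apply_one_eq_deriv, ← mfderiv_eq_fderiv, h3]
  rfl

variable [IsManifold 𝓘(ℝ, ℝ) ∞ C]

/-- A smooth curve with positive velocity is locally the inverse of an oriented chart. -/
lemma Orientation.exists_chart_of_curve (o : Orientation C) {γ : ℝ → C}
    {φ : OpenPartialHomeomorph C ℝ} (hφ : φ ∈ o.charts) {S : Set ℝ} (hS : IsOpen S)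
    (hγ : ∀ t ∈ S, γ t ∈ φ.source) (hsm : ContDiffOn ℝ ∞ (fun t => φ (γ t)) S)
    (hpos : ∀ t ∈ S, 0 < deriv (fun t => φ (γ t)) t) {t₀ : ℝ} (ht₀ : t₀ ∈ S) :
    ∃ ψ ∈ o.charts, t₀ ∈ ψ.target ∧ ψ.target ⊆ S ∧ ∀ t ∈ ψ.target, ψ.symm t = γ t := by
  set f : ℝ → ℝ := fun t => φ (γ t) with hf
  have hφm := o.smooth hφ
  have hc : ∀ t ∈ S, ContDiffAt ℝ ∞ f t := fun t ht => hsm.contDiffAt (hS.mem_nhds ht)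
  have hd : ∀ t ∈ S, HasDerivAt f (deriv f t) t := fun t ht => (hsm.diffAt hS ht).hasDerivAt
  let f' : ℝ ≃L[ℝ] ℝ := ContinuousLinearEquiv.unitsEquivAut ℝ (Units.mk0 _ (hpos t₀ ht₀).ne')
  have hf' : HasFDerivAt f (f' : ℝ →L[ℝ] ℝ) t₀ := by
    convert! (hd t₀ ht₀).hasFDerivAt using 1
  let e0 := (hc t₀ ht₀).toOpenPartialHomeomorph f hf' (by simp)
  let e := e0.restrOpen S hS
  have he_coe : ∀ t, e t = f t := fun t => rfl
  have he_src : e.source ⊆ S := by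
    rw [OpenPartialHomeomorph.restrOpen_source]
    exact Set.inter_subset_right
  have ht₀e : t₀ ∈ e.source := by
    rw [OpenPartialHomeomorph.restrOpen_source]
    exact ⟨(hc t₀ ht₀).mem_toOpenPartialHomeomorph_source hf' (by simp), ht₀⟩
  -- Here e is f = φ ∘ γ near t₀, inverted by the inverse function theorem, so ψ is f⁻¹ ∘ φ and its
  -- inverse is φ⁻¹ ∘ f = γ.
  let ψ := φ.trans e.symm
  have htarget : ψ.target = e.source := by
    rw [OpenPartialHomeomorph.trans_target]
    refine Set.inter_eq_left.2 fun t ht => ?_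
    exact φ.map_source (hγ t (he_src ht))
  have hsymm : ∀ t ∈ ψ.target, ψ.symm t = γ t := fun t ht => by
    rw [htarget] at ht
    exact φ.left_inv (hγ t (he_src ht))
  have hψm : ψ ∈ IsManifold.maximalAtlas 𝓘(ℝ, ℝ) ∞ C := by
    refine ψ.mem_maximalAtlas_of_contMDiffOn ?_ ?_
    · have h1 : ContDiffOn ℝ ∞ e.symm e.target := fun s hs =>
        (e.contDiffAt_symm_deriv (hpos _ (he_src (e.map_target hs))).ne' hs
          (hd _ (he_src (e.map_target hs))) (hc _ (he_src (e.map_target hs)))).contDiffWithinAt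
      exact (contMDiffOn_iff_contDiffOn.2 h1).comp ((contMDiffOn_of_mem_maximalAtlas hφm).mono
        (fun x hx => hx.1)) (fun x hx => hx.2)
    · have h1 : ContDiffOn ℝ ∞ f e.source := hsm.mono he_src
      rw [htarget]
      exact (contMDiffOn_symm_of_mem_maximalAtlas hφm).comp (contMDiffOn_iff_contDiffOn.2 h1)
        fun t ht => φ.map_source (hγ t (he_src ht))
  -- Maximality puts ψ into the orientation: its transition to an oriented chart χ is the transition
  -- from φ to χ after f, both with positive derivative.
  refine ⟨ψ, o.maximal ψ hψm fun χ hχ x hx => ?_, by rwa [htarget], by rwa [htarget], hsymm⟩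
  have hψx : ψ x ∈ e.source := by
    rw [← htarget]
    exact ψ.map_source hx.1
  have hx1 : x ∈ φ.source := hx.1.1
  have hfx : f (ψ x) = φ x := e.right_inv hx.1.2
  have h1 : χ ∘ ψ.symm =ᶠ[nhds (ψ x)] fun t => (χ ∘ φ.symm) (f t) := Filter.Eventually.of_forall fun t => rfl
  have hmem : φ x ∈ φ.target ∩ φ.symm ⁻¹' χ.source :=
    ⟨φ.map_source hx1, by rw [Set.mem_preimage, φ.left_inv hx1]; exact hx.2⟩
  have h2 := (((contDiffOn_transition hφm (o.smooth hχ)).diffAt (isOpen_transition φ χ)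
    hmem)).hasDerivAt
  rw [← hfx] at h2
  refine lt_of_lt_of_eq ?_ (h1.deriv_eq.trans (h2.comp (ψ x) (hd _ (he_src hψx))).deriv).symm
  rw [hfx]
  exact mul_pos (o.pos φ hφ χ hχ x ⟨hx1, hx.2⟩) (hpos _ (he_src hψx))

/-- On an oriented compact one-dimensional manifold there is a smooth positive vector field. -/
lemma Orientation.exists_vectorField [T2Space C] [CompactSpace C] (o : Orientation C) :
    ∃ v : (x : C) → TangentSpace 𝓘(ℝ, ℝ) x,
      ContMDiff 𝓘(ℝ, ℝ) 𝓘(ℝ, ℝ).tangent ∞ (fun x => (⟨x, v x⟩ : TangentBundle 𝓘(ℝ, ℝ) C)) ∧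
      ∀ x, ∀ φ ∈ o.charts, x ∈ φ.source → (0 : ℝ) < mfderiv 𝓘(ℝ, ℝ) 𝓘(ℝ, ℝ) φ x (v x) := by
  -- Being positive in every oriented chart is a convex condition on a tangent vector, so local
  -- solutions glue by a partition of unity. Locally the coordinate field of an oriented chart is
  -- one.
  obtain ⟨s, hs⟩ := exists_contMDiffSection_forall_mem_convex_of_local (n := ⊤) 𝓘(ℝ, ℝ)
    (fun x : C => TangentSpace 𝓘(ℝ, ℝ) x)
    (fun x => {X | ∀ φ ∈ o.charts, x ∈ φ.source → (0 : ℝ) < mfderiv 𝓘(ℝ, ℝ) 𝓘(ℝ, ℝ) φ x X})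
    (fun x => by
      intro X hX Y hY a b ha hb hab φ hφ hx
      have h1 : (0 : ℝ) < mfderiv 𝓘(ℝ, ℝ) 𝓘(ℝ, ℝ) φ x X := hX φ hφ hx
      have h2 : (0 : ℝ) < mfderiv 𝓘(ℝ, ℝ) 𝓘(ℝ, ℝ) φ x Y := hY φ hφ hx
      rw [map_add, map_smul, map_smul]
      have key : ∀ p q : ℝ, 0 < p → 0 < q → 0 < a * p + b * q := fun p q hp hq => by
        rcases ha.eq_or_lt with h | h
        · have : b = 1 := by linarith
          rw [← h, this]
          simpa using hq
        · nlinarith [mul_pos h hp, mul_nonneg hb hq.le]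
      exact key _ _ h1 h2)
    (fun x₀ => by
      obtain ⟨φ, hφ, hx₀⟩ := o.cover x₀
      have hφm := o.smooth hφ
      refine ⟨φ.source, φ.open_source.mem_nhds hx₀,
        fun x => (mfderiv 𝓘(ℝ, ℝ) 𝓘(ℝ, ℝ) φ.symm (φ x) (1 : ℝ) :), ?_, ?_⟩
      · have h1 : ContMDiffOn 𝓘(ℝ, ℝ) 𝓘(ℝ, ℝ).tangent ∞
            (fun x : C => (⟨φ x, (1 : ℝ)⟩ : TangentBundle 𝓘(ℝ, ℝ) ℝ)) φ.source := by
          have h2 : ContMDiffOn 𝓘(ℝ, ℝ) 𝓘(ℝ, ℝ).tangent ∞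
              (fun t : ℝ => (⟨t, (1 : ℝ)⟩ : TangentBundle 𝓘(ℝ, ℝ) ℝ)) Set.univ :=
            contMDiffOn_vectorSpace_iff_contDiffOn.2 contDiffOn_const
          exact h2.comp (contMDiffOn_of_mem_maximalAtlas hφm) fun _ _ => Set.mem_univ _
        have h3 := (contMDiffOn_symm_of_mem_maximalAtlas hφm).contMDiffOn_tangentMapWithin
          (m := ∞) (by simp) φ.open_target.uniqueMDiffOn
        have h4 := h3.comp h1 (fun x hx => φ.map_source hx)
        refine h4.congr fun x hx => ?_
        simp only [Function.comp_apply, tangentMapWithin]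
        rw [mfderivWithin_of_isOpen φ.open_target (φ.map_source hx)]
        refine Bundle.TotalSpace.ext (φ.left_inv hx).symm ?_
        rfl
      · intro y hy ψ hψ hyψ
        have := mfderiv_transition hφm (o.smooth hψ) hy hyψ
        change (0 : ℝ) < mfderiv 𝓘(ℝ, ℝ) 𝓘(ℝ, ℝ) ψ y _
        erw [this]
        exact o.pos φ hφ ψ hψ y ⟨hy, hyψ⟩)
  exact ⟨s, s.contMDiff, hs⟩

end Coordinate

/-! ### Integral curves of a positive vector field and their period -/

section Coordinate

variable {C : Type*} [TopologicalSpace C] [ChartedSpace ℝ C] [IsManifold 𝓘(ℝ, ℝ) ∞ C]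

/-- Integral curves of a smooth positive vector field are locally the inverses of oriented
charts. -/
lemma Orientation.exists_chart_of_integralCurve (o : Orientation C)
    {v : (x : C) → TangentSpace 𝓘(ℝ, ℝ) x}
    (hv : ContMDiff 𝓘(ℝ, ℝ) 𝓘(ℝ, ℝ).tangent ∞ (fun x => (⟨x, v x⟩ : TangentBundle 𝓘(ℝ, ℝ) C)))
    (hpos : ∀ x, ∀ φ ∈ o.charts, x ∈ φ.source → (0 : ℝ) < mfderiv 𝓘(ℝ, ℝ) 𝓘(ℝ, ℝ) φ x (v x))
    {γ : ℝ → C} {S : Set ℝ} (hS : IsOpen S)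
    (hγ : IsMIntegralCurveOn (I := 𝓘(ℝ, ℝ)) γ v S) {r t₀ : ℝ} (hr : 0 < r) (ht₀ : r * t₀ ∈ S) :
    ∃ ψ ∈ o.charts, t₀ ∈ ψ.target ∧ (∀ t ∈ ψ.target, r * t ∈ S) ∧
      ∀ t ∈ ψ.target, ψ.symm t = γ (r * t) := by
  obtain ⟨φ, hφ, hx₀⟩ := o.cover (γ (r * t₀))
  have hφm := o.smooth hφ
  -- V is the vector field in the chart φ. The integral curve solves y' = V(y) there, which makes it
  -- smooth with positive velocity.
  let V : ℝ → ℝ := fun s => mfderiv 𝓘(ℝ, ℝ) 𝓘(ℝ, ℝ) φ (φ.symm s) (v (φ.symm s))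
  have hVsm : ContDiffOn ℝ ∞ V φ.target := by
    have h3 := (contMDiffOn_of_mem_maximalAtlas hφm).contMDiffOn_tangentMapWithin
      (m := ∞) (by simp) φ.open_source.uniqueMDiffOn
    have h4 := h3.comp ((hv.contMDiffOn (s := Set.univ)).comp
      (contMDiffOn_symm_of_mem_maximalAtlas hφm) fun _ _ => Set.mem_univ _)
      (fun t ht => φ.map_target ht)
    refine contMDiffOn_vectorSpace_iff_contDiffOn.1 (h4.congr fun t ht => ?_)
    simp only [Function.comp_apply, tangentMapWithin]
    rw [mfderivWithin_of_isOpen φ.open_source (φ.map_target ht)]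
    refine Bundle.TotalSpace.ext (φ.right_inv ht).symm ?_
    rfl
  have hScont : ContinuousOn γ S := hγ.continuousOn
  have hopen : IsOpen (S ∩ γ ⁻¹' φ.source) := hScont.isOpen_inter_preimage hS φ.open_source
  have hopen' : IsOpen ((fun t => r * t) ⁻¹' (S ∩ γ ⁻¹' φ.source)) :=
    hopen.preimage (continuous_const.mul continuous_id)
  have hder : ∀ t ∈ S ∩ γ ⁻¹' φ.source, HasDerivAt (fun t => φ (γ t)) (V (φ (γ t))) t := by
    intro t ht
    have h1 := (hγ t ht.1).hasMFDerivAt (hS.mem_nhds ht.1)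
    have h2 := ((contMDiffAt_of_mem_maximalAtlas hφm ht.2).mdifferentiableAt
      (by simp)).hasMFDerivAt
    have h3 : HasFDerivAt (fun t => φ (γ t)) (_ : ℝ →L[ℝ] ℝ) t := (h2.comp t h1).hasFDerivAt
    refine h3.hasDerivAt.congr_deriv ?_
    simp only [V]
    rw [φ.left_inv ht.2]
    change mfderiv 𝓘(ℝ, ℝ) 𝓘(ℝ, ℝ) φ (γ t) ((1 : ℝ) • v (γ t)) = _
    rw [one_smul]
  have hsm : ContDiffOn ℝ ∞ (fun t => φ (γ t)) (S ∩ γ ⁻¹' φ.source) :=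
    contDiffOn_of_hasDerivAt hopen hVsm (fun t ht => φ.map_source ht.2) hder
  have hder' : ∀ t ∈ (fun t => r * t) ⁻¹' (S ∩ γ ⁻¹' φ.source),
      HasDerivAt (fun t => φ (γ (r * t))) (V (φ (γ (r * t))) * r) t := fun t ht => by
    have h1 : HasDerivAt (fun t : ℝ => r * t) r t := by
      simpa using (hasDerivAt_id t).const_mul r
    exact (hder (r * t) ht).comp t h1
  obtain ⟨ψ, h1, h2, h3, h4⟩ := o.exists_chart_of_curve (γ := fun t => γ (r * t)) hφ hopen'
    (fun t ht => ht.2) (hsm.comp (contDiff_const.mul contDiff_id).contDiffOn fun t ht => ht)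
    (fun t ht => by
      rw [(hder' t ht).deriv]
      refine mul_pos ?_ hr
      have hp := hpos (γ (r * t)) φ hφ ht.2
      simp only [V]
      rw [φ.left_inv ht.2]
      exact hp) (t₀ := t₀) ⟨ht₀, hx₀⟩
  exact ⟨ψ, h1, h2, fun t ht => (h3 ht).1, h4⟩

/-- A compact connected oriented one-dimensional manifold has a global oriented coordinate. -/
theorem exists_isCoordinate [T2Space C] [CompactSpace C] [ConnectedSpace C] (o : Orientation C) :
    ∃ c : ℝ → C, IsCoordinate o c := by
  obtain ⟨v, hv, hpos⟩ := o.exists_vectorField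
  have hv1 : ContMDiff 𝓘(ℝ, ℝ) 𝓘(ℝ, ℝ).tangent 1
      (fun x => (⟨x, v x⟩ : TangentBundle 𝓘(ℝ, ℝ) C)) := hv.of_le (by exact_mod_cast le_top)
  have : IsManifold 𝓘(ℝ, ℝ) 1 C := IsManifold.of_le (n := ∞) (by exact_mod_cast le_top)
  -- Compactness gives a common existence time. Locally this works because, in dimension one, all
  -- points near x lie on the integral curve through x, whose time translates start at them.
  have hunif : ∃ ε : ℝ, 0 < ε ∧ ∀ x ∈ (Set.univ : Set C), ∃ γ : ℝ → C, γ 0 = x ∧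
      IsMIntegralCurveOn (I := 𝓘(ℝ, ℝ)) γ v (Set.Ioo (-ε) ε) := by
    refine isCompact_univ.induction_on (p := fun S => ∃ ε : ℝ, 0 < ε ∧ ∀ x ∈ S, ∃ γ : ℝ → C,
      γ 0 = x ∧ IsMIntegralCurveOn (I := 𝓘(ℝ, ℝ)) γ v (Set.Ioo (-ε) ε)) ⟨1, one_pos, by simp⟩
      ?_ ?_ ?_
    · rintro S T hST ⟨ε, hε, h⟩
      exact ⟨ε, hε, fun x hx => h x (hST hx)⟩
    · rintro S T ⟨ε, hε, h⟩ ⟨ε', hε', h'⟩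
      refine ⟨min ε ε', lt_min hε hε', fun x hx => ?_⟩
      rcases hx with hx | hx
      · obtain ⟨γ, hγ, hγ'⟩ := h x hx
        exact ⟨γ, hγ, hγ'.mono (Set.Ioo_subset_Ioo (neg_le_neg (min_le_left _ _)) (min_le_left _ _))⟩
      · obtain ⟨γ, hγ, hγ'⟩ := h' x hx
        exact ⟨γ, hγ, hγ'.mono
          (Set.Ioo_subset_Ioo (neg_le_neg (min_le_right _ _)) (min_le_right _ _))⟩
    · intro x _
      obtain ⟨γ, hγ0, hγ⟩ := exists_isMIntegralCurveAt_of_contMDiffAt_boundaryless (I := 𝓘(ℝ, ℝ))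
        (t₀ := 0) (x₀ := x) hv1.contMDiffAt
      obtain ⟨r, hr, hγ⟩ := isMIntegralCurveAt_iff'.1 hγ
      obtain ⟨ψ, hψ, h0, -, hψγ⟩ := o.exists_chart_of_integralCurve hv hpos Metric.isOpen_ball hγ
        one_pos (t₀ := 0) (by simpa using hr)
      simp only [one_mul] at hψγ
      have hx : x = ψ.symm 0 := by rw [hψγ 0 h0, hγ0]
      refine ⟨ψ.source ∩ ψ ⁻¹' Metric.ball 0 (r / 2), mem_nhdsWithin_of_mem_nhds
        ((ψ.isOpen_inter_preimage Metric.isOpen_ball).mem_nhds ?_), r / 2, by positivity, ?_⟩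
      · rw [hx]
        refine ⟨ψ.map_target h0, ?_⟩
        rw [Set.mem_preimage, ψ.right_inv h0]
        simpa using hr
      · rintro y ⟨hy1, hy2⟩
        refine ⟨γ ∘ (· + ψ y), ?_, (hγ.comp_add (ψ y)).mono ?_⟩
        · simp only [Function.comp_apply, zero_add]
          rw [← hψγ _ (ψ.map_source hy1), ψ.left_inv hy1]
        · intro t ht
          rw [Set.mem_preimage, Metric.mem_ball, dist_zero_right, Real.norm_eq_abs, abs_lt] at hy2
          rw [Set.mem_ofPred_eq, Metric.mem_ball, dist_zero_right, Real.norm_eq_abs, abs_lt]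
          constructor <;> linarith [ht.1, ht.2, hy2.1, hy2.2]
  obtain ⟨ε, hε, hunif⟩ := hunif
  have hglob := exists_isMIntegralCurve_of_isMIntegralCurveOn (I := 𝓘(ℝ, ℝ)) hv1 hε
    fun x => hunif x (Set.mem_univ x)
  have hloc : ∀ γ : ℝ → C, IsMIntegralCurve (I := 𝓘(ℝ, ℝ)) γ v → ∀ r t₀ : ℝ, 0 < r →
      ∃ ψ ∈ o.charts, t₀ ∈ ψ.target ∧ ∀ t ∈ ψ.target, ψ.symm t = γ (r * t) := by
    intro γ hγ r t₀ hr
    obtain ⟨ψ, h1, h2, -, h3⟩ := o.exists_chart_of_integralCurve hv hpos isOpen_univ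
      (hγ.isMIntegralCurveOn _) hr (t₀ := t₀) (Set.mem_univ _)
    exact ⟨ψ, h1, h2, h3⟩
  have hopen : ∀ γ : ℝ → C, IsMIntegralCurve (I := 𝓘(ℝ, ℝ)) γ v → IsOpenMap γ := by
    intro γ hγ
    refine IsOpenMap.of_nhds_le fun t => ?_
    obtain ⟨ψ, hψ, h2, h3⟩ := hloc γ hγ 1 t one_pos
    simp only [one_mul] at h3
    have h4 : ψ.symm =ᶠ[nhds t] γ :=
      Filter.eventuallyEq_of_mem (ψ.open_target.mem_nhds h2) h3
    rw [← Filter.map_congr h4, ψ.symm.map_nhds_eq h2, h3 t h2]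
  obtain ⟨x₀⟩ := (inferInstance : Nonempty C)
  obtain ⟨γ, hγ0, hγ⟩ := hglob x₀
  -- The range is open since integral curves are open maps; by uniqueness its complement is a union
  -- of ranges of other integral curves, hence open too. Connectedness concludes.
  have hsurj : Function.Surjective γ := by
    rw [← Set.range_eq_univ]
    refine IsClopen.eq_univ ⟨?_, (hopen γ hγ).isOpen_range⟩ ⟨_, Set.mem_range_self 0⟩
    rw [← isOpen_compl_iff, isOpen_iff_forall_mem_open]
    intro y hy
    obtain ⟨β, hβ0, hβ⟩ := hglob y
    refine ⟨Set.range β, ?_, (hopen β hβ).isOpen_range, ⟨0, hβ0⟩⟩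
    rintro _ ⟨s, rfl⟩ ⟨t, ht⟩
    apply hy
    have h := isMIntegralCurve_Ioo_eq_of_contMDiff_boundaryless (I := 𝓘(ℝ, ℝ)) (t₀ := 0) hv1
      (hγ.comp_add t) (hβ.comp_add s) (by simpa using ht)
    refine ⟨-s + t, ?_⟩
    have := congrFun h (-s)
    simpa [hβ0] using this
  -- Otherwise γ would be a homeomorphism of ℝ with a compact space.
  have hninj : ¬ Function.Injective γ := by
    intro hinj
    let e := (Equiv.ofBijective γ ⟨hinj, hsurj⟩).toHomeomorphOfContinuousOpen hγ.continuous
      (hopen γ hγ)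
    have : CompactSpace ℝ := e.symm.compactSpace
    exact not_compactSpace_iff.2 inferInstance this
  obtain ⟨T₁, hT₁, hper₁⟩ : ∃ T > 0, Function.Periodic γ T := by
    rcases hγ.periodic_xor_injective hv1 with h | h
    · exact h.1
    · exact absurd h.1 hninj
  let P : AddSubgroup ℝ :=
    { carrier := {T | Function.Periodic γ T}
      add_mem' := fun ha hb => Function.Periodic.add_period ha hb
      zero_mem' := fun t => by simp
      neg_mem' := fun ha => Function.Periodic.neg ha }
  -- A subgroup of ℝ is dense or cyclic. A dense group of periods would have a positive element in a
  -- neighbourhood of 0 on which γ is injective.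
  obtain ⟨T₀, hT₀⟩ : ∃ a : ℝ, P = AddSubgroup.closure {a} := by
    refine (AddSubgroup.dense_or_cyclic P).resolve_left fun hd => ?_
    obtain ⟨ψ, hψ, h0, h3⟩ := hloc γ hγ 1 0 one_pos
    simp only [one_mul] at h3
    have hop : IsOpen (ψ.target ∩ Set.Ioi 0) := ψ.open_target.inter isOpen_Ioi
    have hne : (ψ.target ∩ Set.Ioi 0).Nonempty := by
      obtain ⟨δ, hδ, hb⟩ := Metric.isOpen_iff.1 ψ.open_target 0 h0
      refine ⟨δ / 2, hb ?_, by simpa using hδ⟩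
      rw [Metric.mem_ball, dist_zero_right, Real.norm_eq_abs, abs_of_pos (by positivity)]
      linarith
    obtain ⟨T, hT, hTP⟩ := hd.inter_open_nonempty _ hop hne
    have h5 : γ T = γ 0 := by simpa using hTP 0
    rw [← h3 T hT.1, ← h3 0 h0] at h5
    exact hT.2.ne' (ψ.symm.injOn hT.1 h0 h5)
  have hmem : ∀ T, Function.Periodic γ T ↔ ∃ k : ℤ, k • T₀ = T := fun T => by
    have : T ∈ P ↔ ∃ k : ℤ, k • T₀ = T := by rw [hT₀, AddSubgroup.mem_closure_singleton]
    exact this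
  have hT₀0 : T₀ ≠ 0 := by
    rintro rfl
    obtain ⟨k, hk⟩ := (hmem T₁).1 hper₁
    simp at hk
    exact hT₁.ne hk
  -- The generator may be negative; its absolute value generates the same group and is an
  -- orientation preserving scale that normalizes the period to 1.
  have hmem' : ∀ T, Function.Periodic γ T ↔ ∃ k : ℤ, k * |T₀| = T := fun T => by
    rw [hmem]
    rcases abs_choice T₀ with h | h
    · simp [h]
    · rw [h]
      constructor
      · rintro ⟨k, hk⟩
        exact ⟨-k, by simpa using hk⟩
      · rintro ⟨k, hk⟩
        exact ⟨-k, by simpa using hk⟩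
  have hr : 0 < |T₀| := abs_pos.2 hT₀0
  refine ⟨fun t => γ (|T₀| * t), fun x => ?_, fun t t' => ?_, fun t => ?_⟩
  · obtain ⟨s, rfl⟩ := hsurj x
    exact ⟨s / |T₀|, by rw [mul_div_cancel₀ _ hr.ne']⟩
  · constructor
    · intro h
      obtain ⟨k, hk⟩ := (hmem' _).1 (hγ.periodic_of_eq hv1 h.symm)
      refine ⟨k, ?_⟩
      have : |T₀| * t' = |T₀| * (t + k) := by linarith
      exact mul_left_cancel₀ hr.ne' this
    · rintro ⟨k, rfl⟩
      have := (hmem' (k * |T₀|)).2 ⟨k, rfl⟩ (|T₀| * t)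
      rw [← this]
      congr 1
      ring
  · exact hloc γ hγ |T₀| t hr

end Coordinate

/-! ## Calculus in a global coordinate -/

section CoordinateCalculus

variable {C : Type*} [TopologicalSpace C] [ChartedSpace ℝ C]
  {o : Orientation C} {c : ℝ → C}

/-- `f` is a smooth function on the open subset `V` of the range of the chart `φ`, which expresses
the coordinate `c` in terms of `φ`. -/
structure IsCoordLift (c : ℝ → C) (φ : OpenPartialHomeomorph C ℝ) (V : Set ℝ) (f : ℝ → ℝ) :
    Prop where
  isOpen : IsOpen V
  subset : V ⊆ φ.target
  smooth : ContDiffOn ℝ ∞ f V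
  comm : ∀ t ∈ V, c (f t) = φ.symm t

namespace IsCoordinate

lemma map_add_int (hc : IsCoordinate o c) (t : ℝ) (k : ℤ) : c (t + k) = c t :=
  ((hc.eq_iff t (t + k)).2 ⟨k, rfl⟩).symm

lemma map_add_one (hc : IsCoordinate o c) (t : ℝ) : c (t + 1) = c t := by
  simpa using hc.map_add_int t 1

lemma contMDiff (hc : IsCoordinate o c) : ContMDiff 𝓘(ℝ, ℝ) 𝓘(ℝ, ℝ) ∞ c := by
  intro t
  obtain ⟨ψ, hψ, ht, hψc⟩ := hc.local_inverse t
  exact (contMDiffAt_symm_of_mem_maximalAtlas (o.smooth hψ) ht).congr_of_eventuallyEq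
    (Filter.eventuallyEq_of_mem (ψ.open_target.mem_nhds ht) fun s hs => (hψc s hs).symm)

lemma continuous (hc : IsCoordinate o c) : Continuous c :=
  hc.contMDiff.continuous

/-- Near T₀ the coordinate is inverse to an oriented chart ψ, and f is the transition from φ to ψ.
On W the map φ ∘ c inverts f. -/
lemma exists_lift (hc : IsCoordinate o c) {φ : OpenPartialHomeomorph C ℝ}
    (hφ : φ ∈ IsManifold.maximalAtlas 𝓘(ℝ, ℝ) ∞ C) {t₀ T₀ : ℝ} (ht₀ : t₀ ∈ φ.target)
    (hT₀ : c T₀ = φ.symm t₀) :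
    ∃ V f, IsCoordLift c φ V f ∧ t₀ ∈ V ∧ f t₀ = T₀ ∧
      ∃ W, IsOpen W ∧ (∀ t ∈ V, f t ∈ W) ∧
        ∀ T ∈ W, c T ∈ φ.source ∧ φ (c T) ∈ V ∧ f (φ (c T)) = T := by
  obtain ⟨ψ, hψ, hT, hψc⟩ := hc.local_inverse T₀
  have hinv : ∀ T ∈ ψ.target, c T ∈ ψ.source ∧ ψ (c T) = T := fun T hT => by
    rw [← hψc T hT]
    exact ⟨ψ.map_target hT, ψ.right_inv hT⟩
  refine ⟨φ.target ∩ φ.symm ⁻¹' ψ.source, ψ ∘ φ.symm, ⟨isOpen_transition φ ψ,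
    Set.inter_subset_left, contDiffOn_transition hφ (o.smooth hψ), fun t ht => ?_⟩,
    ⟨ht₀, ?_⟩, ?_, ψ.target ∩ c ⁻¹' φ.source,
    ψ.open_target.inter (φ.open_source.preimage hc.continuous), fun t ht => ⟨ψ.map_source ht.2, ?_⟩,
    fun T hT => ⟨hT.2, ⟨φ.map_source hT.2, ?_⟩, ?_⟩⟩
  · simp only [Function.comp_apply]
    rw [← hψc _ (ψ.map_source ht.2), ψ.left_inv ht.2]
  · rw [Set.mem_preimage, ← hT₀]
    exact (hinv T₀ hT).1
  · simp only [Function.comp_apply]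
    rw [← hT₀, (hinv T₀ hT).2]
  · simp only [Function.comp_apply, Set.mem_preimage]
    rw [← hψc _ (ψ.map_source ht.2), ψ.left_inv ht.2]
    exact φ.map_target ht.1
  · rw [Set.mem_preimage, φ.left_inv hT.2]
    exact (hinv T hT.1).1
  · simp only [Function.comp_apply]
    rw [φ.left_inv hT.2, (hinv T hT.1).2]

/-- A coordinate chart in which the coordinate `c` is the identity. -/
def chart (hc : IsCoordinate o c) (T : ℝ) : o.charts :=
  ⟨(hc.local_inverse T).choose, (hc.local_inverse T).choose_spec.1⟩

lemma mem_chart_target (hc : IsCoordinate o c) (T : ℝ) : T ∈ (hc.chart T).1.target :=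
  (hc.local_inverse T).choose_spec.2.1

lemma chart_symm (hc : IsCoordinate o c) (T : ℝ) :
    ∀ t ∈ (hc.chart T).1.target, (hc.chart T).1.symm t = c t :=
  (hc.local_inverse T).choose_spec.2.2

lemma chart_eventually (hc : IsCoordinate o c) {φ : OpenPartialHomeomorph C ℝ} {V : Set ℝ}
    {f : ℝ → ℝ} (hf : IsCoordLift c φ V f) {t : ℝ} (ht : t ∈ V) :
    (hc.chart (f t)).1 ∘ φ.symm =ᶠ[nhds t] f := by
  have h1 : ∀ᶠ s in nhds t, f s ∈ (hc.chart (f t)).1.target :=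
    ((hf.smooth.diffAt hf.isOpen ht).continuousAt).eventually_mem
      ((hc.chart (f t)).1.open_target.mem_nhds (hc.mem_chart_target (f t)))
  filter_upwards [h1, hf.isOpen.mem_nhds ht] with s hs hsV
  simp only [Function.comp_apply]
  rw [← hf.comm s hsV, ← hc.chart_symm (f t) _ hs, (hc.chart (f t)).1.right_inv hs]

lemma symm_mem_chart_source (hc : IsCoordinate o c) {T : ℝ} {x : C} (h : c T = x) :
    x ∈ (hc.chart T).1.source := by
  rw [← h, ← hc.chart_symm T T (hc.mem_chart_target T)]
  exact (hc.chart T).1.map_target (hc.mem_chart_target T)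

lemma isCoordLift_id (hc : IsCoordinate o c) (T : ℝ) :
    IsCoordLift c (hc.chart T).1 (hc.chart T).1.target id :=
  ⟨(hc.chart T).1.open_target, subset_rfl, contDiffOn_id, fun t ht => (hc.chart_symm T t ht).symm⟩

lemma _root_.DrinfeldSokolov.IsCoordLift.deriv_pos (hc : IsCoordinate o c) {φ : o.charts}
    {V : Set ℝ} {f : ℝ → ℝ} (hf : IsCoordLift c φ.1 V f) {t : ℝ} (ht : t ∈ V) : 0 < deriv f t := by
  have h := o.pos φ.1 φ.2 (hc.chart (f t)).1 (hc.chart (f t)).2 (φ.1.symm t)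
    ⟨φ.1.map_target (hf.subset ht), hc.symm_mem_chart_source (hf.comm t ht)⟩
  rwa [φ.1.right_inv (hf.subset ht), (hc.chart_eventually hf ht).deriv_eq] at h

lemma _root_.DrinfeldSokolov.IsCoordLift.add_int (hc : IsCoordinate o c)
    {φ : OpenPartialHomeomorph C ℝ} {V : Set ℝ} {f : ℝ → ℝ} (hf : IsCoordLift c φ V f) (k : ℤ) :
    IsCoordLift c φ V (fun t => f t + k) :=
  ⟨hf.isOpen, hf.subset, hf.smooth.add contDiffOn_const, fun t ht => by
    rw [hc.map_add_int, hf.comm t ht]⟩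

/-- Smoothness on the circle is smoothness in the global coordinate. -/
lemma contMDiffOn_iff (hc : IsCoordinate o c) {F : Type*} [NormedAddCommGroup F] [NormedSpace ℝ F]
    {g : C → F} {U : Set C} (hU : IsOpen U) :
    ContMDiffOn 𝓘(ℝ, ℝ) 𝓘(ℝ, F) ∞ g U ↔ ContDiffOn ℝ ∞ (fun t => g (c t)) (c ⁻¹' U) := by
  constructor
  · intro h
    exact contMDiffOn_iff_contDiffOn.1 (h.comp hc.contMDiff.contMDiffOn fun t ht => ht)
  · intro h x hx
    obtain ⟨T, rfl⟩ := hc.surjective x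
    have hT := hc.mem_chart_target T
    have hs : c T ∈ (hc.chart T).1.source := hc.symm_mem_chart_source rfl
    have h1 := contMDiffAt_of_mem_maximalAtlas (o.smooth (hc.chart T).2) hs
    have hval : (hc.chart T).1 (c T) = T := by
      rw [← hc.chart_symm T T hT, (hc.chart T).1.right_inv hT]
    have h2 : ContDiffAt ℝ ∞ (fun t => g (c t)) ((hc.chart T).1 (c T)) := by
      rw [hval]
      exact h.contDiffAt ((hU.preimage hc.continuous).mem_nhds hx)
    refine (((contMDiffAt_iff_contDiffAt.2 h2).comp (c T) h1).congr_of_eventuallyEq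
      ?_).contMDiffWithinAt
    filter_upwards [(hc.chart T).1.open_source.mem_nhds hs] with y hy
    simp only [Function.comp_apply]
    rw [← hc.chart_symm T _ ((hc.chart T).1.map_source hy), (hc.chart T).1.left_inv hy]

/-- A function on the circle, from a periodic function of the coordinate. -/
def desc (hc : IsCoordinate o c) {α : Type*} (q : ℝ → α) (x : C) : α :=
  q (Function.surjInv hc.surjective x)

/-- Preimages of a point differ by integers, so the choice made in `desc` does not matter for
periodic functions. -/
lemma desc_apply (hc : IsCoordinate o c) {α : Type*} {q : ℝ → α} (hq : ∀ t, q (t + 1) = q t)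
    (t : ℝ) : hc.desc q (c t) = q t := by
  obtain ⟨k, hk⟩ := (hc.eq_iff t (Function.surjInv hc.surjective (c t))).1
    (Function.surjInv_eq hc.surjective (c t)).symm
  unfold desc
  rw [hk]
  have h : Function.Periodic q 1 := hq
  simpa using h.int_mul k t

end IsCoordinate

/-! ### Densities -/

namespace IsCoordinate

/-- The coefficient function of a density in the global coordinate. -/
def dens (hc : IsCoordinate o c) {r : ℝ} (u : Density o r) (T : ℝ) : ℝ :=
  u.1 (hc.chart T) T

lemma density_eq (hc : IsCoordinate o c) {r : ℝ} (u : Density o r) {φ : o.charts} {V : Set ℝ}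
    {f : ℝ → ℝ} (hf : IsCoordLift c φ.1 V f) {t : ℝ} (ht : t ∈ V) :
    u.1 φ t = hc.dens u (f t) * deriv f t ^ r := by
  have h := u.2.2.2 φ (hc.chart (f t)) (φ.1.symm t)
    ⟨φ.1.map_target (hf.subset ht), hc.symm_mem_chart_source (hf.comm t ht)⟩
  have h2 : (hc.chart (f t)).1 (φ.1.symm t) = f t := (hc.chart_eventually hf ht).self_of_nhds
  rwa [φ.1.right_inv (hf.subset ht), (hc.chart_eventually hf ht).deriv_eq, h2,
    abs_of_pos (hf.deriv_pos hc ht)] at h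

lemma density_eq_of_symm_eq (hc : IsCoordinate o c) {r : ℝ} (u : Density o r) {φ : o.charts}
    (hφ : ∀ t ∈ φ.1.target, φ.1.symm t = c t) {t : ℝ} (ht : t ∈ φ.1.target) :
    u.1 φ t = hc.dens u t := by
  have hf : IsCoordLift c φ.1 φ.1.target id :=
    ⟨φ.1.open_target, subset_rfl, contDiffOn_id, fun t ht => (hφ t ht).symm⟩
  rw [hc.density_eq u hf ht]
  simp

lemma dens_periodic (hc : IsCoordinate o c) {r : ℝ} (u : Density o r) (T : ℝ) :
    hc.dens u (T + 1) = hc.dens u T := by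
  have h := hc.density_eq u ((hc.isCoordLift_id T).add_int hc 1) (hc.mem_chart_target T)
  have h2 := hc.density_eq u (hc.isCoordLift_id T) (hc.mem_chart_target T)
  rw [h2] at h
  simpa using h.symm

lemma contDiff_dens (hc : IsCoordinate o c) {r : ℝ} (u : Density o r) :
    ContDiff ℝ ∞ (hc.dens u) := by
  rw [contDiff_iff_contDiffAt]
  intro T
  have hT := (hc.chart T).1.open_target.mem_nhds (hc.mem_chart_target T)
  refine ((u.2.1 (hc.chart T)).contDiffAt hT).congr_of_eventuallyEq ?_
  filter_upwards [hT] with t ht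
  exact (hc.density_eq_of_symm_eq u (hc.chart_symm T) ht).symm

lemma density_ext (hc : IsCoordinate o c) {r : ℝ} {u u' : Density o r}
    (h : ∀ T, hc.dens u T = hc.dens u' T) : u = u' := by
  apply Subtype.ext
  funext φ t
  by_cases ht : t ∈ φ.1.target
  · obtain ⟨T, hT⟩ := hc.surjective (φ.1.symm t)
    obtain ⟨V, f, hf, htV, -⟩ := hc.exists_lift (o.smooth φ.2) ht hT
    rw [hc.density_eq u hf htV, hc.density_eq u' hf htV, h]
  · rw [u.2.2.1 φ t ht, u'.2.2.1 φ t ht]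

open Classical in
/-- The coefficient in the chart `φ` of the density with coefficient `q` in the global
coordinate. -/
def densityCoeff (hc : IsCoordinate o c) (r : ℝ) (q : ℝ → ℝ) (φ : o.charts) (t : ℝ) : ℝ :=
  if t ∈ φ.1.target then
    q (Function.surjInv hc.surjective (φ.1.symm t)) *
      |deriv ((hc.chart (Function.surjInv hc.surjective (φ.1.symm t))).1 ∘ φ.1.symm) t| ^ r
  else 0

/-- The preimage chosen in the definition differs from f t by an integer, which neither the periodic
q nor the derivative of the transition map detects. -/
lemma densityCoeff_eq (hc : IsCoordinate o c) (r : ℝ) {q : ℝ → ℝ} (hq : ∀ t, q (t + 1) = q t)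
    {φ : o.charts} {V : Set ℝ} {f : ℝ → ℝ} (hf : IsCoordLift c φ.1 V f) {t : ℝ} (ht : t ∈ V) :
    hc.densityCoeff r q φ t = q (f t) * deriv f t ^ r := by
  obtain ⟨k, hk⟩ := (hc.eq_iff (f t) (Function.surjInv hc.surjective (φ.1.symm t))).1
    ((Function.surjInv_eq hc.surjective (φ.1.symm t)).trans (hf.comm t ht).symm).symm
  rw [densityCoeff, if_pos (hf.subset ht), hk, (hc.chart_eventually (hf.add_int hc k) ht).deriv_eq,
    deriv_add_const, abs_of_pos (hf.deriv_pos hc ht)]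
  have h : Function.Periodic q 1 := hq
  have h2 : q (f t + k) = q (f t) := by simpa using h.int_mul k (f t)
  rw [h2]

/-- The density with coefficient `q` in the global coordinate. -/
def ofPeriodic (hc : IsCoordinate o c) (r : ℝ) {q : ℝ → ℝ} (hq : ContDiff ℝ ∞ q)
    (hq1 : ∀ t, q (t + 1) = q t) : Density o r :=
  ⟨hc.densityCoeff r q, by
    refine ⟨fun φ t ht => ?_, fun φ t ht => if_neg ht, fun φ ψ x hx => ?_⟩
    · obtain ⟨T, hT⟩ := hc.surjective (φ.1.symm t)
      obtain ⟨V, f, hf, htV, -⟩ := hc.exists_lift (o.smooth φ.2) ht hT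
      have hV := hf.isOpen.mem_nhds htV
      have h1 : ContDiffAt ℝ ∞ (fun t => q (f t) * deriv f t ^ r) t :=
        (hq.contDiffAt.comp t (hf.smooth.contDiffAt hV)).mul
          (((contDiffOn_deriv hf.isOpen hf.smooth).contDiffAt hV).rpow_const_of_ne
            (hf.deriv_pos hc htV).ne')
      exact (h1.congr_of_eventuallyEq (Filter.eventuallyEq_of_mem hV fun s hs =>
        hc.densityCoeff_eq r hq1 hf hs)).contDiffWithinAt
    · obtain ⟨T, hT⟩ := hc.surjective x
      have hxt := ψ.1.map_source hx.2
      obtain ⟨V, f, hf, htV, -⟩ := hc.exists_lift (o.smooth ψ.2) hxt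
        (hT.trans (ψ.1.left_inv hx.2).symm)
      have hsm := contDiffOn_transition (o.smooth φ.2) (o.smooth ψ.2)
      have hop := isOpen_transition φ.1 ψ.1
      have hmem : φ.1 x ∈ φ.1.target ∩ φ.1.symm ⁻¹' ψ.1.source :=
        ⟨φ.1.map_source hx.1, by rw [Set.mem_preimage, φ.1.left_inv hx.1]; exact hx.2⟩
      have hval : (ψ.1 ∘ φ.1.symm) (φ.1 x) = ψ.1 x := by
        simp only [Function.comp_apply]
        rw [φ.1.left_inv hx.1]
      -- The transformation law between φ and ψ is the chain rule for a lift f through ψ composed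
      -- with the transition map, which is a lift through φ.
      have hlift : IsCoordLift c φ.1 ((φ.1.target ∩ φ.1.symm ⁻¹' ψ.1.source) ∩
          (ψ.1 ∘ φ.1.symm) ⁻¹' V) (f ∘ (ψ.1 ∘ φ.1.symm)) := by
        refine ⟨hsm.continuousOn.isOpen_inter_preimage hop hf.isOpen, fun t ht => ht.1.1,
          hf.smooth.comp (hsm.mono Set.inter_subset_left) fun t ht => ht.2, fun t ht => ?_⟩
        exact (hf.comm _ ht.2).trans (ψ.1.left_inv ht.1.2)
      have hmem' : φ.1 x ∈ (φ.1.target ∩ φ.1.symm ⁻¹' ψ.1.source) ∩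
          (ψ.1 ∘ φ.1.symm) ⁻¹' V := ⟨hmem, by rw [Set.mem_preimage, hval]; exact htV⟩
      have hd2 : HasDerivAt f (deriv f (ψ.1 x)) ((ψ.1 ∘ φ.1.symm) (φ.1 x)) := by
        rw [hval]
        exact (hf.smooth.diffAt hf.isOpen htV).hasDerivAt
      have hd := hd2.comp (φ.1 x) (hsm.diffAt hop hmem).hasDerivAt
      have hpos := o.pos φ.1 φ.2 ψ.1 ψ.2 x hx
      rw [hc.densityCoeff_eq r hq1 hf htV, hc.densityCoeff_eq r hq1 hlift hmem', hd.deriv,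
        abs_of_pos hpos, Real.mul_rpow (hf.deriv_pos hc htV).le hpos.le, Function.comp_apply, hval,
        mul_assoc]⟩

lemma dens_ofPeriodic (hc : IsCoordinate o c) (r : ℝ) {q : ℝ → ℝ} (hq : ContDiff ℝ ∞ q)
    (hq1 : ∀ t, q (t + 1) = q t) (T : ℝ) : hc.dens (hc.ofPeriodic r hq hq1) T = q T := by
  have h := hc.densityCoeff_eq r hq1 (hc.isCoordLift_id T) (hc.mem_chart_target T)
  exact h.trans (by simp)

/-! ### Differential operators -/

lemma hasCoefficients_iff (hc : IsCoordinate o c) {r s : ℝ}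
    {L : Density o r →ₗ[ℝ] Density o s} {n : ℕ} {a : ℕ → ℝ → ℝ} :
    HasCoefficients L n c a ↔ ∀ u T, hc.dens (L u) T =
      ∑ i ∈ Finset.range (n + 1), a i T * iteratedDeriv i (hc.dens u) T := by
  have key : ∀ φ : o.charts, (∀ t ∈ φ.1.target, φ.1.symm t = c t) → ∀ u : Density o r,
      ∀ t ∈ φ.1.target, ∀ i, iteratedDeriv i (u.1 φ) t = iteratedDeriv i (hc.dens u) t :=
    fun φ hφ u t ht i => Filter.EventuallyEq.iteratedDeriv_eq i
      (Filter.eventuallyEq_of_mem (φ.1.open_target.mem_nhds ht)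
        fun s hs => hc.density_eq_of_symm_eq u hφ hs)
  constructor
  · intro h u T
    have hT := hc.mem_chart_target T
    have h1 := h (hc.chart T) (hc.chart_symm T) u T hT
    rw [← hc.density_eq_of_symm_eq (L u) (hc.chart_symm T) hT, h1]
    exact Finset.sum_congr rfl fun i _ => by rw [key _ (hc.chart_symm T) u T hT]
  · intro h φ hφ u t ht
    rw [hc.density_eq_of_symm_eq (L u) hφ ht, h]
    exact Finset.sum_congr rfl fun i _ => by rw [key φ hφ u t ht]

/-- Every smooth periodic function is the coefficient of some density, so periodic test functions
separate the coefficients at the point T. -/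
lemma coeff_unique (hc : IsCoordinate o c) {r s : ℝ} {L : Density o r →ₗ[ℝ] Density o s} {n : ℕ}
    {T : ℝ} {b b' : ℕ → ℝ}
    (hb : ∀ u, hc.dens (L u) T = ∑ i ∈ Finset.range (n + 1), b i * iteratedDeriv i (hc.dens u) T)
    (hb' : ∀ u, hc.dens (L u) T =
      ∑ i ∈ Finset.range (n + 1), b' i * iteratedDeriv i (hc.dens u) T) :
    ∀ i ≤ n, b i = b' i := by
  intro i hi
  have h := coeff_eq_zero_of_periodic (N := n) (b := fun i => b i - b' i) (T := T)
    (fun q hq hq1 => by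
      have h1 := hb (hc.ofPeriodic r hq hq1)
      rw [hb' (hc.ofPeriodic r hq hq1)] at h1
      have h2 : hc.dens (hc.ofPeriodic r hq hq1) = q := funext (hc.dens_ofPeriodic r hq hq1)
      rw [h2] at h1
      simp only [sub_mul, Finset.sum_sub_distrib]
      rw [h1, sub_self]) i hi
  exact sub_eq_zero.1 h

end IsCoordinate

/-- The coefficients, in a global coordinate, of the operators in `R_n(C)`. -/
structure IsAGDCoeff (n : ℕ) (a : ℕ → ℝ → ℝ) : Prop where
  smooth : ∀ i, ContDiff ℝ ∞ (a i)
  periodic : ∀ i t, a i (t + 1) = a i t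
  top : ∀ t, a n t = 1
  sub : ∀ t, a (n - 1) t = 0

lemma chg_periodic {lam f : ℝ → ℝ} (hl : ∀ t, lam (t + 1) = lam t) (hf : ∀ t, f (t + 1) = f t)
    (k j : ℕ) (t : ℝ) : chg lam f k j (t + 1) = chg lam f k j t := by
  have key : ∀ q : ℝ → ℝ, (∀ t, q (t + 1) = q t) → ∀ t, deriv q (t + 1) = deriv q t :=
    fun q hq t => by rw [← deriv_comp_add_const, funext hq]
  induction k generalizing j t with
  | zero =>
    cases j with
    | zero => exact hl t
    | succ j => rfl
  | succ k ih =>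
    cases j with
    | zero => exact key _ (ih 0) t
    | succ j =>
      simp only [chg]
      rw [key _ (ih (j + 1)), key _ hf, ih]

namespace IsCoordinate

/-- At T the coefficients are taken from a chart inverse to c near T. Uniqueness forces the choices
to agree on overlapping charts and at T and T + 1, whence smoothness and periodicity. -/
lemma AGD_exists_coeff (hc : IsCoordinate o c) {n : ℕ} (L : AGD n o) :
    ∃ a, IsAGDCoeff n a ∧ HasCoefficients L.1 n c a := by
  choose A hA1 hA2 hA3 hA4 using L.2
  have hloc : ∀ φ : o.charts, (∀ t ∈ φ.1.target, φ.1.symm t = c t) → ∀ u, ∀ t ∈ φ.1.target,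
      hc.dens (L.1 u) t =
        ∑ i ∈ Finset.range (n + 1), A φ i t * iteratedDeriv i (hc.dens u) t := by
    intro φ hφ u t ht
    rw [← hc.density_eq_of_symm_eq (L.1 u) hφ ht, hA4 φ u t ht]
    refine Finset.sum_congr rfl fun i _ => ?_
    rw [Filter.EventuallyEq.iteratedDeriv_eq i
      (Filter.eventuallyEq_of_mem (φ.1.open_target.mem_nhds ht)
        fun s hs => hc.density_eq_of_symm_eq u hφ hs)]
  have h0 : ∀ u T, hc.dens (L.1 u) T =
      ∑ i ∈ Finset.range (n + 1), A (hc.chart T) i T * iteratedDeriv i (hc.dens u) T :=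
    fun u T => hloc _ (hc.chart_symm T) u T (hc.mem_chart_target T)
  have hsub : n - 1 ≤ n := Nat.sub_le n 1
  -- Beyond order n the local data carry no information; the value 0 makes all the coefficients
  -- smooth and periodic.
  refine ⟨fun i T => if i ≤ n then A (hc.chart T) i T else 0, ⟨fun i => ?_, fun i T => ?_,
    fun T => ?_, fun T => ?_⟩, hc.hasCoefficients_iff.2 fun u T => ?_⟩
  · by_cases hi : i ≤ n
    · simp only [hi, if_true]
      rw [contDiff_iff_contDiffAt]
      intro T
      have hT := (hc.chart T).1.open_target.mem_nhds (hc.mem_chart_target T)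
      refine ((hA1 (hc.chart T) i hi).contDiffAt hT).congr_of_eventuallyEq ?_
      filter_upwards [hT] with t ht
      exact hc.coeff_unique (fun u => h0 u t) (fun u => hloc _ (hc.chart_symm T) u t ht) i hi
    · simp only [hi, if_false]
      exact contDiff_const
  · by_cases hi : i ≤ n
    · simp only [hi, if_true]
      refine hc.coeff_unique (L := L.1) (T := T)
        (b := fun i => A (hc.chart (T + 1)) i (T + 1)) (fun u => ?_) (fun u => h0 u T) i hi
      rw [← hc.dens_periodic, h0 u (T + 1)]
      refine Finset.sum_congr rfl fun j _ => ?_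
      have h1 := congrFun (iteratedDeriv_comp_add_const j (hc.dens u) 1) T
      rw [funext (hc.dens_periodic u)] at h1
      rw [h1]
    · simp only [hi, if_false]
  · simp only [le_refl, if_true]
    exact hA2 _ T (hc.mem_chart_target T)
  · simp only [hsub, if_true]
    exact hA3 _ T (hc.mem_chart_target T)
  · rw [h0]
    refine Finset.sum_congr rfl fun i hi => ?_
    rw [if_pos (Nat.lt_succ_iff.1 (Finset.mem_range.1 hi))]

lemma contDiff_operator (hc : IsCoordinate o c) {n : ℕ} {a : ℕ → ℝ → ℝ} (ha : IsAGDCoeff n a)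
    {r : ℝ} (u : Density o r) : ContDiff ℝ ∞
      (fun T => ∑ i ∈ Finset.range (n + 1), a i T * iteratedDeriv i (hc.dens u) T) :=
  ContDiff.sum fun i _ => (ha.smooth i).mul (by
    rw [iteratedDeriv_eq_iterate]
    exact (hc.contDiff_dens u).iterate_deriv i)

lemma periodic_operator (hc : IsCoordinate o c) {n : ℕ} {a : ℕ → ℝ → ℝ} (ha : IsAGDCoeff n a)
    {r : ℝ} (u : Density o r) (T : ℝ) :
    ∑ i ∈ Finset.range (n + 1), a i (T + 1) * iteratedDeriv i (hc.dens u) (T + 1) =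
      ∑ i ∈ Finset.range (n + 1), a i T * iteratedDeriv i (hc.dens u) T := by
  refine Finset.sum_congr rfl fun i _ => ?_
  have h1 := congrFun (iteratedDeriv_comp_add_const i (hc.dens u) 1) T
  rw [funext (hc.dens_periodic u)] at h1
  rw [ha.periodic, h1]

end IsCoordinate

end CoordinateCalculus

/-! ### Operators with prescribed coefficients in the global coordinate -/

section Operators

variable {C : Type*} [TopologicalSpace C] [ChartedSpace ℝ C]
  {o : Orientation C} {c : ℝ → C}

namespace IsCoordinate

/-- The differential operator with given coefficients in the global coordinate. -/
def operator (hc : IsCoordinate o c) {n : ℕ} {a : ℕ → ℝ → ℝ} (ha : IsAGDCoeff n a) (r s : ℝ) :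
    Density o r →ₗ[ℝ] Density o s where
  toFun u := hc.ofPeriodic s (hc.contDiff_operator ha u) (hc.periodic_operator ha u)
  map_add' u v := by
    refine hc.density_ext fun T => ?_
    have h1 : hc.dens (u + v) = hc.dens u + hc.dens v := rfl
    change _ = hc.dens (hc.ofPeriodic s _ _) T + hc.dens (hc.ofPeriodic s _ _) T
    simp only [dens_ofPeriodic]
    rw [← Finset.sum_add_distrib, h1]
    refine Finset.sum_congr rfl fun i _ => ?_
    rw [iteratedDeriv_add
      ((hc.contDiff_dens u).of_le (by exact_mod_cast le_top) : ContDiff ℝ i _).contDiffAt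
      ((hc.contDiff_dens v).of_le (by exact_mod_cast le_top) : ContDiff ℝ i _).contDiffAt, mul_add]
  map_smul' k u := by
    refine hc.density_ext fun T => ?_
    have h1 : hc.dens (k • u) = k • hc.dens u := rfl
    change _ = k * hc.dens (hc.ofPeriodic s _ _) T
    simp only [dens_ofPeriodic]
    rw [Finset.mul_sum, h1]
    refine Finset.sum_congr rfl fun i _ => ?_
    rw [iteratedDeriv_const_smul
      ((hc.contDiff_dens u).of_le (by exact_mod_cast le_top) : ContDiff ℝ i _).contDiffAt,
      smul_eq_mul]
    ring

lemma hasCoefficients_operator (hc : IsCoordinate o c) {n : ℕ} {a : ℕ → ℝ → ℝ}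
    (ha : IsAGDCoeff n a) (r s : ℝ) : HasCoefficients (hc.operator ha r s) n c a :=
  hc.hasCoefficients_iff.2 fun u T =>
    hc.dens_ofPeriodic s (hc.contDiff_operator ha u) (hc.periodic_operator ha u) T

/-- Properties of the change of coordinate from the global coordinate to a chart. -/
lemma chart_change (hc : IsCoordinate o c) (φ : o.charts) {t₀ : ℝ} (ht₀ : t₀ ∈ φ.1.target) :
    ∃ V f W, IsCoordLift c φ.1 V f ∧ t₀ ∈ V ∧ IsOpen W ∧ (∀ t ∈ V, f t ∈ W) ∧
      ContDiffOn ℝ ∞ (fun T => φ.1 (c T)) W ∧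
      (∀ T ∈ W, c T ∈ φ.1.source ∧ φ.1 (c T) ∈ V ∧ f (φ.1 (c T)) = T) ∧
      (∀ t ∈ V, φ.1 (c (f t)) = t) ∧
      (∀ T ∈ W, 0 < deriv (fun T => φ.1 (c T)) T) ∧
      ∀ T ∈ W, deriv f (φ.1 (c T)) = (deriv (fun T => φ.1 (c T)) T)⁻¹ := by
  obtain ⟨T₀, hT₀⟩ := hc.surjective (φ.1.symm t₀)
  obtain ⟨V, f, hf, htV, -, W, hW, hfW, hWV⟩ := hc.exists_lift (o.smooth φ.2) ht₀ hT₀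
  have hsm : ContDiffOn ℝ ∞ (fun T => φ.1 (c T)) W :=
    ((hc.contMDiffOn_iff φ.1.open_source).1
      (contMDiffOn_of_mem_maximalAtlas (o.smooth φ.2))).mono fun T hT => (hWV T hT).1
  have hprod : ∀ T ∈ W, deriv f (φ.1 (c T)) * deriv (fun T => φ.1 (c T)) T = 1 := by
    intro T hT
    have h1 := (hf.smooth.diffAt hf.isOpen (hWV T hT).2.1).hasDerivAt.comp T
      (hsm.diffAt hW hT).hasDerivAt
    have h2 : (f ∘ fun T => φ.1 (c T)) =ᶠ[nhds T] id :=
      Filter.eventuallyEq_of_mem (hW.mem_nhds hT) fun s hs => (hWV s hs).2.2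
    rw [← h1.deriv, h2.deriv_eq, deriv_id]
  refine ⟨V, f, W, hf, htV, hW, hfW, hsm, hWV, fun t ht => ?_, fun T hT => ?_, fun T hT => ?_⟩
  · rw [hf.comm t ht, φ.1.right_inv (hf.subset ht)]
  · have h1 := hf.deriv_pos hc (hWV T hT).2.1
    exact pos_of_mul_pos_right (by rw [hprod T hT]; exact one_pos) h1.le
  · exact eq_inv_of_mul_eq_one_left (hprod T hT)

/-- With h = φ ∘ c, the coefficient of u in the coordinate c is h'^r times its coefficient in φ
composed with h. Expanding gives the local coefficients, and the two weights make the leading one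
h'^(-s + r + n) = 1 and the next one 0. -/
lemma operator_mem_AGD (hc : IsCoordinate o c) {n : ℕ} (hn : 1 ≤ n) {a : ℕ → ℝ → ℝ}
    (ha : IsAGDCoeff n a) :
    hc.operator ha ((1 - (n : ℝ)) / 2) ((1 + (n : ℝ)) / 2) ∈ AGD n o := by
  intro φ
  set r := (1 - (n : ℝ)) / 2 with hr
  set s := (1 + (n : ℝ)) / 2 with hs
  -- Off the source of φ the values of h are meaningless, but h is periodic everywhere, so the
  -- coefficients built from it descend to the circle.
  let h : ℝ → ℝ := fun T => φ.1 (c T)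
  let lam : ℝ → ℝ := fun T => deriv h T ^ r
  have hper : ∀ T, h (T + 1) = h T := fun T => by
    simp only [h]
    rw [hc.map_add_one]
  have hper' : ∀ T, deriv h (T + 1) = deriv h T := fun T => by
    rw [← deriv_comp_add_const, funext hper]
  have hlper : ∀ T, lam (T + 1) = lam T := fun T => by
    simp only [lam, hper']
  -- The prefactor converts the resulting s-density from the coordinate c to the chart φ.
  let B : ℕ → ℝ → ℝ := fun j T => deriv h T ^ (-s) *
    ∑ k ∈ Finset.range (n + 1), a k T * chg lam h k j T
  have hB : ∀ j T, B j (T + 1) = B j T := fun j T => by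
    simp only [B, hper', ha.periodic, chg_periodic hlper hper]
  have hval : ∀ {V f}, IsCoordLift c φ.1 V f → ∀ t ∈ V, ∀ j,
      hc.desc (B j) (φ.1.symm t) = B j (f t) := fun hf t ht j => by
    rw [← hf.comm t ht, hc.desc_apply (hB j)]
  refine ⟨fun j t => hc.desc (B j) (φ.1.symm t), fun j _ t ht => ?_, fun t ht => ?_,
    fun t ht => ?_, fun u t ht => ?_⟩
  all_goals obtain ⟨V, f, W, hf, htV, hW, hfW, hsm, hWV, hh, hpos, hinv⟩ := hc.chart_change φ ht
  all_goals have hlsm : ContDiffOn ℝ ∞ lam W := fun T hT =>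
    (((contDiffOn_deriv hW hsm).contDiffAt (hW.mem_nhds hT)).rpow_const_of_ne
      (hpos T hT).ne').contDiffWithinAt
  · have hBsm : ContDiffOn ℝ ∞ (B j) W := by
      refine ContDiffOn.mul (fun T hT => (((contDiffOn_deriv hW hsm).contDiffAt
        (hW.mem_nhds hT)).rpow_const_of_ne (hpos T hT).ne').contDiffWithinAt)
        (ContDiffOn.sum fun k _ => ?_)
      exact (ha.smooth k).contDiffOn.mul (contDiffOn_chg hW hlsm hsm k j)
    have h1 : ContDiffAt ℝ ∞ (fun t => B j (f t)) t :=
      (hBsm.comp hf.smooth hfW).contDiffAt (hf.isOpen.mem_nhds htV)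
    exact (h1.congr_of_eventuallyEq (Filter.eventuallyEq_of_mem (hf.isOpen.mem_nhds htV)
      fun t ht => hval hf t ht j)).contDiffWithinAt
  · refine (hval hf t htV n).trans ?_
    have hT := hfW t htV
    simp only [B]
    rw [Finset.sum_range_succ, Finset.sum_eq_zero fun k hk => by
      rw [chg_of_lt lam h (Finset.mem_range.1 hk), mul_zero], zero_add, ha.top, one_mul, chg_self,
      ← Real.rpow_natCast, ← Real.rpow_add (hpos _ hT), ← Real.rpow_add (hpos _ hT)]
    rw [show -s + (r + n) = 0 by rw [hr, hs]; ring, Real.rpow_zero]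
  · refine (hval hf t htV (n - 1)).trans ?_
    have hT := hfW t htV
    obtain ⟨m, rfl⟩ : ∃ m, n = m + 1 := ⟨n - 1, by omega⟩
    have hsub := ha.sub (f t)
    simp only [Nat.add_sub_cancel] at hsub ⊢
    simp only [B]
    -- Only two terms can contribute: order m has coefficient 0, and order m + 1 carries the factor
    -- (m + 1)((1 - n)/2 + m/2), which is zero for n = m + 1.
    rw [Finset.sum_range_succ, Finset.sum_range_succ, Finset.sum_eq_zero fun k hk => by
      rw [chg_of_lt lam h (Finset.mem_range.1 hk), mul_zero], hsub,
      chg_succ_self_density hW hsm hpos m (f t) hT, hr]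
    push_cast
    ring
  · have hT := hfW t htV
    have hu : ∀ T ∈ W, hc.dens u T = lam T * u.1 φ (h T) := fun T hT => by
      rw [hc.density_eq u hf (hWV T hT).2.1, (hWV T hT).2.2, hinv T hT,
        Real.inv_rpow (hpos T hT).le]
      have : deriv h T ^ r ≠ 0 := (Real.rpow_pos_of_pos (hpos T hT) r).ne'
      change _ = deriv h T ^ r * (hc.dens u T * (deriv h T ^ r)⁻¹)
      rw [mul_comm, mul_assoc, inv_mul_cancel₀ this, mul_one]
    have hder : ∀ k, iteratedDeriv k (hc.dens u) (f t) =
        ∑ j ∈ Finset.range (k + 1), chg lam h k j (f t) * iteratedDeriv j (u.1 φ) t := fun k => by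
      rw [Filter.EventuallyEq.iteratedDeriv_eq k
        (Filter.eventuallyEq_of_mem (hW.mem_nhds hT) hu),
        iteratedDeriv_change hW hf.isOpen (fun T hT => (hWV T hT).2.1)
          ((u.2.1 φ).mono hf.subset) hlsm hsm hT k]
      simp only [h, hh t htV]
    have hder' : ∀ k ∈ Finset.range (n + 1), iteratedDeriv k (hc.dens u) (f t) =
        ∑ j ∈ Finset.range (n + 1), chg lam h k j (f t) * iteratedDeriv j (u.1 φ) t := by
      intro k hk
      rw [hder]
      refine Finset.sum_subset (Finset.range_mono (Finset.mem_range.1 hk)) fun j _ hj => ?_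
      rw [chg_of_lt lam h (by simpa using hj), zero_mul]
    have hft : deriv f t = (deriv h (f t))⁻¹ := by
      have := hinv (f t) hT
      rwa [hh t htV] at this
    rw [hc.density_eq _ hf htV, hc.hasCoefficients_iff.1 (hc.hasCoefficients_operator ha r s),
      hft, Real.inv_rpow (hpos _ hT).le, ← Real.rpow_neg (hpos _ hT).le,
      Finset.sum_congr rfl fun k hk => by rw [hder' k hk]]
    simp only [hval hf t htV]
    simp only [B, Finset.mul_sum, Finset.sum_mul]
    rw [Finset.sum_comm]
    refine Finset.sum_congr rfl fun j _ => Finset.sum_congr rfl fun k _ => ?_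
    ring

lemma exists_AGD (hc : IsCoordinate o c) {n : ℕ} (hn : 1 ≤ n) {a : ℕ → ℝ → ℝ}
    (ha : IsAGDCoeff n a) : ∃ L : AGD n o, HasCoefficients L.1 n c a :=
  ⟨⟨_, hc.operator_mem_AGD hn ha⟩, hc.hasCoefficients_operator ha _ _⟩

end IsCoordinate

end Operators

/-! ## Sections of principal bundles -/

lemma SmoothSLOn.mono' {E H M : Type*} [NormedAddCommGroup E] [NormedSpace ℝ E]
    [TopologicalSpace H] [TopologicalSpace M] [ChartedSpace H M] {I : ModelWithCorners ℝ E H}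
    {n : ℕ} {g : M → SL n} {S T : Set M} (hg : SmoothSLOn I g S) (h : T ⊆ S) : SmoothSLOn I g T :=
  fun i j => (hg i j).mono h

lemma SmoothSLOn.congr' {E H M : Type*} [NormedAddCommGroup E] [NormedSpace ℝ E]
    [TopologicalSpace H] [TopologicalSpace M] [ChartedSpace H M] {I : ModelWithCorners ℝ E H}
    {n : ℕ} {g h : M → SL n} {S : Set M} (hg : SmoothSLOn I g S) (hgh : ∀ x ∈ S, h x = g x) :
    SmoothSLOn I h S :=
  fun i j => (hg i j).congr fun x hx => by rw [hgh x hx]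

lemma smoothSLOn_of_locally {E H M : Type*} [NormedAddCommGroup E] [NormedSpace ℝ E]
    [TopologicalSpace H] [TopologicalSpace M] [ChartedSpace H M] {I : ModelWithCorners ℝ E H}
    {n : ℕ} {g : M → SL n} {S : Set M}
    (h : ∀ x ∈ S, ∃ U, IsOpen U ∧ x ∈ U ∧ SmoothSLOn I g (S ∩ U)) : SmoothSLOn I g S :=
  fun i j => contMDiffOn_of_locally_contMDiffOn fun x hx => by
    obtain ⟨U, hU, hxU, hg⟩ := h x hx
    exact ⟨U, hU, hxU, hg i j⟩

lemma IsCoordinate.smoothSLOn_iff {C : Type*} [TopologicalSpace C] [ChartedSpace ℝ C]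
    {o : Orientation C} {c : ℝ → C} (hc : IsCoordinate o c) {n : ℕ} {g : C → SL n} {U : Set C}
    (hU : IsOpen U) :
    SmoothSLOn 𝓘(ℝ, ℝ) g U ↔ SmoothMat (fun t => (g (c t)).1) (c ⁻¹' U) :=
  forall_congr' fun i => forall_congr' fun j =>
    hc.contMDiffOn_iff (g := fun x => (g x).1 i j) hU

namespace PrincipalBundle

variable {n : ℕ} {C : Type*} [TopologicalSpace C] [ChartedSpace ℝ C] {Q : Type*}
  [MulAction (SL n)ᵐᵒᵖ Q]

lemma smul_mul_right (q : Q) (g h : SL n) : q <• (g * h) = (q <• g) <• h := by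
  rw [MulOpposite.op_mul, mul_smul]

lemma translation_smul (P : PrincipalBundle n C Q) (q : Q) (g : SL n) : translation (n := n) q (q <• g) = g :=
  translation_unique P rfl

lemma translation_self (P : PrincipalBundle n C Q) (q : Q) : translation (n := n) q q = 1 :=
  translation_unique P (by rw [MulOpposite.op_one, one_smul])

variable (P : PrincipalBundle n C Q)

lemma translation_mul {q q' q'' : Q} (h : P.proj q = P.proj q') (h' : P.proj q' = P.proj q'') :
    translation (n := n) q q' * translation (n := n) q' q'' = translation (n := n) q q'' := by
  refine (translation_unique P ?_).symm
  rw [smul_mul_right, ← smul_translation (P := P) q q' h, ← smul_translation (P := P) q' q'' h']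

lemma translation_inv {q q' : Q} (h : P.proj q = P.proj q') :
    translation (n := n) q' q = (translation (n := n) q q')⁻¹ := by
  rw [eq_inv_iff_mul_eq_one, P.translation_mul h.symm h, P.translation_self]

lemma translation_smul_right {q q' : Q} (h : P.proj q = P.proj q') (g : SL n) :
    translation (n := n) q (q' <• g) = translation (n := n) q q' * g := by
  rw [← P.translation_mul h (P.proj_smul q' g).symm, P.translation_smul]

variable {P}

lemma LocalSection.proj_val (s : P.LocalSection) {x : C} (hx : x ∈ s.dom) :
    P.proj (s.val x) = x :=
  s.isSmooth.proj x hx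

lemma LocalSection.proj_eq (s s' : P.LocalSection) {x : C} (hx : x ∈ s.dom) (hx' : x ∈ s'.dom) :
    P.proj (s.val x) = P.proj (s'.val x) := by
  rw [s.proj_val hx, s'.proj_val hx']

lemma LocalSection.smul_translation (s s' : P.LocalSection) {x : C} (hx : x ∈ s.dom)
    (hx' : x ∈ s'.dom) :
    s'.val x = s.val x <• translation (n := n) (s.val x) (s'.val x) :=
  PrincipalBundle.smul_translation (P := P) _ _ (s.proj_eq s' hx hx')

lemma IsSmoothSection.congr {U : Set C} {s s' : C → Q} (hs : P.IsSmoothSection U s)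
    (h : ∀ x ∈ U, s' x = s x) : P.IsSmoothSection U s' :=
  ⟨hs.isOpen, fun x hx => by rw [h x hx, hs.proj x hx], fun e he =>
    (hs.smooth e he).congr' fun x hx => by rw [h x hx.1]⟩

/-- The translation function between two smooth sections is smooth. -/
lemma LocalSection.smooth_translation (s s' : P.LocalSection) :
    SmoothSLOn 𝓘(ℝ, ℝ) (fun x => translation (n := n) (s.val x) (s'.val x)) (s.dom ∩ s'.dom) := by
  refine smoothSLOn_of_locally fun x hx => ?_
  obtain ⟨e, he, hxe⟩ := P.cover x
  refine ⟨e.1, P.isOpen e he, hxe, ?_⟩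
  have h1 := (s.isSmooth.smooth e he).mono' (T := s.dom ∩ s'.dom ∩ e.1) fun y hy => ⟨hy.1.1, hy.2⟩
  have h2 := (s'.isSmooth.smooth e he).mono' (T := s.dom ∩ s'.dom ∩ e.1) fun y hy => ⟨hy.1.2, hy.2⟩
  refine (h1.inv.mul h2).congr' fun y hy => ?_
  have hp : P.proj (e.2 y) = P.proj (s.val y) := by
    rw [P.proj_section e he y hy.2, s.proj_val hy.1.1]
  rw [← P.translation_inv hp, P.translation_mul hp.symm]
  rw [P.proj_section e he y hy.2, s'.proj_val hy.1.2]

/-- The section `s g`. -/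
def LocalSection.mulRight (s : P.LocalSection) (g : C → SL n) (U : Set C) (hU : IsOpen U)
    (hUs : U ⊆ s.dom) (hg : SmoothSLOn 𝓘(ℝ, ℝ) g U) : P.LocalSection where
  dom := U
  val x := s.val x <• g x
  isSmooth := by
    refine ⟨hU, fun x hx => by rw [P.proj_smul, s.proj_val (hUs hx)], fun e he => ?_⟩
    refine (((s.isSmooth.smooth e he).mono' (T := U ∩ e.1) fun y hy => ⟨hUs hy.1, hy.2⟩).mul
      (hg.mono' Set.inter_subset_left)).congr' fun y hy => ?_
    exact P.translation_smul_right
      (by rw [P.proj_section e he y hy.2, s.proj_val (hUs hy.1)]) _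

/-- The local sections of the atlas. -/
def atlasSection (e : Set C × (C → Q)) (he : e ∈ P.atlas) : P.LocalSection where
  dom := e.1
  val := e.2
  isSmooth := ⟨P.isOpen e he, P.proj_section e he, fun e' he' =>
    (P.smooth e' he' e he).mono' fun _ hx => ⟨hx.2, hx.1⟩⟩

/-! ### Connections in a global frame -/

section Frame

variable {o : Orientation C} {c : ℝ → C}

lemma mfderiv_comp_curve {γ : ℝ → C} {t : ℝ} (h2 : MDifferentiableAt 𝓘(ℝ, ℝ) 𝓘(ℝ, ℝ) γ t)
    {U : Set C} (hU : IsOpen U) {g : C → ℝ} (hg : ContMDiffOn 𝓘(ℝ, ℝ) 𝓘(ℝ, ℝ) ∞ g U)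
    (ht : γ t ∈ U) :
    mfderiv 𝓘(ℝ, ℝ) 𝓘(ℝ, ℝ) g (γ t) (mfderiv 𝓘(ℝ, ℝ) 𝓘(ℝ, ℝ) γ t (1 : ℝ)) =
      deriv (fun t => g (γ t)) t := by
  have h1 : MDifferentiableAt 𝓘(ℝ, ℝ) 𝓘(ℝ, ℝ) g (γ t) :=
    ((hg (γ t) ht).contMDiffAt (hU.mem_nhds ht)).mdifferentiableAt (by simp)
  have h3 := mfderiv_comp t h1 h2
  have h4 : deriv (fun t => g (γ t)) t = mfderiv 𝓘(ℝ, ℝ) 𝓘(ℝ, ℝ) (g ∘ γ) t (1 : ℝ) := by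
    rw [mfderiv_eq_fderiv, ← fderiv_apply_one_eq_deriv]
    rfl
  rw [h4, h3]
  rfl

lemma _root_.DrinfeldSokolov.IsCoordinate.mdifferentiableAt (hc : IsCoordinate o c) (t : ℝ) :
    MDifferentiableAt 𝓘(ℝ, ℝ) 𝓘(ℝ, ℝ) c t :=
  (hc.contMDiff t).mdifferentiableAt (by simp)

lemma _root_.DrinfeldSokolov.IsCoordinate.mfderiv_chart (hc : IsCoordinate o c) {T t : ℝ}
    (hmem : c t ∈ (hc.chart T).1.source) :
    (mfderiv 𝓘(ℝ, ℝ) 𝓘(ℝ, ℝ) (hc.chart T).1 (c t) (mfderiv 𝓘(ℝ, ℝ) 𝓘(ℝ, ℝ) c t (1 : ℝ)) : ℝ) =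
      1 := by
  have hT : (hc.chart T).1 (c t) ∈ (hc.chart T).1.target := (hc.chart T).1.map_source hmem
  refine (mfderiv_comp_curve (hc.mdifferentiableAt t) (hc.chart T).1.open_source
    (contMDiffOn_of_mem_maximalAtlas (o.smooth (hc.chart T).2)) hmem).trans ?_
  obtain ⟨k, hk⟩ := (hc.eq_iff ((hc.chart T).1 (c t)) t).1
    (by rw [← hc.chart_symm T _ hT, (hc.chart T).1.left_inv hmem])
  have hev : (fun s => (hc.chart T).1 (c s)) =ᶠ[nhds t] fun s : ℝ => s - (k : ℝ) := by
    have h1 : ∀ᶠ s : ℝ in nhds t, s - (k : ℝ) ∈ (hc.chart T).1.target := by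
      refine (continuous_id.sub continuous_const).continuousAt.eventually_mem
        ((hc.chart T).1.open_target.mem_nhds ?_)
      change t - (k : ℝ) ∈ _
      rw [show t - (k : ℝ) = (hc.chart T).1 (c t) by linarith]
      exact hT
    filter_upwards [h1] with s hs
    have h2 : c s = c (s - k) := by
      have := hc.map_add_int (s - k) k
      rwa [sub_add_cancel] at this
    rw [h2, ← hc.chart_symm T _ hs, (hc.chart T).1.right_inv hs]
  rw [hev.deriv_eq, deriv_sub_const]
  exact deriv_id t

lemma _root_.DrinfeldSokolov.IsCoordinate.velocity_ne_zero (hc : IsCoordinate o c) (t : ℝ) :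
    (mfderiv 𝓘(ℝ, ℝ) 𝓘(ℝ, ℝ) c t (1 : ℝ) : ℝ) ≠ 0 := by
  intro h
  have h1 := hc.mfderiv_chart (T := t) (t := t) (hc.symm_mem_chart_source rfl)
  have h2 : (mfderiv 𝓘(ℝ, ℝ) 𝓘(ℝ, ℝ) c t (1 : ℝ)) = 0 := h
  have h3 : (0 : ℝ) = 1 := by
    rw [h2] at h1
    exact (map_zero (mfderiv 𝓘(ℝ, ℝ) 𝓘(ℝ, ℝ) (hc.chart t).1 (c t))).symm.trans h1
  exact zero_ne_one h3

/-- Every tangent vector is a multiple of the velocity vector of the coordinate. -/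
lemma _root_.DrinfeldSokolov.IsCoordinate.exists_smul_velocity (hc : IsCoordinate o c) (t : ℝ)
    (X : TangentSpace 𝓘(ℝ, ℝ) (c t)) :
    ∃ k : ℝ, X = k • (mfderiv 𝓘(ℝ, ℝ) 𝓘(ℝ, ℝ) c t (1 : ℝ) : TangentSpace 𝓘(ℝ, ℝ) (c t)) := by
  have h : ∀ x k : ℝ, k ≠ 0 → x = (x / k) • k := fun x k hk => (div_mul_cancel₀ x hk).symm
  exact ⟨_, h X _ (hc.velocity_ne_zero t)⟩

/-- The velocity of the coordinate spans each tangent line, so identities between 1-forms reduce to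
identities between functions of t. -/
lemma _root_.DrinfeldSokolov.IsCoordinate.linearMap_ext (hc : IsCoordinate o c) {t : ℝ}
    {F : Type*} [AddCommGroup F] [Module ℝ F] {A B : TangentSpace 𝓘(ℝ, ℝ) (c t) →ₗ[ℝ] F}
    (h : A (mfderiv 𝓘(ℝ, ℝ) 𝓘(ℝ, ℝ) c t (1 : ℝ)) = B (mfderiv 𝓘(ℝ, ℝ) 𝓘(ℝ, ℝ) c t (1 : ℝ))) :
    A = B := by
  refine LinearMap.ext fun X => ?_
  obtain ⟨k, rfl⟩ := hc.exists_smul_velocity t X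
  rw [map_smul, map_smul, h]

/-- `gaugeTransform` as a linear map. -/
def gaugeTransformLin (g : C → SL n) (x : C)
    (A : TangentSpace 𝓘(ℝ, ℝ) x →ₗ[ℝ] Matrix (Fin n) (Fin n) ℝ) :
    TangentSpace 𝓘(ℝ, ℝ) x →ₗ[ℝ] Matrix (Fin n) (Fin n) ℝ where
  toFun := gaugeTransform g x A
  map_add' X Y := by
    have h : (Matrix.of fun i j => mfderiv 𝓘(ℝ, ℝ) 𝓘(ℝ, ℝ) (fun y => (g y).1 i j) x (X + Y) :
        Matrix (Fin n) (Fin n) ℝ) =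
        (Matrix.of fun i j => mfderiv 𝓘(ℝ, ℝ) 𝓘(ℝ, ℝ) (fun y => (g y).1 i j) x X) +
        Matrix.of fun i j => mfderiv 𝓘(ℝ, ℝ) 𝓘(ℝ, ℝ) (fun y => (g y).1 i j) x Y := by
      ext i j
      exact map_add (mfderiv 𝓘(ℝ, ℝ) 𝓘(ℝ, ℝ) (fun y => (g y).1 i j) x) X Y
    simp only [gaugeTransform]
    rw [h, map_add, mul_add, add_mul, mul_add]
    abel
  map_smul' k X := by
    have h : (Matrix.of fun i j => mfderiv 𝓘(ℝ, ℝ) 𝓘(ℝ, ℝ) (fun y => (g y).1 i j) x (k • X) :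
        Matrix (Fin n) (Fin n) ℝ) =
        k • Matrix.of fun i j => mfderiv 𝓘(ℝ, ℝ) 𝓘(ℝ, ℝ) (fun y => (g y).1 i j) x X := by
      ext i j
      exact map_smul (mfderiv 𝓘(ℝ, ℝ) 𝓘(ℝ, ℝ) (fun y => (g y).1 i j) x) k X
    simp only [gaugeTransform]
    rw [h, map_smul, mul_smul_comm, smul_mul_assoc, mul_smul_comm, RingHom.id_apply, smul_add]

lemma gaugeTransform_velocity {γ : ℝ → C} {t : ℝ}
    (hγ : MDifferentiableAt 𝓘(ℝ, ℝ) 𝓘(ℝ, ℝ) γ t) {U : Set C} (hU : IsOpen U) {g : C → SL n}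
    (hg : SmoothSLOn 𝓘(ℝ, ℝ) g U) (ht : γ t ∈ U)
    (A : TangentSpace 𝓘(ℝ, ℝ) (γ t) →ₗ[ℝ] Matrix (Fin n) (Fin n) ℝ) :
    gaugeTransform g (γ t) A (mfderiv 𝓘(ℝ, ℝ) 𝓘(ℝ, ℝ) γ t (1 : ℝ)) =
      (g (γ t))⁻¹.1 * A (mfderiv 𝓘(ℝ, ℝ) 𝓘(ℝ, ℝ) γ t (1 : ℝ)) * (g (γ t)).1 +
        (g (γ t))⁻¹.1 * matDeriv (fun t => (g (γ t)).1) t := by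
  unfold gaugeTransform
  congr 2
  ext i j
  exact mfderiv_comp_curve hγ hU (hg i j) ht

lemma Connection.matrix_transform (hc : IsCoordinate o c) (θ : P.Connection)
    (s s' : P.LocalSection) {t : ℝ} (ht : c t ∈ s.dom) (ht' : c t ∈ s'.dom) :
    θ.matrix s' c t =
      (translation (n := n) (s.val (c t)) (s'.val (c t)))⁻¹.1 * θ.matrix s c t *
          (translation (n := n) (s.val (c t)) (s'.val (c t))).1 +
        (translation (n := n) (s.val (c t)) (s'.val (c t)))⁻¹.1 *
          matDeriv (fun t => (translation (n := n) (s.val (c t)) (s'.val (c t))).1) t :=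
  (θ.transform s s' (c t) ⟨ht, ht'⟩ _).trans
    (gaugeTransform_velocity (hc.mdifferentiableAt t) (s.isSmooth.isOpen.inter s'.isSmooth.isOpen)
      (s.smooth_translation s') ⟨ht, ht'⟩ _)

/-- The form of the transformation law used most: `A g + g' = g B`. -/
lemma Connection.matrix_transform' (hc : IsCoordinate o c) (θ : P.Connection)
    (s s' : P.LocalSection) {t : ℝ} (ht : c t ∈ s.dom) (ht' : c t ∈ s'.dom) :
    θ.matrix s c t * (translation (n := n) (s.val (c t)) (s'.val (c t))).1 +
          matDeriv (fun t => (translation (n := n) (s.val (c t)) (s'.val (c t))).1) t =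
      (translation (n := n) (s.val (c t)) (s'.val (c t))).1 * θ.matrix s' c t := by
  rw [θ.matrix_transform hc s s' ht ht', mul_add, ← mul_assoc, ← mul_assoc, ← mul_assoc,
    ← Matrix.SpecialLinearGroup.coe_mul, mul_inv_cancel, Matrix.SpecialLinearGroup.coe_one,
    one_mul, one_mul]

lemma Connection.form_eq_zero_iff (hc : IsCoordinate o c) (θ : P.Connection) (s : P.LocalSection)
    (t : ℝ) : θ.form s (c t) = 0 ↔ θ.matrix s c t = 0 := by
  constructor
  · intro h
    rw [Connection.matrix, h]
    rfl
  · intro h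
    exact hc.linearMap_ext (h.trans (LinearMap.zero_apply _).symm)

/-- A connection is determined by its matrix in a global frame. -/
lemma Connection.ext_matrix (hc : IsCoordinate o c) {θ θ' : P.Connection} {e : P.LocalSection}
    (he : e.dom = Set.univ) (h : ∀ t, θ.matrix e c t = θ'.matrix e c t) : θ = θ' := by
  apply Connection.ext
  funext s x
  by_cases hx : x ∈ s.dom
  · obtain ⟨t, rfl⟩ := hc.surjective x
    have hxe : c t ∈ e.dom := by rw [he]; trivial
    refine hc.linearMap_ext ?_
    have h1 := θ.matrix_transform hc e s hxe hx
    rw [h, ← θ'.matrix_transform hc e s hxe hx] at h1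
    exact h1
  · rw [θ.form_of_notMem s x hx, θ'.form_of_notMem s x hx]

lemma Connection.trace_matrix (θ : P.Connection) (e : P.LocalSection) (t : ℝ) :
    (θ.matrix e c t).trace = 0 :=
  θ.trace_form _ _ _

lemma Connection.matrix_smul (θ : P.Connection) (u : P.gauge) (e : P.LocalSection) (t : ℝ) :
    (u • θ).matrix e c t = θ.matrix (e.map u⁻¹) c t :=
  rfl

end Frame

end PrincipalBundle

namespace PrincipalBundle

variable {n : ℕ} {C : Type*} [TopologicalSpace C] [ChartedSpace ℝ C] {Q : Type*}
  [MulAction (SL n)ᵐᵒᵖ Q] {P : PrincipalBundle n C Q} {o : Orientation C} {c : ℝ → C}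

/-! ### The matrix of a connection -/

/-- The tangent spaces at γ t and γ' t' are formally different types which both unfold to ℝ;
comparing the vectors as real numbers avoids transport. This serves to replace c by the inverse of a
chart and to prove periodicity. -/
lemma Connection.form_congr (θ : P.Connection) (s : P.LocalSection) {γ γ' : ℝ → C} {t t' : ℝ}
    (h : γ t = γ' t')
    (h' : (mfderiv 𝓘(ℝ, ℝ) 𝓘(ℝ, ℝ) γ t (1 : ℝ) : ℝ) = mfderiv 𝓘(ℝ, ℝ) 𝓘(ℝ, ℝ) γ' t' (1 : ℝ)) :
    θ.form s (γ t) (mfderiv 𝓘(ℝ, ℝ) 𝓘(ℝ, ℝ) γ t (1 : ℝ)) =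
      θ.form s (γ' t') (mfderiv 𝓘(ℝ, ℝ) 𝓘(ℝ, ℝ) γ' t' (1 : ℝ)) := by
  have key : ∀ (x y : C) (X Y : ℝ), x = y → X = Y →
      (θ.form s x : ℝ →ₗ[ℝ] Matrix (Fin n) (Fin n) ℝ) X =
        (θ.form s y : ℝ →ₗ[ℝ] Matrix (Fin n) (Fin n) ℝ) Y := by
    rintro x _ X _ rfl rfl
    rfl
  exact key _ _ _ _ h h'

lemma velocity_congr {γ γ' : ℝ → C} {t : ℝ} (h : γ =ᶠ[nhds t] γ') :
    (mfderiv 𝓘(ℝ, ℝ) 𝓘(ℝ, ℝ) γ t (1 : ℝ) : ℝ) = mfderiv 𝓘(ℝ, ℝ) 𝓘(ℝ, ℝ) γ' t (1 : ℝ) :=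
  congrArg (fun L : ℝ →L[ℝ] ℝ => L 1) h.mfderiv_eq

lemma Connection.smoothMat_matrix (hc : IsCoordinate o c) (θ : P.Connection)
    (s : P.LocalSection) : SmoothMat (fun t => θ.matrix s c t) (c ⁻¹' s.dom) := by
  intro i j t₀ ht₀
  have hφ := hc.chart_symm t₀
  have hev : ∀ t ∈ (hc.chart t₀).1.target, θ.matrix s c t =
      θ.form s ((hc.chart t₀).1.symm t)
        (mfderiv 𝓘(ℝ, ℝ) 𝓘(ℝ, ℝ) (hc.chart t₀).1.symm t (1 : ℝ)) := fun t ht =>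
    θ.form_congr s (hφ t ht).symm (velocity_congr (Filter.eventuallyEq_of_mem
      ((hc.chart t₀).1.open_target.mem_nhds ht) fun t' ht' => (hφ t' ht').symm))
  have h1 := θ.smooth s _ (o.smooth (hc.chart t₀).2) i j
  have hmem : t₀ ∈ (hc.chart t₀).1.target := hc.mem_chart_target t₀
  have hopen : IsOpen ((hc.chart t₀).1.target ∩ (hc.chart t₀).1.symm ⁻¹' s.dom) :=
    (hc.chart t₀).1.isOpen_inter_preimage_symm s.isSmooth.isOpen
  have hmem2 : t₀ ∈ (hc.chart t₀).1.target ∩ (hc.chart t₀).1.symm ⁻¹' s.dom :=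
    ⟨hmem, by rw [Set.mem_preimage, hφ t₀ hmem]; exact ht₀⟩
  refine (((h1 t₀ hmem2).contDiffAt (hopen.mem_nhds hmem2)).congr_of_eventuallyEq
    (Filter.eventuallyEq_of_mem ((hc.chart t₀).1.open_target.mem_nhds hmem)
      fun t ht => ?_)).contDiffWithinAt
  exact congrFun (congrFun (hev t ht) i) j

lemma _root_.DrinfeldSokolov.IsCoordinate.velocity_add_one (hc : IsCoordinate o c) (t : ℝ) :
    (mfderiv 𝓘(ℝ, ℝ) 𝓘(ℝ, ℝ) c (t + 1) (1 : ℝ) : ℝ) =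
      mfderiv 𝓘(ℝ, ℝ) 𝓘(ℝ, ℝ) c t (1 : ℝ) := by
  have h1 : c ∘ (fun s : ℝ => s + 1) = c := funext hc.map_add_one
  have h2 : MDifferentiableAt 𝓘(ℝ, ℝ) 𝓘(ℝ, ℝ) (fun s : ℝ => s + 1) t :=
    (differentiableAt_id.add_const (1 : ℝ)).mdifferentiableAt
  have h3 := mfderiv_comp t (hc.mdifferentiableAt (t + 1)) h2
  have h4 : (mfderiv 𝓘(ℝ, ℝ) 𝓘(ℝ, ℝ) (fun s : ℝ => s + 1) t (1 : ℝ) : ℝ) = 1 := by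
    rw [mfderiv_eq_fderiv]
    have : fderiv ℝ (fun s : ℝ => s + 1) t 1 = 1 := by simp
    exact this
  have h5 := congrArg (fun L : ℝ →L[ℝ] ℝ => L 1) h3
  refine (Eq.trans ?_ h5.symm).trans ?_
  · exact (congrArg (fun x : ℝ => (mfderiv 𝓘(ℝ, ℝ) 𝓘(ℝ, ℝ) c (t + 1) : ℝ →L[ℝ] ℝ) x) h4).symm
  · exact congrArg (fun γ : ℝ → C => (mfderiv 𝓘(ℝ, ℝ) 𝓘(ℝ, ℝ) γ t : ℝ →L[ℝ] ℝ) 1) h1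

lemma Connection.matrix_periodic (hc : IsCoordinate o c) (θ : P.Connection) (s : P.LocalSection)
    (t : ℝ) : θ.matrix s c (t + 1) = θ.matrix s c t :=
  θ.form_congr s (hc.map_add_one t) (hc.velocity_add_one t)

/-! ### Connections with a given matrix -/

/-- The 1-form `dt` of the coordinate `c`. -/
def coordForm (hc : IsCoordinate o c) (x : C) : TangentSpace 𝓘(ℝ, ℝ) x →ₗ[ℝ] ℝ :=
  (mfderiv 𝓘(ℝ, ℝ) 𝓘(ℝ, ℝ) (hc.chart (Function.surjInv hc.surjective x)).1 x).toLinearMap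

/-- Any chart inverse to c sends the velocity of c to 1, so dt does not depend on the choice of
chart. -/
lemma coordForm_eq (hc : IsCoordinate o c) {T : ℝ} {x : C} (hx : x ∈ (hc.chart T).1.source) :
    coordForm hc x = (mfderiv 𝓘(ℝ, ℝ) 𝓘(ℝ, ℝ) (hc.chart T).1 x).toLinearMap := by
  obtain ⟨t, rfl⟩ := hc.surjective x
  refine hc.linearMap_ext ((hc.mfderiv_chart ?_).trans (hc.mfderiv_chart hx).symm)
  exact hc.symm_mem_chart_source (Function.surjInv_eq hc.surjective _)

lemma coordForm_velocity (hc : IsCoordinate o c) (t : ℝ) :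
    coordForm hc (c t) (mfderiv 𝓘(ℝ, ℝ) 𝓘(ℝ, ℝ) c t (1 : ℝ)) = 1 :=
  hc.mfderiv_chart (hc.symm_mem_chart_source (Function.surjInv_eq hc.surjective _))

open Classical in
/-- The forms of the connection with matrix `A` in the frame `e`. -/
def frameForm (hc : IsCoordinate o c) (e : P.LocalSection) (A : ℝ → Matrix (Fin n) (Fin n) ℝ)
    (s : P.LocalSection) (x : C) : TangentSpace 𝓘(ℝ, ℝ) x →ₗ[ℝ] Matrix (Fin n) (Fin n) ℝ :=
  if x ∈ s.dom then
    gaugeTransformLin (fun y => translation (n := n) (e.val y) (s.val y)) x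
      ((coordForm hc x).smulRight (hc.desc A x))
  else 0

/-- Arbitrary curves are allowed because the formula is needed both for c and for inverses of
charts, in which smoothness of a connection is tested. -/
lemma frameForm_curve (hc : IsCoordinate o c) {e : P.LocalSection} (he : e.dom = Set.univ)
    {A : ℝ → Matrix (Fin n) (Fin n) ℝ} (s : P.LocalSection) {γ : ℝ → C} {t : ℝ}
    (hγ : MDifferentiableAt 𝓘(ℝ, ℝ) 𝓘(ℝ, ℝ) γ t) (ht : γ t ∈ s.dom) :
    frameForm hc e A s (γ t) (mfderiv 𝓘(ℝ, ℝ) 𝓘(ℝ, ℝ) γ t (1 : ℝ)) =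
      (translation (n := n) (e.val (γ t)) (s.val (γ t)))⁻¹.1 *
          (coordForm hc (γ t) (mfderiv 𝓘(ℝ, ℝ) 𝓘(ℝ, ℝ) γ t (1 : ℝ)) • hc.desc A (γ t)) *
          (translation (n := n) (e.val (γ t)) (s.val (γ t))).1 +
        (translation (n := n) (e.val (γ t)) (s.val (γ t)))⁻¹.1 *
          matDeriv (fun t => (translation (n := n) (e.val (γ t)) (s.val (γ t))).1) t := by
  rw [frameForm, if_pos ht]
  exact gaugeTransform_velocity hγ (e.isSmooth.isOpen.inter s.isSmooth.isOpen)
    (e.smooth_translation s) ⟨by rw [he]; trivial, ht⟩ _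

lemma frameForm_velocity (hc : IsCoordinate o c) {e : P.LocalSection} (he : e.dom = Set.univ)
    {A : ℝ → Matrix (Fin n) (Fin n) ℝ} (hA1 : ∀ t, A (t + 1) = A t) (s : P.LocalSection) {t : ℝ}
    (ht : c t ∈ s.dom) :
    frameForm hc e A s (c t) (mfderiv 𝓘(ℝ, ℝ) 𝓘(ℝ, ℝ) c t (1 : ℝ)) =
      (translation (n := n) (e.val (c t)) (s.val (c t)))⁻¹.1 * A t *
          (translation (n := n) (e.val (c t)) (s.val (c t))).1 +
        (translation (n := n) (e.val (c t)) (s.val (c t)))⁻¹.1 *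
          matDeriv (fun t => (translation (n := n) (e.val (c t)) (s.val (c t))).1) t := by
  rw [frameForm_curve hc he s (hc.mdifferentiableAt t) ht, coordForm_velocity hc, one_smul,
    hc.desc_apply hA1]

lemma smoothMat_translation (hc : IsCoordinate o c) (s s' : P.LocalSection) :
    SmoothMat (fun t => (translation (n := n) (s.val (c t)) (s'.val (c t))).1)
      (c ⁻¹' (s.dom ∩ s'.dom)) :=
  (hc.smoothSLOn_iff (s.isSmooth.isOpen.inter s'.isSmooth.isOpen)).1 (s.smooth_translation s')

lemma isOpen_preimage_dom (hc : IsCoordinate o c) (s : P.LocalSection) : IsOpen (c ⁻¹' s.dom) :=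
  s.isSmooth.isOpen.preimage hc.continuous

lemma coe_inv_mul {g : SL n} : (g⁻¹).1 * g.1 = 1 := by
  rw [← Matrix.SpecialLinearGroup.coe_mul, inv_mul_cancel, Matrix.SpecialLinearGroup.coe_one]

lemma coe_mul_inv {g : SL n} : g.1 * (g⁻¹).1 = 1 := by
  rw [← Matrix.SpecialLinearGroup.coe_mul, mul_inv_cancel, Matrix.SpecialLinearGroup.coe_one]

/-- Conjugation preserves the trace of A, and g⁻¹ g' is trace free for g in SL(n). -/
lemma trace_frameForm (hc : IsCoordinate o c) {e : P.LocalSection} (he : e.dom = Set.univ)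
    {A : ℝ → Matrix (Fin n) (Fin n) ℝ} (hA1 : ∀ t, A (t + 1) = A t) (htr : ∀ t, (A t).trace = 0)
    (s : P.LocalSection) (x : C) (X : TangentSpace 𝓘(ℝ, ℝ) x) :
    (frameForm hc e A s x X).trace = 0 := by
  by_cases hx : x ∈ s.dom
  · obtain ⟨t, rfl⟩ := hc.surjective x
    obtain ⟨k, rfl⟩ := hc.exists_smul_velocity t X
    have hxe : c t ∈ e.dom := by rw [he]; trivial
    rw [map_smul, Matrix.trace_smul, frameForm_velocity hc he hA1 s hx, Matrix.trace_add,
      trace_inv_mul_matDeriv (g := fun t => translation (n := n) (e.val (c t)) (s.val (c t)))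
        ((isOpen_preimage_dom hc e).inter (isOpen_preimage_dom hc s))
        (smoothMat_translation hc e s) ⟨hxe, hx⟩, Matrix.trace_mul_comm, ← mul_assoc, coe_mul_inv,
      one_mul, htr, add_zero, smul_zero]
  · rw [frameForm, if_neg hx]
    exact Matrix.trace_zero _ _

lemma contDiffOn_frameForm (hc : IsCoordinate o c) {e : P.LocalSection} (he : e.dom = Set.univ)
    {A : ℝ → Matrix (Fin n) (Fin n) ℝ} (hA : SmoothMat A Set.univ) (hA1 : ∀ t, A (t + 1) = A t)
    (s : P.LocalSection) {φ : OpenPartialHomeomorph C ℝ}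
    (hφ : φ ∈ IsManifold.maximalAtlas 𝓘(ℝ, ℝ) ∞ C) :
    SmoothMat (fun t : ℝ => frameForm hc e A s (φ.symm t)
        (mfderiv 𝓘(ℝ, ℝ) 𝓘(ℝ, ℝ) φ.symm t (1 : ℝ))) (φ.target ∩ φ.symm ⁻¹' s.dom) := by
  have hS : IsOpen (φ.target ∩ φ.symm ⁻¹' s.dom) :=
    φ.isOpen_inter_preimage_symm s.isSmooth.isOpen
  have hsm := contMDiffOn_symm_of_mem_maximalAtlas hφ
  have hcomp : ∀ {g : C → ℝ} {U : Set C}, ContMDiffOn 𝓘(ℝ, ℝ) 𝓘(ℝ, ℝ) ∞ g U →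
      ContDiffOn ℝ ∞ (fun t => g (φ.symm t)) (φ.target ∩ φ.symm ⁻¹' U) := fun hg =>
    contMDiffOn_iff_contDiffOn.1 (hg.comp (hsm.mono Set.inter_subset_left) fun t ht => ht.2)
  have hsmg : SmoothSLOn 𝓘(ℝ, ℝ) (fun x => translation (n := n) (e.val x) (s.val x)) s.dom :=
    (e.smooth_translation s).mono' fun x hx => ⟨by rw [he]; trivial, hx⟩
  have hg : SmoothMat (fun t => (translation (n := n) (e.val (φ.symm t)) (s.val (φ.symm t))).1)
      (φ.target ∩ φ.symm ⁻¹' s.dom) := fun i j => hcomp (hsmg i j)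
  have hginv : SmoothMat
      (fun t => (translation (n := n) (e.val (φ.symm t)) (s.val (φ.symm t)))⁻¹.1)
      (φ.target ∩ φ.symm ⁻¹' s.dom) := fun i j => hcomp (hsmg.inv i j)
  have hB : SmoothMat (fun t => coordForm hc (φ.symm t)
      (mfderiv 𝓘(ℝ, ℝ) 𝓘(ℝ, ℝ) φ.symm t (1 : ℝ)) • hc.desc A (φ.symm t))
      (φ.target ∩ φ.symm ⁻¹' s.dom) := by
    intro i j
    have h1 : ContDiffOn ℝ ∞ (fun t => coordForm hc (φ.symm t)
        (mfderiv 𝓘(ℝ, ℝ) 𝓘(ℝ, ℝ) φ.symm t (1 : ℝ))) φ.target := by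
      intro t₀ ht₀
      obtain ⟨T, hT⟩ := hc.surjective (φ.symm t₀)
      have hmem : φ.symm t₀ ∈ (hc.chart T).1.source := hc.symm_mem_chart_source hT
      have hV : IsOpen (φ.target ∩ φ.symm ⁻¹' (hc.chart T).1.source) :=
        φ.isOpen_inter_preimage_symm (hc.chart T).1.open_source
      have hψ := contMDiffOn_of_mem_maximalAtlas (o.smooth (hc.chart T).2)
      refine ContDiffAt.contDiffWithinAt (ContDiffAt.congr_of_eventuallyEq
        ((contDiffOn_deriv hV (hcomp hψ)).contDiffAt (hV.mem_nhds ⟨ht₀, hmem⟩))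
        (Filter.eventuallyEq_of_mem (hV.mem_nhds ⟨ht₀, hmem⟩) fun t ht => ?_))
      rw [coordForm_eq hc ht.2]
      exact mfderiv_comp_curve ((hsm.contMDiffAt (φ.open_target.mem_nhds ht.1)).mdifferentiableAt
        (by simp)) (hc.chart T).1.open_source hψ ht.2
    have h2 : ContMDiffOn 𝓘(ℝ, ℝ) 𝓘(ℝ, ℝ) ∞ (fun x => hc.desc A x i j) Set.univ := by
      rw [hc.contMDiffOn_iff isOpen_univ]
      simp only [hc.desc_apply hA1]
      exact hA i j
    exact (h1.mono Set.inter_subset_left).mul ((hcomp h2).mono fun t ht => ⟨ht.1, trivial⟩)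
  have hall := ((hginv.mul hB).mul hg).add (hginv.mul (hg.matDeriv hS))
  intro i j
  refine (hall i j).congr fun t ht => ?_
  exact congrFun (congrFun (frameForm_curve hc he s
    ((hsm.contMDiffAt (φ.open_target.mem_nhds ht.1)).mdifferentiableAt (by simp)) ht.2) i) j

/-- In a global frame, every smooth periodic trace free matrix function is the matrix of a
connection. -/
lemma exists_connection (hc : IsCoordinate o c) {e : P.LocalSection} (he : e.dom = Set.univ)
    {A : ℝ → Matrix (Fin n) (Fin n) ℝ} (hA : SmoothMat A Set.univ) (hA1 : ∀ t, A (t + 1) = A t)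
    (htr : ∀ t, (A t).trace = 0) : ∃ θ : P.Connection, ∀ t, θ.matrix e c t = A t := by
  have hmem : ∀ x, x ∈ e.dom := fun x => by rw [he]; trivial
  refine ⟨⟨frameForm hc e A, fun s x hx => if_neg hx, trace_frameForm hc he hA1 htr,
    fun s φ hφ => contDiffOn_frameForm hc he hA hA1 s hφ, ?_⟩, fun t => ?_⟩
  · rintro s s' x ⟨hx, hx'⟩ X
    obtain ⟨t, rfl⟩ := hc.surjective x
    -- With g the translation from e to s and h the one from s to s', this is the composition law of
    -- gauge transformations: transforming by g h is transforming by g, then by h.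
    have key : frameForm hc e A s' (c t) =
        gaugeTransformLin (fun y => translation (n := n) (s.val y) (s'.val y)) (c t)
          (frameForm hc e A s (c t)) := by
      refine hc.linearMap_ext ?_
      rw [frameForm_velocity hc he hA1 s' hx']
      refine Eq.trans ?_ (gaugeTransform_velocity (hc.mdifferentiableAt t)
        (s.isSmooth.isOpen.inter s'.isSmooth.isOpen) (s.smooth_translation s') ⟨hx, hx'⟩ _).symm
      rw [frameForm_velocity hc he hA1 s hx]
      have hmul : ∀ y, y ∈ s.dom → y ∈ s'.dom →
          translation (n := n) (e.val y) (s'.val y) =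
            translation (n := n) (e.val y) (s.val y) * translation (n := n) (s.val y) (s'.val y) :=
        fun y hy hy' => (P.translation_mul (e.proj_eq s (hmem y) hy) (s.proj_eq s' hy hy')).symm
      have hO : IsOpen (c ⁻¹' (s.dom ∩ s'.dom)) :=
        (isOpen_preimage_dom hc s).inter (isOpen_preimage_dom hc s')
      have hev : (fun t => (translation (n := n) (e.val (c t)) (s'.val (c t))).1) =ᶠ[nhds t]
          fun t => (translation (n := n) (e.val (c t)) (s.val (c t))).1 *
            (translation (n := n) (s.val (c t)) (s'.val (c t))).1 :=
        Filter.eventuallyEq_of_mem (hO.mem_nhds ⟨hx, hx'⟩) fun t ht => by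
          rw [← Matrix.SpecialLinearGroup.coe_mul, ← hmul _ ht.1 ht.2]
      rw [matDeriv_congr hev, matDeriv_mul hO
        ((smoothMat_translation hc e s).mono fun t ht => ⟨hmem _, ht.1⟩)
        (smoothMat_translation hc s s') ⟨hx, hx'⟩, hmul _ hx hx', mul_inv_rev,
        Matrix.SpecialLinearGroup.coe_mul, Matrix.SpecialLinearGroup.coe_mul]
      generalize translation (n := n) (e.val (c t)) (s.val (c t)) = g
      generalize translation (n := n) (s.val (c t)) (s'.val (c t)) = h
      have h1 : ∀ M : Matrix (Fin n) (Fin n) ℝ, (g⁻¹).1 * (g.1 * M) = M := fun M => by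
        rw [← mul_assoc, coe_inv_mul, one_mul]
      simp only [mul_add, add_mul, mul_assoc, h1, add_assoc]
    exact congrArg (fun L => L X) key
  · have h := frameForm_velocity hc he hA1 e (hmem (c t))
    refine h.trans ?_
    have h1 : ∀ q : Q, translation (n := n) q q = 1 := P.translation_self
    simp only [h1, inv_one, Matrix.SpecialLinearGroup.coe_one, one_mul, mul_one, matDeriv_const,
      add_zero]

end PrincipalBundle

/-! ## Normalization of matrices, rays and flags -/

open Classical in
/-- The positive multiple of `M` of determinant one. -/
def slNormalize {n : ℕ} (M : Matrix (Fin n) (Fin n) ℝ) : SL n :=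
  if h : 0 < M.det ∧ n ≠ 0 then
    ⟨M.det ^ (-(n : ℝ)⁻¹) • M, by
      have hn : (n : ℝ) ≠ 0 := Nat.cast_ne_zero.2 h.2
      rw [Matrix.det_smul, Fintype.card_fin, ← Real.rpow_natCast, ← Real.rpow_mul h.1.le,
        neg_mul, inv_mul_cancel₀ hn, Real.rpow_neg_one, inv_mul_cancel₀ h.1.ne']⟩
  else 1

section Normalize

variable {n : ℕ}

lemma slNormalize_coe [NeZero n] {M : Matrix (Fin n) (Fin n) ℝ} (h : 0 < M.det) :
    (slNormalize M).1 = M.det ^ (-(n : ℝ)⁻¹) • M := by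
  have h1 : slNormalize M = ⟨M.det ^ (-(n : ℝ)⁻¹) • M, _⟩ := dif_pos ⟨h, NeZero.ne n⟩
  exact congrArg Subtype.val h1

/-- Multiplication by g preserves the determinant. This equivariance is what makes normalized local
frames agree on overlaps. -/
lemma slNormalize_mul [NeZero n] (g : SL n) {M : Matrix (Fin n) (Fin n) ℝ} (h : 0 < M.det) :
    slNormalize (g.1 * M) = g * slNormalize M := by
  have hd : (g.1 * M).det = M.det := by rw [Matrix.det_mul, g.2, one_mul]
  apply Subtype.ext
  rw [slNormalize_coe (by rwa [hd]), Matrix.SpecialLinearGroup.coe_mul, slNormalize_coe h, hd,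
    mul_smul_comm]

lemma slNormalize_coe_SL [NeZero n] (g : SL n) : slNormalize g.1 = g := by
  apply Subtype.ext
  rw [slNormalize_coe (by rw [g.2]; exact one_pos), g.2, Real.one_rpow, one_smul]

lemma IsPosUpper.det_pos {b : Matrix (Fin n) (Fin n) ℝ} (hb : IsPosUpper b) : 0 < b.det := by
  have h : b.IsUpperTriangular := fun i j hij => hb.1 i j hij
  rw [Matrix.det_of_isUpperTriangular h]
  exact Finset.prod_pos fun i _ => hb.2 i

lemma IsPosUpper.slNormalize_mem [NeZero n] {b : Matrix (Fin n) (Fin n) ℝ} (hb : IsPosUpper b) :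
    slNormalize b ∈ borel n := by
  have h := Real.rpow_pos_of_pos hb.det_pos (-(n : ℝ)⁻¹)
  change IsPosUpper (slNormalize b).1
  rw [slNormalize_coe hb.det_pos]
  refine ⟨fun i j hij => ?_, fun i => ?_⟩
  · rw [Matrix.smul_apply, hb.1 i j hij, smul_zero]
  · exact mul_pos h (hb.2 i)

/-- Convexity holds before the determinant is fixed. Followed by `slNormalize` it connects any two
elements of B within B. -/
lemma IsPosUpper.convex {b b' : Matrix (Fin n) (Fin n) ℝ} (hb : IsPosUpper b)
    (hb' : IsPosUpper b') {l : ℝ} (h0 : 0 ≤ l) (h1 : l ≤ 1) :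
    IsPosUpper ((1 - l) • b + l • b') := by
  refine ⟨fun i j hij => ?_, fun i => ?_⟩
  · simp [hb.1 i j hij, hb'.1 i j hij]
  · have h2 := hb.2 i
    have h3 := hb'.2 i
    simp only [Matrix.add_apply, Matrix.smul_apply, smul_eq_mul]
    rcases h0.eq_or_lt with rfl | h0
    · simpa using h2
    · have := mul_pos h0 h3
      have := mul_nonneg (sub_nonneg.2 h1) h2.le
      linarith

section Manifolds

variable {E H M : Type*} [NormedAddCommGroup E] [NormedSpace ℝ E] [TopologicalSpace H]
  [TopologicalSpace M] [ChartedSpace H M] {I : ModelWithCorners ℝ E H}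

lemma contMDiffOn_det {A : M → Matrix (Fin n) (Fin n) ℝ} {S : Set M}
    (hA : ∀ i j, ContMDiffOn I 𝓘(ℝ, ℝ) ∞ (fun x => A x i j) S) :
    ContMDiffOn I 𝓘(ℝ, ℝ) ∞ (fun x => (A x).det) S := by
  simp only [Matrix.det_apply']
  exact contMDiffOn_finsetSum fun σ _ => contMDiffOn_const.mul
    (contMDiffOn_finsetProd fun k _ => hA (σ k) k)

lemma contMDiffOn_rpow {f : M → ℝ} {S : Set M} (hf : ContMDiffOn I 𝓘(ℝ, ℝ) ∞ f S)
    (hpos : ∀ x ∈ S, 0 < f x) (r : ℝ) : ContMDiffOn I 𝓘(ℝ, ℝ) ∞ (fun x => f x ^ r) S := by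
  have h : ContDiffOn ℝ ∞ (fun y : ℝ => y ^ r) (Set.Ioi 0) := fun y hy =>
    (Real.contDiffAt_rpow_const_of_ne (ne_of_gt hy)).contDiffWithinAt
  exact h.contMDiffOn.comp hf hpos

lemma smoothSLOn_slNormalize [NeZero n] {A : M → Matrix (Fin n) (Fin n) ℝ} {S : Set M}
    (hA : ∀ i j, ContMDiffOn I 𝓘(ℝ, ℝ) ∞ (fun x => A x i j) S) (hpos : ∀ x ∈ S, 0 < (A x).det) :
    SmoothSLOn I (fun x => slNormalize (A x)) S := by
  intro i j
  refine ((contMDiffOn_rpow (contMDiffOn_det hA) hpos (-(n : ℝ)⁻¹)).mul (hA i j)).congr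
    fun x hx => ?_
  rw [slNormalize_coe (hpos x hx)]
  rfl

end Manifolds

/-! ### Rays -/

lemma Represents.unique {v : Fin n → ℝ} {x y : Sphere n} (hx : Represents v x)
    (hy : Represents v y) : x = y := by
  obtain ⟨h, rfl⟩ := hx
  obtain ⟨h', rfl⟩ := hy
  rfl

lemma Represents.smul {v : Fin n → ℝ} {x : Sphere n} (hx : Represents v x) {k : ℝ} (hk : 0 < k) :
    Represents (k • v) x := by
  obtain ⟨h, rfl⟩ := hx
  refine ⟨smul_ne_zero hk.ne' h, ?_⟩
  exact (ray_eq_iff _ _).2 (SameRay.sameRay_pos_smul_left v hk)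

lemma Represents.exists_pos_smul {v w : Fin n → ℝ} {x : Sphere n} (hv : Represents v x)
    (hw : Represents w x) : ∃ k : ℝ, 0 < k ∧ w = k • v := by
  obtain ⟨h, rfl⟩ := hv
  obtain ⟨h', h2⟩ := hw
  obtain ⟨r, hr, h3⟩ := ((ray_eq_iff h' h).1 h2).symm.exists_pos_left h h'
  exact ⟨r, hr, h3.symm⟩

lemma Represents.act {v : Fin n → ℝ} {x : Sphere n} (hv : Represents v x) (g : SL n) :
    Represents (g.1 *ᵥ v) (sphereAct g x) := by
  obtain ⟨h, rfl⟩ := hv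
  refine ⟨?_, ?_⟩
  · intro h0
    exact h ((Matrix.SpecialLinearGroup.toLin' g).map_eq_zero_iff.1 h0)
  · rfl

/-! ### Flags -/

lemma mk_eq_standardFlag_iff {g : SL n} : (g : OrientedFlag n) = standardFlag n ↔ g ∈ borel n := by
  rw [standardFlag, eq_comm, QuotientGroup.eq, inv_one, one_mul]

lemma smul_mk (g h : SL n) : g • (h : OrientedFlag n) = ((g * h : SL n) : OrientedFlag n) :=
  rfl

/-- A representative of the standard flag lies in B, and its first column is a positive multiple of
e₁. -/
lemma FlagOver.represents_single [NeZero n] {x : Sphere n} (h : FlagOver (standardFlag n) x) :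
    Represents (Pi.single 0 1) x := by
  obtain ⟨g, hg, hx⟩ := h
  have hg' : IsPosUpper g.1 := mk_eq_standardFlag_iff.1 hg
  have h1 : (Pi.single 0 1 : Fin n → ℝ) = (g.1 0 0)⁻¹ • fun k => g.1 k 0 := by
    ext k
    by_cases hk : k = 0
    · subst hk
      simp [(hg'.2 0).ne']
    · simp [hk, hg'.1 k 0 (Fin.pos_iff_ne_zero.2 hk)]
  rw [h1]
  exact (hx 0 rfl).smul (inv_pos.2 (hg'.2 0))

end Normalize

/-! ### Frames adapted to a flag lift -/

namespace PrincipalBundle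

variable {n : ℕ} {C : Type*} [TopologicalSpace C] [ChartedSpace ℝ C] {Q : Type*}
  [MulAction (SL n)ᵐᵒᵖ Q] {P : PrincipalBundle n C Q} {τ : Q → Sphere n} {T : Q → OrientedFlag n}

lemma IsFlagLift.smul_eq_standardFlag (hT : P.IsFlagLift τ T) {q : Q} {g : SL n}
    (h : (g : OrientedFlag n) = T q) : T (q <• g) = standardFlag n := by
  rw [hT.equivariant, ← h, smul_mk, inv_mul_cancel]
  rfl

lemma IsFlagLift.smul_eq_standardFlag_iff (hT : P.IsFlagLift τ T) {q : Q} {g : SL n} :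
    T (q <• g) = standardFlag n ↔ T q = (g : OrientedFlag n) := by
  rw [hT.equivariant, inv_smul_eq_iff, standardFlag, smul_mk, mul_one]

lemma IsFlagLift.translation_mem_borel (hT : P.IsFlagLift τ T) {q q' : Q}
    (hp : P.proj q = P.proj q') (h : T q = standardFlag n) (h' : T q' = standardFlag n) :
    translation (n := n) q q' ∈ borel n := by
  rw [smul_translation (P := P) q q' hp, hT.smul_eq_standardFlag_iff, h] at h'
  exact mk_eq_standardFlag_iff.1 h'.symm

/-- Locally, there are sections along which a given flag lift is standard. -/
lemma IsFlagLift.exists_local_frame (hT : P.IsFlagLift τ T) (x : C) :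
    ∃ s : P.LocalSection, x ∈ s.dom ∧ ∀ y ∈ s.dom, T (s.val y) = standardFlag n := by
  obtain ⟨a, ha, hx⟩ := P.cover x
  obtain ⟨g, hg, hgT⟩ := hT.smooth (atlasSection a ha)
  exact ⟨(atlasSection a ha).mulRight g a.1 (P.isOpen a ha) subset_rfl hg, hx,
    fun y hy => hT.smul_eq_standardFlag (hgT y hy)⟩

open Classical in
/-- The oriented flags of a flag lift are the standard flags of a global section. -/
lemma IsFlagLift.exists_isFlagFrame [NeZero n] [T2Space C] [CompactSpace C]
    [IsManifold 𝓘(ℝ, ℝ) ∞ C] (hT : P.IsFlagLift τ T) :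
    ∃ e : P.LocalSection, e.IsFlagFrame T := by
  choose s hs hsT using hT.exists_local_frame
  obtain ⟨ρ, hρ⟩ := SmoothPartitionOfUnity.exists_isSubordinate (I := 𝓘(ℝ, ℝ)) (s := Set.univ)
    isClosed_univ (fun x : C => (s x).dom) (fun x => (s x).isSmooth.isOpen)
    (fun x _ => Set.mem_iUnion.2 ⟨x, hs x⟩)
  have hρs : ∀ i x, ρ i x ≠ 0 → x ∈ (s i).dom := fun i x h =>
    hρ i (subset_tsupport _ (Function.mem_support.2 h))
  -- The adapted local frames are averaged, written relative to the frame j. Translations between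
  -- adapted frames lie in B, so the average is again upper triangular with positive diagonal.
  let S : C → C → Matrix (Fin n) (Fin n) ℝ := fun j x => Matrix.of fun a b =>
    ∑ᶠ i, ρ i x • (translation (n := n) ((s j).val x) ((s i).val x)).1 a b
  have hfin : ∀ x, (Function.support fun i => ρ i x).Finite := fun x =>
    ρ.locallyFinite.point_finite x
  have hS : ∀ j x, S j x = ∑ i ∈ (hfin x).toFinset,
      ρ i x • (translation (n := n) ((s j).val x) ((s i).val x)).1 := by
    intro j x
    ext a b
    rw [Matrix.sum_apply]
    refine finsum_eq_sum_of_support_subset _ fun i hi => ?_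
    rw [Set.Finite.coe_toFinset]
    intro h0
    refine hi ?_
    exact (congrArg (· • (translation (n := n) ((s j).val x) ((s i).val x)).1 a b) h0).trans
      (zero_smul ℝ _)
  have hmem : ∀ x, ∀ i ∈ (hfin x).toFinset, ρ i x ≠ 0 := fun x i hi => by
    simpa using hi
  have hup : ∀ j, ∀ x ∈ (s j).dom, IsPosUpper (S j x) := by
    intro j x hx
    have hb : ∀ i ∈ (hfin x).toFinset,
        IsPosUpper (translation (n := n) ((s j).val x) ((s i).val x)).1 := fun i hi =>
      hT.translation_mem_borel ((s j).proj_eq (s i) hx (hρs i x (hmem x i hi)))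
        (hsT j x hx) (hsT i x (hρs i x (hmem x i hi)))
    rw [hS]
    refine ⟨fun a b hab => ?_, fun a => ?_⟩
    · rw [Matrix.sum_apply]
      refine Finset.sum_eq_zero fun i hi => ?_
      rw [Matrix.smul_apply, (hb i hi).1 a b hab, smul_zero]
    · rw [Matrix.sum_apply]
      obtain ⟨i, hi⟩ := ρ.exists_pos_of_mem (Set.mem_univ x)
      refine Finset.sum_pos (fun i hi => ?_) ⟨i, ?_⟩
      · exact mul_pos (lt_of_le_of_ne (ρ.nonneg i x) (hmem x i hi).symm) ((hb i hi).2 a)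
      · simpa using hi.ne'
  have hchange : ∀ j j' x, x ∈ (s j).dom → x ∈ (s j').dom →
      S j x = (translation (n := n) ((s j).val x) ((s j').val x)).1 * S j' x := by
    intro j j' x hj hj'
    rw [hS, hS, Finset.mul_sum]
    refine Finset.sum_congr rfl fun i hi => ?_
    have hi' := hρs i x (hmem x i hi)
    rw [mul_smul_comm, ← Matrix.SpecialLinearGroup.coe_mul,
      P.translation_mul ((s j).proj_eq (s j') hj hj') ((s j').proj_eq (s i) hj' hi')]
  -- At x the local frame indexed by x itself is used; `hchange` shows that any other frame defined
  -- at x gives the same point, and near a fixed x one frame can be used throughout.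
  let e : C → Q := fun x => (s x).val x <• slNormalize (S x x)
  have he : ∀ j, ∀ x ∈ (s j).dom, e x = (s j).val x <• slNormalize (S j x) := by
    intro j x hx
    rw [hchange j x x hx (hs x), slNormalize_mul _ (hup x x (hs x)).det_pos, smul_mul_right,
      ← (s j).smul_translation (s x) hx (hs x)]
  have hsmooth : ∀ j a b, ContMDiffOn 𝓘(ℝ, ℝ) 𝓘(ℝ, ℝ) ∞ (fun x => S j x a b) (s j).dom := by
    intro j a b x hx
    refine ContMDiffAt.contMDiffWithinAt (ρ.contMDiffAt_finsum fun i hi => ?_)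
    have hx' : x ∈ (s j).dom ∩ (s i).dom := ⟨hx, hρ i hi⟩
    exact (((s j).smooth_translation (s i)) a b x hx').contMDiffAt
      (((s j).isSmooth.isOpen.inter (s i).isSmooth.isOpen).mem_nhds hx')
  refine ⟨⟨Set.univ, e, isOpen_univ, fun x _ => ?_, fun a ha => ?_⟩, rfl, fun x => ?_⟩
  · rw [he x x (hs x), P.proj_smul, (s x).proj_val (hs x)]
  · refine smoothSLOn_of_locally fun x hx => ⟨(s x).dom, (s x).isSmooth.isOpen, hs x, ?_⟩
    have h1 := smoothSLOn_slNormalize (hsmooth x) fun y hy => (hup x y hy).det_pos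
    refine ((((s x).isSmooth.smooth a ha).mono' ?_).mul (h1.mono' ?_)).congr' fun y hy => ?_
    · exact fun y hy => ⟨hy.2, hy.1.2⟩
    · exact fun y hy => hy.2
    · rw [he x y hy.2]
      exact P.translation_smul_right
        (by rw [P.proj_section a ha y hy.1.2, (s x).proj_val hy.2]) _
  · change T (e x) = _
    rw [hT.smul_eq_standardFlag_iff, hsT x x (hs x)]
    exact (mk_eq_standardFlag_iff.2 (hup x x (hs x)).slNormalize_mem).symm

end PrincipalBundle

namespace PrincipalBundle

variable {n : ℕ} {C : Type*} [TopologicalSpace C] [ChartedSpace ℝ C] {Q : Type*}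
  [MulAction (SL n)ᵐᵒᵖ Q] {P : PrincipalBundle n C Q} {o : Orientation C} {c : ℝ → C}
  {τ : Q → Sphere n} {T : Q → OrientedFlag n}

lemma IsSphereMap.represents_smul (hτ : P.IsSphereMap τ) {q : Q} {v : Fin n → ℝ}
    (h : Represents v (τ q)) (g : SL n) : Represents ((g⁻¹).1 *ᵥ v) (τ (q <• g)) := by
  rw [hτ.equivariant]
  exact h.act _

lemma LocalSection.IsFlagFrame.represents [NeZero n] {e : P.LocalSection} (he : e.IsFlagFrame T)
    (hT : P.IsFlagLift τ T) (x : C) : Represents (Pi.single 0 1) (τ (e.val x)) :=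
  FlagOver.represents_single (he.2 x ▸ hT.lift (e.val x))

/-! ### Gauge transformations in a global frame -/

section FrameGauge

variable {e : P.LocalSection}

lemma proj_frame (he : e.dom = Set.univ) (x : C) : P.proj (e.val x) = x :=
  e.proj_val (by rw [he]; trivial)

lemma eq_frame_smul (he : e.dom = Set.univ) (q : Q) :
    q = e.val (P.proj q) <• translation (n := n) (e.val (P.proj q)) q :=
  smul_translation (P := P) _ _ (proj_frame he _)

/-- The map of `Q` which multiplies the frame `e` by `H`. -/
def frameMap (e : P.LocalSection) (H : C → SL n) (q : Q) : Q :=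
  e.val (P.proj q) <• (H (P.proj q) * translation (n := n) (e.val (P.proj q)) q)

lemma proj_frameMap (he : e.dom = Set.univ) (H : C → SL n) (q : Q) : P.proj (frameMap e H q) = P.proj q := by
  rw [frameMap, P.proj_smul, proj_frame he]

lemma frameMap_smul_frame (he : e.dom = Set.univ) (H : C → SL n) (x : C) (g : SL n) :
    frameMap e H (e.val x <• g) = e.val x <• (H x * g) := by
  rw [frameMap, P.proj_smul, proj_frame he, P.translation_smul]

lemma frameMap_frame (he : e.dom = Set.univ) (H : C → SL n) (x : C) : frameMap e H (e.val x) = e.val x <• H x := by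
  have h := frameMap_smul_frame he H x 1
  rwa [mul_one, MulOpposite.op_one, one_smul] at h

lemma frameMap_frameMap (he : e.dom = Set.univ) (H H' : C → SL n) (q : Q) :
    frameMap e H (frameMap e H' q) = frameMap e (fun x => H x * H' x) q := by
  rw [eq_frame_smul he q]
  generalize P.proj q = x
  generalize translation (n := n) (e.val x) q = g
  rw [frameMap_smul_frame he, frameMap_smul_frame he, frameMap_smul_frame he, mul_assoc]

lemma frameMap_one (he : e.dom = Set.univ) (q : Q) : frameMap e (fun _ => (1 : SL n)) q = q := by
  rw [frameMap, one_mul, ← eq_frame_smul he q]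

lemma frameMap_smul (he : e.dom = Set.univ) (H : C → SL n) (q : Q) (g : SL n) :
    frameMap e H (q <• g) = frameMap e H q <• g := by
  rw [eq_frame_smul he q]
  generalize P.proj q = x
  generalize translation (n := n) (e.val x) q = h
  rw [← smul_mul_right, frameMap_smul_frame he, frameMap_smul_frame he, ← smul_mul_right,
    mul_assoc]

lemma isSmoothSection_frameMap (he : e.dom = Set.univ) {H : C → SL n} (hH : SmoothSLOn 𝓘(ℝ, ℝ) H Set.univ) {U : Set C}
    {s : C → Q} (hs : P.IsSmoothSection U s) :
    P.IsSmoothSection U (fun x => frameMap e H (s x)) := by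
  have hg : SmoothSLOn 𝓘(ℝ, ℝ) (fun x => H x * translation (n := n) (e.val x) (s x)) U :=
    (hH.mono' (Set.subset_univ U)).mul
      ((e.smooth_translation ⟨U, s, hs⟩).mono' fun x hx => ⟨by rw [he]; trivial, hx⟩)
  refine (e.mulRight _ U hs.isOpen (by rw [he]; exact Set.subset_univ U) hg).isSmooth.congr
    fun x hx => ?_
  rw [frameMap, hs.proj x hx]
  rfl

/-- The gauge transformation which multiplies the frame `e` by `H`. -/
def frameGauge (he : e.dom = Set.univ) {H : C → SL n} (hH : SmoothSLOn 𝓘(ℝ, ℝ) H Set.univ) : P.gauge :=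
  ⟨{ toFun := frameMap e H
     invFun := frameMap e fun x => (H x)⁻¹
     left_inv := fun q => by
      rw [frameMap_frameMap he]
      simp only [inv_mul_cancel]
      exact frameMap_one he q
     right_inv := fun q => by
      rw [frameMap_frameMap he]
      simp only [mul_inv_cancel]
      exact frameMap_one he q },
    frameMap_smul he H, proj_frameMap he H, fun _ _ hs =>
      ⟨isSmoothSection_frameMap he hH hs, isSmoothSection_frameMap he hH.inv hs⟩⟩

lemma frameGauge_apply (he : e.dom = Set.univ) {H : C → SL n} (hH : SmoothSLOn 𝓘(ℝ, ℝ) H Set.univ) (q : Q) :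
    (frameGauge he hH).1 q = frameMap e H q :=
  rfl

lemma frameGauge_inv_apply (he : e.dom = Set.univ) {H : C → SL n} (hH : SmoothSLOn 𝓘(ℝ, ℝ) H Set.univ) (q : Q) :
    (frameGauge he hH)⁻¹.1 q = frameMap e (fun x => (H x)⁻¹) q :=
  rfl

lemma gauge_ext (he : e.dom = Set.univ) {u v : P.gauge} (h : ∀ x, u.1 (e.val x) = v.1 (e.val x)) : u = v := by
  apply Subtype.ext
  ext q
  rw [eq_frame_smul he q, u.2.1, v.2.1, h]

lemma gauge_smul_translation (u : P.gauge) (q : Q) :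
    u.1 q = q <• translation (n := n) q (u.1 q) :=
  smul_translation (P := P) _ _ (u.2.2.1 q).symm

/-- Along the frame τ is the ray of e₁, so fixing τ amounts to fixing that ray. The converse
direction is `exists_pos_of_mem_gaugeFixing`. -/
lemma frameGauge_mem_gaugeFixing [NeZero n] (he : e.dom = Set.univ) (hτ : P.IsSphereMap τ)
    (heτ : ∀ x, Represents (Pi.single 0 1) (τ (e.val x))) {H : C → SL n}
    (hH : SmoothSLOn 𝓘(ℝ, ℝ) H Set.univ)
    (h : ∀ x, ∃ k : ℝ, 0 < k ∧ (H x).1 *ᵥ Pi.single 0 1 = k • Pi.single 0 1) :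
    frameGauge he hH ∈ P.gaugeFixing τ := by
  intro q
  rw [frameGauge_inv_apply, eq_frame_smul he q, frameMap_smul_frame he]
  generalize P.proj q = x
  generalize translation (n := n) (e.val x) q = g
  have h1 := hτ.represents_smul (heτ x) ((H x)⁻¹ * g)
  have h2 := hτ.represents_smul (heτ x) g
  obtain ⟨k, hk, hk'⟩ := h x
  rw [mul_inv_rev, inv_inv, Matrix.SpecialLinearGroup.coe_mul, ← Matrix.mulVec_mulVec, hk',
    Matrix.mulVec_smul] at h1
  exact h1.unique (h2.smul hk)

lemma exists_pos_of_mem_gaugeFixing [NeZero n] (hτ : P.IsSphereMap τ)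
    {q : Q} (heτ : Represents (Pi.single 0 1) (τ q)) {u : P.gauge} (hu : u ∈ P.gaugeFixing τ) :
    ∃ k : ℝ, 0 < k ∧ (translation (n := n) q (u⁻¹.1 q)).1 *ᵥ Pi.single 0 1 = k • Pi.single 0 1 := by
  have h1 : Represents ((translation (n := n) q (u⁻¹.1 q))⁻¹.1 *ᵥ Pi.single 0 1) (τ q) := by
    have := hτ.represents_smul heτ (translation (n := n) q (u⁻¹.1 q))
    rwa [← gauge_smul_translation u⁻¹, hu q] at this
  obtain ⟨k, hk, hk'⟩ := h1.exists_pos_smul heτ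
  refine ⟨k, hk, ?_⟩
  conv_lhs => rw [hk']
  rw [Matrix.mulVec_smul, Matrix.mulVec_mulVec, coe_mul_inv, Matrix.one_mulVec]

lemma translation_frameGauge (he : e.dom = Set.univ) {H : C → SL n} (hH : SmoothSLOn 𝓘(ℝ, ℝ) H Set.univ) {x : C} {q : Q}
    (hq : P.proj q = x) : translation (n := n) q ((frameGauge he hH).1 q) =
      (translation (n := n) (e.val x) q)⁻¹ * H x * translation (n := n) (e.val x) q := by
  subst hq
  refine translation_unique P ?_
  rw [frameGauge_apply, frameMap]
  conv_rhs => rw [eq_frame_smul he q]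
  rw [P.proj_smul, proj_frame he, P.translation_smul, ← smul_mul_right, mul_assoc,
    mul_inv_cancel_left]

/-- Relative to another section the matrix of the gauge transformation is conjugated by a
translation function independent of the parameter. -/
lemma isSmoothPath_frameGauge (he : e.dom = Set.univ) {H : ℝ → C → SL n} (hH : ∀ l, SmoothSLOn 𝓘(ℝ, ℝ) (H l) Set.univ)
    (hH2 : SmoothSLOn (𝓘(ℝ, ℝ).prod 𝓘(ℝ, ℝ)) (fun z : ℝ × C => H z.1 z.2) Set.univ) :
    P.IsSmoothPath fun l => frameGauge he (hH l) := by
  intro s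
  have h1 : SmoothSLOn (𝓘(ℝ, ℝ).prod 𝓘(ℝ, ℝ))
      (fun z : ℝ × C => translation (n := n) (e.val z.2) (s.val z.2)) (Set.univ ×ˢ s.dom) :=
    fun i j => (e.smooth_translation s i j).comp contMDiff_snd.contMDiffOn
      fun z hz => ⟨by rw [he]; trivial, hz.2⟩
  refine ((h1.inv.mul (hH2.mono' (Set.subset_univ _))).mul h1).congr' fun z hz => ?_
  exact translation_frameGauge he (hH z.1) (s.proj_val hz.2)

end FrameGauge

/-! ### Pulling back flag lifts by gauge transformations -/

lemma IsFlagLift.comp_gauge (hT : P.IsFlagLift τ T) {u : P.gauge} (hu : u ∈ P.gaugeFixing τ) :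
    P.IsFlagLift τ fun q => T (u⁻¹.1 q) where
  equivariant q g := by rw [u⁻¹.2.1, hT.equivariant]
  smooth s := hT.smooth (s.map u⁻¹)
  lift q := by
    rw [← hu q]
    exact hT.lift _

/-- The homotopy is composed with the path of gauge transformations run backwards, F_l ∘ U_{1-l}⁻¹.
At l = 0 this is T₀ ∘ u⁻¹, and at l = 1 it is T₁ because U_0 = 1. -/
lemma LiftHomotopic.comp_path {T₀ T₁ : Q → OrientedFlag n} (h : P.LiftHomotopic τ T₀ T₁)
    {u : P.gauge} (hu : u ∈ P.gaugeFixingIdentity τ) :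
    P.LiftHomotopic τ (fun q => T₀ (u⁻¹.1 q)) T₁ := by
  obtain ⟨F, hF0, hF1, hF, hFs⟩ := h
  obtain ⟨U, hU0, hU1, hU, hUs⟩ := hu
  refine ⟨fun l q => F l ((U (1 - l))⁻¹.1 q), ?_, ?_, fun l => (hF l).comp_gauge (hU _),
    fun s => ?_⟩
  · funext q
    simp only [hF0, sub_zero, hU1]
  · funext q
    simp only [hF1, sub_self, hU0, inv_one]
    rfl
  · obtain ⟨g, hg, hgF⟩ := hFs s
    have h1 : SmoothSLOn (𝓘(ℝ, ℝ).prod 𝓘(ℝ, ℝ)) (fun z : ℝ × C =>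
        translation (n := n) (s.val z.2) ((U (1 - z.1)).1 (s.val z.2))) (Set.univ ×ˢ s.dom) :=
      fun i j => (hUs s i j).comp (t := Set.univ ×ˢ s.dom) (f := fun z : ℝ × C => (1 - z.1, z.2))
        ((((contDiff_const.sub contDiff_id).contMDiff (n := ∞) (f := fun l : ℝ => 1 - l)).comp
          contMDiff_fst).prodMk contMDiff_snd).contMDiffOn
        fun z hz => ⟨trivial, hz.2⟩
    refine ⟨_, h1.mul hg, fun z hz => ?_⟩
    have h2 : (U (1 - z.1))⁻¹.1 (s.val z.2) = s.val z.2 <•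
        (translation (n := n) (s.val z.2) ((U (1 - z.1)).1 (s.val z.2)))⁻¹ := by
      apply (U (1 - z.1)).1.injective
      rw [(U (1 - z.1)).2.1]
      have h1 : (U (1 - z.1)).1 ((U (1 - z.1))⁻¹.1 (s.val z.2)) = s.val z.2 :=
        perm_apply_inv (U (1 - z.1)).1 _
      rw [h1, eq_comm, MulOpposite.op_inv, inv_smul_eq_iff]
      exact gauge_smul_translation _ _
    change _ = F z.1 ((U (1 - z.1))⁻¹.1 (s.val z.2))
    rw [h2, (hF z.1).equivariant, inv_inv, ← smul_mk]
    exact congrArg (_ • ·) (hgF z hz)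

end PrincipalBundle

/-! ### Flags spanned by matrices of positive determinant -/

section Spans

variable {n : ℕ}

/-- Such a matrix is a positive multiple of an element of B, where inverses are available. The case
n = 0 is separate because normalization requires n ≠ 0. -/
lemma IsPosUpper.exists_mul_eq {b : Matrix (Fin n) (Fin n) ℝ} (hb : IsPosUpper b) :
    ∃ b', IsPosUpper b' ∧ b * b' = 1 ∧ b' * b = 1 := by
  rcases Nat.eq_zero_or_pos n with rfl | hn
  · exact ⟨b, hb, Subsingleton.elim _ _, Subsingleton.elim _ _⟩
  have : NeZero n := ⟨hn.ne'⟩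
  have hd := Real.rpow_pos_of_pos hb.det_pos (-(n : ℝ)⁻¹)
  have h1 : IsPosUpper ((slNormalize b)⁻¹).1 := (borel n).inv_mem hb.slNormalize_mem
  have h2 := slNormalize_coe hb.det_pos
  refine ⟨b.det ^ (-(n : ℝ)⁻¹) • ((slNormalize b)⁻¹).1, ⟨fun i j hij => ?_, fun i => ?_⟩, ?_, ?_⟩
  · rw [Matrix.smul_apply, h1.1 i j hij, smul_zero]
  · exact mul_pos hd (h1.2 i)
  · rw [mul_smul_comm, ← smul_mul_assoc, ← h2, PrincipalBundle.coe_mul_inv]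
  · rw [smul_mul_assoc, ← mul_smul_comm, ← h2, PrincipalBundle.coe_inv_mul]

lemma SpansFlag.mul_isPosUpper {W b : Matrix (Fin n) (Fin n) ℝ} {F : OrientedFlag n}
    (h : SpansFlag W F) (hb : IsPosUpper b) : SpansFlag (W * b) F := by
  obtain ⟨g, b', hb', rfl, hF⟩ := h
  exact ⟨g, b' * b, hb'.mul hb, mul_assoc _ _ _, hF⟩

lemma spansFlag_mul_iff {W b : Matrix (Fin n) (Fin n) ℝ} {F : OrientedFlag n}
    (hb : IsPosUpper b) : SpansFlag (W * b) F ↔ SpansFlag W F := by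
  refine ⟨fun h => ?_, fun h => h.mul_isPosUpper hb⟩
  obtain ⟨b', hb', h1, -⟩ := hb.exists_mul_eq
  have := h.mul_isPosUpper hb'
  rwa [mul_assoc, h1, mul_one] at this

lemma SpansFlag.smul {W : Matrix (Fin n) (Fin n) ℝ} {F : OrientedFlag n} (h : SpansFlag W F)
    (g : SL n) : SpansFlag (g.1 * W) (g • F) := by
  obtain ⟨g', b, hb, rfl, rfl⟩ := h
  refine ⟨g * g', b, hb, ?_, (smul_mk g g').symm⟩
  rw [Matrix.SpecialLinearGroup.coe_mul, mul_assoc]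

lemma spansFlag_smul_iff {W : Matrix (Fin n) (Fin n) ℝ} {F : OrientedFlag n} (g : SL n) :
    SpansFlag (g.1 * W) (g • F) ↔ SpansFlag W F := by
  refine ⟨fun h => ?_, fun h => h.smul g⟩
  have := h.smul g⁻¹
  rwa [← mul_assoc, PrincipalBundle.coe_inv_mul, one_mul, inv_smul_smul] at this

/-- Positive triangular factors on the right do not move the flag, so the normalization of W is a
representative of the flag it spans. -/
lemma spansFlag_iff [NeZero n] {W : Matrix (Fin n) (Fin n) ℝ} (hW : 0 < W.det)
    {F : OrientedFlag n} : SpansFlag W F ↔ (slNormalize W : OrientedFlag n) = F := by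
  constructor
  · rintro ⟨g, b, hb, rfl, rfl⟩
    rw [slNormalize_mul _ hb.det_pos, eq_comm, QuotientGroup.eq, inv_mul_cancel_left]
    exact hb.slNormalize_mem
  · rintro rfl
    have hd := Real.rpow_pos_of_pos hW (-(n : ℝ)⁻¹)
    refine ⟨slNormalize W, (W.det ^ (-(n : ℝ)⁻¹))⁻¹ • 1, ⟨fun i j hij => ?_, fun i => ?_⟩, ?_, rfl⟩
    · rw [Matrix.smul_apply, Matrix.one_apply_ne hij.ne', smul_zero]
    · rw [Matrix.smul_apply, Matrix.one_apply_eq, smul_eq_mul, mul_one]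
      exact inv_pos.2 hd
    · rw [slNormalize_coe hW, mul_smul_comm, mul_one, smul_smul, inv_mul_cancel₀ hd.ne', one_smul]

lemma dotProduct_self_pos {v : Fin n → ℝ} (hv : v ≠ 0) : 0 < v ⬝ᵥ v :=
  lt_of_le_of_ne (Finset.sum_nonneg fun i _ => mul_self_nonneg (v i))
    fun h => hv (dotProduct_self_eq_zero.1 h.symm)

end Spans

namespace PrincipalBundle

variable {n : ℕ} {C : Type*} [TopologicalSpace C] [ChartedSpace ℝ C] {Q : Type*}
  [MulAction (SL n)ᵐᵒᵖ Q] {P : PrincipalBundle n C Q} {o : Orientation C} {c : ℝ → C}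
  {τ : Q → Sphere n} {T : Q → OrientedFlag n}

/-! ### Horizontal sections -/

/-- The matrix of θ in the section e g vanishes exactly when g' = - A g, which has local solutions
in SL(n). The chart at t₀ transports the solution to an open subset of the circle. -/
lemma Connection.exists_isHorizontal (hc : IsCoordinate o c) (θ : P.Connection)
    {e : P.LocalSection} (he : e.dom = Set.univ) (t₀ : ℝ) :
    ∃ s : P.LocalSection, θ.IsHorizontal s ∧ c t₀ ∈ s.dom := by
  have hA : SmoothMat (fun t => θ.matrix e c t) Set.univ := by
    have := θ.smoothMat_matrix hc e
    rwa [he, Set.preimage_univ] at this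
  obtain ⟨ε, hε, g, hg, hgA⟩ := exists_horizontal hA (fun t => θ.trace_matrix e t) t₀
  let φ := (hc.chart t₀).1
  have ht₀ : t₀ ∈ φ.target := hc.mem_chart_target t₀
  have hφ : ∀ t ∈ φ.target, φ.symm t = c t := hc.chart_symm t₀
  let J := Set.Ioo (t₀ - ε) (t₀ + ε)
  have hU : IsOpen (φ.source ∩ φ ⁻¹' J) := φ.isOpen_inter_preimage isOpen_Ioo
  have hsm : SmoothSLOn 𝓘(ℝ, ℝ) (fun x => g (φ x)) (φ.source ∩ φ ⁻¹' J) := fun i j =>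
    (hg i j).contMDiffOn.comp ((contMDiffOn_of_mem_maximalAtlas
      (o.smooth (hc.chart t₀).2)).mono Set.inter_subset_left) fun x hx => hx.2
  let s : P.LocalSection := e.mulRight (fun x => g (φ x)) (φ.source ∩ φ ⁻¹' J) hU
    (by rw [he]; exact Set.subset_univ _) hsm
  have hct : ∀ t ∈ φ.target, c t ∈ φ.source ∧ φ (c t) = t := fun t ht => by
    rw [← hφ t ht]
    exact ⟨φ.map_target ht, φ.right_inv ht⟩
  refine ⟨s, fun x hx => ?_, (hct t₀ ht₀).1, ?_⟩
  · have ht : φ x ∈ φ.target := φ.map_source hx.1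
    have hxc : c (φ x) = x := by rw [← hφ _ ht, φ.left_inv hx.1]
    have htJ : φ x ∈ J := hx.2
    rw [← hxc] at hx ⊢
    generalize φ x = t at ht htJ hx
    rw [θ.form_eq_zero_iff hc]
    have h1 := θ.matrix_transform' hc e s (by rw [he]; trivial) hx
    have h2 : ∀ t ∈ φ.target ∩ J, translation (n := n) (e.val (c t)) (s.val (c t)) = g t :=
      fun t ht => by
        refine (P.translation_smul _ _).trans ?_
        exact congrArg g (hct t ht.1).2
    have h3 : (fun t => (translation (n := n) (e.val (c t)) (s.val (c t))).1) =ᶠ[nhds t]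
        fun t => (g t).1 := Filter.eventuallyEq_of_mem
      ((φ.open_target.inter isOpen_Ioo).mem_nhds ⟨ht, htJ⟩) fun t ht => by rw [h2 t ht]
    rw [matDeriv_congr h3, h2 t ⟨ht, htJ⟩, hgA t htJ] at h1
    have h4 := congrArg (fun M => (g t)⁻¹.1 * M) h1
    simp only [← mul_assoc] at h4
    rw [coe_inv_mul, one_mul, mul_zero] at h4
    exact h4.symm
  · change φ (c t₀) ∈ J
    rw [(hct t₀ ht₀).2]
    exact ⟨by linarith, by linarith⟩

lemma smoothMat_translation_frame (hc : IsCoordinate o c) {e : P.LocalSection} (he : e.dom = Set.univ)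
    (s : P.LocalSection) :
    SmoothMat (fun t => (translation (n := n) (e.val (c t)) (s.val (c t))).1) (c ⁻¹' s.dom) := by
  have := smoothMat_translation hc e s
  rwa [he, Set.univ_inter] at this

section Curve

variable [NeZero n] {e : P.LocalSection}

/-- A lift to `ℝⁿ` of the curve in the sphere along the section `s`. -/
def frameCurve (c : ℝ → C) (e s : P.LocalSection) (t : ℝ) : Fin n → ℝ :=
  (translation (n := n) (e.val (c t)) (s.val (c t)))⁻¹.1 *ᵥ Pi.single 0 1

/-- The matrix with columns `(A + d/dt)^k e₁`, for the matrix `A` of the connection. -/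
def Connection.krylov (θ : P.Connection) (e : P.LocalSection) (c : ℝ → C) (t : ℝ) :
    Matrix (Fin n) (Fin n) ℝ :=
  kryMat (fun t => θ.matrix e c t) (fun _ => Pi.single 0 1) t

lemma contDiffOn_frameCurve (hc : IsCoordinate o c) (he : e.dom = Set.univ)
    (s : P.LocalSection) : ContDiffOn ℝ ∞ (frameCurve c e s) (c ⁻¹' s.dom) := by
  have h1 : SmoothSLOn 𝓘(ℝ, ℝ) (fun x => (translation (n := n) (e.val x) (s.val x))⁻¹) s.dom :=
    ((e.smooth_translation s).mono' fun x hx => ⟨by rw [he]; trivial, hx⟩).inv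
  exact SmoothMat.mulVec ((hc.smoothSLOn_iff s.isSmooth.isOpen).1 h1) contDiffOn_const

lemma represents_frameCurve (hτ : P.IsSphereMap τ) (he : e.dom = Set.univ)
    (heτ : ∀ x, Represents (Pi.single 0 1) (τ (e.val x))) (s : P.LocalSection) {t : ℝ}
    (ht : c t ∈ s.dom) : Represents (frameCurve c e s t) (τ (s.val (c t))) := by
  have h := hτ.represents_smul (heτ (c t)) (translation (n := n) (e.val (c t)) (s.val (c t)))
  rwa [← e.smul_translation s (by rw [he]; trivial) ht] at h

/-- In a horizontal section the connection matrix is 0 and covariant derivatives are ordinary ones.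
The vector e₁ in the frame e is `frameCurve` in the frame s, so the translation intertwines the two
sequences of derivatives. -/
lemma Connection.kry_frame (hc : IsCoordinate o c) {θ : P.Connection} (he : e.dom = Set.univ)
    {s : P.LocalSection} (hs : θ.IsHorizontal s) (k : ℕ) {t : ℝ} (ht : c t ∈ s.dom) :
    kry (fun t => θ.matrix e c t) (fun _ => Pi.single 0 1) k t =
      (translation (n := n) (e.val (c t)) (s.val (c t))).1 *ᵥ
        fun i => iteratedDeriv k (fun t => frameCurve c e s t i) t := by
  have hO := isOpen_preimage_dom hc s
  have hg := smoothMat_translation_frame hc he s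
  have hv := contDiffOn_frameCurve hc he s
  have heq : ∀ t ∈ c ⁻¹' s.dom, (fun t => θ.matrix e c t) t *
      (fun t => (translation (n := n) (e.val (c t)) (s.val (c t))).1) t +
      matDeriv (fun t => (translation (n := n) (e.val (c t)) (s.val (c t))).1) t =
      (fun t => (translation (n := n) (e.val (c t)) (s.val (c t))).1) t *
        (fun _ => (0 : Matrix (Fin n) (Fin n) ℝ)) t := by
    intro t ht
    have h := θ.matrix_transform' hc e s (by rw [he]; trivial) ht
    rwa [(θ.form_eq_zero_iff hc s t).1 (hs _ ht)] at h
  have h1 := kry_intertwine hO (SmoothMat.const 0 _) hg hv heq k t ht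
  have h2 : ∀ t ∈ c ⁻¹' s.dom, (Pi.single 0 1 : Fin n → ℝ) =
      (translation (n := n) (e.val (c t)) (s.val (c t))).1 *ᵥ frameCurve c e s t := fun t _ => by
    rw [frameCurve, Matrix.mulVec_mulVec, coe_mul_inv, Matrix.one_mulVec]
  refine (kry_congr hO (fun _ _ => rfl) h2 k t ht).trans (h1.trans ?_)
  congr 1
  ext i
  exact kry_zero_apply hO hv k t ht i

lemma Connection.iteratedDeriv_frameCurve (hc : IsCoordinate o c) {θ : P.Connection}
    (he : e.dom = Set.univ) {s : P.LocalSection} (hs : θ.IsHorizontal s) (k : ℕ) {t : ℝ}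
    (ht : c t ∈ s.dom) :
    (fun i => iteratedDeriv k (fun t => frameCurve c e s t i) t) =
      (translation (n := n) (e.val (c t)) (s.val (c t)))⁻¹.1 *ᵥ
        kry (fun t => θ.matrix e c t) (fun _ => Pi.single 0 1) k t := by
  rw [θ.kry_frame hc he hs k ht, Matrix.mulVec_mulVec, coe_inv_mul, Matrix.one_mulVec]

lemma Connection.jet_frameCurve (hc : IsCoordinate o c) {θ : P.Connection}
    (he : e.dom = Set.univ) {s : P.LocalSection} (hs : θ.IsHorizontal s) {t : ℝ}
    (ht : c t ∈ s.dom) :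
    jet (frameCurve c e s) t =
      (translation (n := n) (e.val (c t)) (s.val (c t)))⁻¹.1 * θ.krylov e c t := by
  ext i k
  exact congrFun (θ.iteratedDeriv_frameCurve hc he hs k.1 ht) i

/-- Any lift of the curve along `s`, in any oriented chart, is locally a positive multiple of
`frameCurve`. -/
lemma exists_eq_smul_frameCurve (hc : IsCoordinate o c) (hτ : P.IsSphereMap τ)
    (he : e.dom = Set.univ) (heτ : ∀ x, Represents (Pi.single 0 1) (τ (e.val x)))
    (s : P.LocalSection) (φ : o.charts) {w : ℝ → Fin n → ℝ}
    (hw : IsLiftOn 𝓘(ℝ, ℝ) (fun t => τ (s.val (φ.1.symm t))) w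
      (φ.1.target ∩ φ.1.symm ⁻¹' s.dom)) {t₀ T₀ : ℝ}
    (ht₀ : t₀ ∈ φ.1.target ∩ φ.1.symm ⁻¹' s.dom) (hT₀ : c T₀ = φ.1.symm t₀) :
    ∃ V f, ∃ mu : ℝ → ℝ, IsCoordLift c φ.1 V f ∧ V ⊆ φ.1.symm ⁻¹' s.dom ∧ t₀ ∈ V ∧ f t₀ = T₀ ∧
      ContDiffOn ℝ ∞ mu V ∧ (∀ t ∈ V, 0 < mu t) ∧
      ∀ t ∈ V, w t = mu t • frameCurve c e s (f t) := by
  obtain ⟨V, f, hf, htV, hfT, -⟩ := hc.exists_lift (o.smooth φ.2) ht₀.1 hT₀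
  have hS : IsOpen (φ.1.target ∩ φ.1.symm ⁻¹' s.dom) :=
    φ.1.isOpen_inter_preimage_symm s.isSmooth.isOpen
  let V' := V ∩ (φ.1.target ∩ φ.1.symm ⁻¹' s.dom)
  have hf' : IsCoordLift c φ.1 V' f :=
    ⟨hf.isOpen.inter hS, fun t ht => ht.2.1, hf.smooth.mono Set.inter_subset_left,
      fun t ht => hf.comm t ht.1⟩
  have hmem : ∀ t ∈ V', c (f t) ∈ s.dom := fun t ht => by
    rw [hf.comm t ht.1]
    exact ht.2.2
  have hrep : ∀ t ∈ V', Represents (frameCurve c e s (f t)) (τ (s.val (φ.1.symm t))) :=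
    fun t ht => by
      rw [← hf.comm t ht.1]
      exact represents_frameCurve hτ he heτ s (hmem t ht)
  have hsm : ContDiffOn ℝ ∞ (fun t => frameCurve c e s (f t)) V' :=
    (contDiffOn_frameCurve hc he s).comp hf'.smooth hmem
  have hw' : ∀ i, ContDiffOn ℝ ∞ (fun t => w t i) V' := fun i =>
    (contMDiffOn_iff_contDiffOn.1 (hw.1 i)).mono Set.inter_subset_right
  have hdot : ∀ t ∈ V', 0 < frameCurve c e s (f t) ⬝ᵥ frameCurve c e s (f t) := fun t ht =>
    dotProduct_self_pos (hrep t ht).1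
  -- The proportionality factor is a quotient of dot products, which exhibits it as a smooth
  -- function.
  have key : ∀ t ∈ V', ∃ k : ℝ, 0 < k ∧ w t = k • frameCurve c e s (f t) ∧
      (w t ⬝ᵥ frameCurve c e s (f t)) / (frameCurve c e s (f t) ⬝ᵥ frameCurve c e s (f t)) = k := by
    intro t ht
    obtain ⟨k, hk, hk'⟩ := (hrep t ht).exists_pos_smul (hw.2 t ht.2)
    refine ⟨k, hk, hk', ?_⟩
    rw [hk', smul_dotProduct, smul_eq_mul, mul_div_cancel_right₀ _ (hdot t ht).ne']
  refine ⟨V', f, fun t => (w t ⬝ᵥ frameCurve c e s (f t)) /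
    (frameCurve c e s (f t) ⬝ᵥ frameCurve c e s (f t)), hf', fun t ht => ht.2.2, ⟨htV, ht₀⟩, hfT,
    ContDiffOn.div ?_ ?_ fun t ht => (hdot t ht).ne', fun t ht => ?_, fun t ht => ?_⟩
  · exact ContDiffOn.sum fun i _ => (hw' i).mul (contDiffOn_pi.1 hsm i)
  · exact ContDiffOn.sum fun i _ => (contDiffOn_pi.1 hsm i).mul (contDiffOn_pi.1 hsm i)
  · obtain ⟨k, hk, -, h⟩ := key t ht
    exact hk.trans_eq h.symm
  · obtain ⟨k, hk, h1, h⟩ := key t ht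
    exact h1.trans (congrArg (· • frameCurve c e s (f t)) h.symm)

/-- Two corrections to the jet of `frameCurve` are absorbed in b: the rescaling to another lift v
and the change from the coordinate c to the chart φ. -/
lemma Connection.exists_jet_eq (hc : IsCoordinate o c) (hτ : P.IsSphereMap τ)
    {θ : P.Connection} (he : e.dom = Set.univ)
    (heτ : ∀ x, Represents (Pi.single 0 1) (τ (e.val x)))
    {s : P.LocalSection} (hs : θ.IsHorizontal s) {v : C → Fin n → ℝ}
    (hv : IsLiftOn 𝓘(ℝ, ℝ) (fun x => τ (s.val x)) v s.dom) {φ : OpenPartialHomeomorph C ℝ}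
    (hφ : φ ∈ o.charts) {T₀ : ℝ} (hx : c T₀ ∈ s.dom ∩ φ.source) :
    ∃ b, IsPosUpper b ∧ jet (fun t => v (φ.symm t)) (φ (c T₀)) =
      (translation (n := n) (e.val (c T₀)) (s.val (c T₀)))⁻¹.1 * (θ.krylov e c T₀ * b) := by
  have hsm := contMDiffOn_symm_of_mem_maximalAtlas (o.smooth hφ)
  have hw : IsLiftOn 𝓘(ℝ, ℝ) (fun t => τ (s.val (φ.symm t))) (fun t => v (φ.symm t))
      (φ.target ∩ φ.symm ⁻¹' s.dom) :=
    ⟨fun i => (hv.1 i).comp (hsm.mono Set.inter_subset_left) fun t ht => ht.2,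
      fun t ht => hv.2 _ ht.2⟩
  have hli : φ.symm (φ (c T₀)) = c T₀ := φ.left_inv hx.2
  obtain ⟨V, f, mu, hf, hVs, htV, hfT, hmu, hpos, heq⟩ := exists_eq_smul_frameCurve hc hτ he heτ s
    ⟨φ, hφ⟩ hw (t₀ := φ (c T₀)) (T₀ := T₀)
    ⟨φ.map_source hx.2, by rw [Set.mem_preimage, hli]; exact hx.1⟩ hli.symm
  have hfs : ∀ t ∈ V, f t ∈ c ⁻¹' s.dom := fun t ht => by
    rw [Set.mem_preimage, hf.comm t ht]
    exact hVs ht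
  have hd : 0 < deriv f (φ (c T₀)) := IsCoordLift.deriv_pos (φ := ⟨φ, hφ⟩) hc hf htV
  refine ⟨chgMat n mu f (φ (c T₀)), chgMat_isPosUpper (hpos _ htV) hd, ?_⟩
  rw [jet_congr (Filter.eventuallyEq_of_mem (hf.isOpen.mem_nhds htV) heq),
    jet_change hf.isOpen (isOpen_preimage_dom hc s) hfs (contDiffOn_frameCurve hc he s) hmu
      hf.smooth htV, hfT, θ.jet_frameCurve hc he hs hx.1, mul_assoc]

/-- The jet along a horizontal section and the Krylov matrix differ by factors of positive
determinant, so positivity of one is positivity of the other;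
`Connection.isNondegenerate_of_det_krylov_pos` is the converse. -/
lemma Connection.det_krylov_pos (hc : IsCoordinate o c) (hτ : P.IsSphereMap τ)
    {θ : P.Connection} (he : e.dom = Set.univ)
    (heτ : ∀ x, Represents (Pi.single 0 1) (τ (e.val x))) (hθ : θ.IsNondegenerate o τ) (t : ℝ) :
    0 < (θ.krylov e c t).det := by
  obtain ⟨s, hs, ht⟩ := θ.exists_isHorizontal hc he t
  obtain ⟨v, hv, hpos⟩ := hθ s hs
  have hx : c t ∈ s.dom ∩ (hc.chart t).1.source := ⟨ht, hc.symm_mem_chart_source rfl⟩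
  have h := hpos _ (hc.chart t).2 _ hx
  obtain ⟨b, hb, h2⟩ := θ.exists_jet_eq hc hτ he heτ hs hv (hc.chart t).2 hx
  rw [h2, Matrix.det_mul, Matrix.det_mul, Matrix.SpecialLinearGroup.det_coe, one_mul] at h
  exact pos_of_mul_pos_left h hb.det_pos.le

lemma Connection.isNondegenerate_of_det_krylov_pos (hc : IsCoordinate o c) (hτ : P.IsSphereMap τ)
    {θ : P.Connection} (he : e.dom = Set.univ)
    (heτ : ∀ x, Represents (Pi.single 0 1) (τ (e.val x)))
    (h : ∀ t, 0 < (θ.krylov e c t).det) : θ.IsNondegenerate o τ := by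
  intro s hs
  obtain ⟨v, hv⟩ := hτ.smooth s
  refine ⟨v, hv, fun φ hφ x hx => ?_⟩
  obtain ⟨t, rfl⟩ := hc.surjective x
  obtain ⟨b, hb, h2⟩ := θ.exists_jet_eq hc hτ he heτ hs hv hφ hx
  rw [h2, Matrix.det_mul, Matrix.det_mul, Matrix.SpecialLinearGroup.det_coe, one_mul]
  exact mul_pos (h t) hb.det_pos

/-- The triangular factor leaves the flag alone, and by equivariance of T the factor in SL(n)
relates the flags at s and e. Derived lifts can therefore be tested in the frame e. -/
lemma Connection.spansFlag_jet_iff (hc : IsCoordinate o c) (hτ : P.IsSphereMap τ)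
    {θ : P.Connection} (he : e.dom = Set.univ)
    (heτ : ∀ x, Represents (Pi.single 0 1) (τ (e.val x))) (hT : P.IsFlagLift τ T)
    {s : P.LocalSection} (hs : θ.IsHorizontal s) {v : C → Fin n → ℝ}
    (hv : IsLiftOn 𝓘(ℝ, ℝ) (fun x => τ (s.val x)) v s.dom) {φ : OpenPartialHomeomorph C ℝ}
    (hφ : φ ∈ o.charts) {t : ℝ} (hx : c t ∈ s.dom ∩ φ.source) :
    SpansFlag (jet (fun t => v (φ.symm t)) (φ (c t))) (T (s.val (c t))) ↔
      SpansFlag (θ.krylov e c t) (T (e.val (c t))) := by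
  obtain ⟨b, hb, h2⟩ := θ.exists_jet_eq hc hτ he heτ hs hv hφ hx
  rw [h2, e.smul_translation s (by rw [he]; trivial) hx.1, hT.equivariant, P.translation_smul,
    spansFlag_smul_iff, spansFlag_mul_iff hb]

lemma Connection.IsDerivedLift.spansFlag (hc : IsCoordinate o c) (hτ : P.IsSphereMap τ)
    {θ : P.Connection} (he : e.dom = Set.univ)
    (heτ : ∀ x, Represents (Pi.single 0 1) (τ (e.val x))) (hT : P.IsFlagLift τ T)
    (h : θ.IsDerivedLift o τ T) (t : ℝ) : SpansFlag (θ.krylov e c t) (T (e.val (c t))) := by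
  obtain ⟨s, hs, ht⟩ := θ.exists_isHorizontal hc he t
  obtain ⟨v, hv⟩ := hτ.smooth s
  have hx : c t ∈ s.dom ∩ (hc.chart t).1.source := ⟨ht, hc.symm_mem_chart_source rfl⟩
  exact (θ.spansFlag_jet_iff hc hτ he heτ hT hs hv (hc.chart t).2 hx).1
    (h s hs v hv _ (hc.chart t).2 _ hx)

lemma Connection.isDerivedLift_of_spansFlag (hc : IsCoordinate o c) (hτ : P.IsSphereMap τ)
    {θ : P.Connection} (he : e.dom = Set.univ)
    (heτ : ∀ x, Represents (Pi.single 0 1) (τ (e.val x))) (hT : P.IsFlagLift τ T)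
    (h : ∀ t, SpansFlag (θ.krylov e c t) (T (e.val (c t)))) : θ.IsDerivedLift o τ T := by
  intro s hs v hv φ hφ x hx
  obtain ⟨t, rfl⟩ := hc.surjective x
  exact (θ.spansFlag_jet_iff hc hτ he heτ hT hs hv hφ hx).2 (h t)

end Curve

end PrincipalBundle

/-! ## Wronskians and companion matrices -/

lemma wronskian_congr {m : ℕ} {v w : ℝ → Fin m → ℝ} {t : ℝ} (h : v =ᶠ[nhds t] w) :
    wronskian v t = wronskian w t :=
  congrArg Matrix.det (jet_congr h)

/-- The Wronskian of `U` and a system of solutions `v` of the equation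
`v⁽ⁿ⁾ + ∑ aⱼ v⁽ʲ⁾ = 0`. -/
lemma wronskian_cons {n : ℕ} {v : ℝ → Fin n → ℝ} {U : ℝ → ℝ} {t : ℝ} {a : ℕ → ℝ}
    (h : ∀ i, iteratedDeriv n (fun s => v s i) t =
      -∑ j ∈ Finset.range n, a j * iteratedDeriv j (fun s => v s i) t) :
    wronskian (fun s => (Fin.cons (U s) (v s) : Fin (n + 1) → ℝ)) t =
      (-1) ^ n * (iteratedDeriv n U t + ∑ j ∈ Finset.range n, a j * iteratedDeriv j U t) *
        wronskian v t := by
  set M := jet (fun s => (Fin.cons (U s) (v s) : Fin (n + 1) → ℝ)) t with hM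
  -- Multiplication by N on the right adds a j times column j to the last column, for j < n. The
  -- equation for v then leaves only the first entry of that column.
  let N : Matrix (Fin (n + 1)) (Fin (n + 1)) ℝ := Matrix.of fun j k =>
    if j = k then 1 else if k = Fin.last n then a j.1 else 0
  have hN : N.det = 1 := by
    have htri : N.IsUpperTriangular := fun i j (hij : j < i) => by
      have h1 : j ≠ Fin.last n := (lt_of_lt_of_le hij (Fin.le_last i)).ne
      simp [N, hij.ne', h1]
    rw [Matrix.det_of_isUpperTriangular htri]
    simp [N]
  have hMN1 : ∀ i (k : Fin n), (M * N) i k.castSucc = M i k.castSucc := fun i k => by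
    have h1 : k.castSucc ≠ Fin.last n := (Fin.castSucc_lt_last k).ne
    simp [Matrix.mul_apply, N, h1]
  have hMN2 : ∀ i, (M * N) i (Fin.last n) =
      M i (Fin.last n) + ∑ j ∈ Finset.range n,
        a j * iteratedDeriv j (fun s => (Fin.cons (U s) (v s) : Fin (n + 1) → ℝ) i) t := fun i => by
    rw [Matrix.mul_apply, Fin.sum_univ_castSucc, add_comm, ← Fin.sum_univ_eq_sum_range (fun j =>
      a j * iteratedDeriv j (fun s => (Fin.cons (U s) (v s) : Fin (n + 1) → ℝ) i) t)]
    congr 1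
    · simp [N]
    · refine Finset.sum_congr rfl fun j _ => ?_
      have h1 : j.castSucc ≠ Fin.last n := (Fin.castSucc_lt_last j).ne
      simp only [N, Matrix.of_apply, if_neg h1, if_true, Fin.val_castSucc]
      rw [mul_comm, hM]
      rfl
  have h0 : (M * N) 0 (Fin.last n) =
      iteratedDeriv n U t + ∑ j ∈ Finset.range n, a j * iteratedDeriv j U t := by
    rw [hMN2]
    rfl
  have hs : ∀ i : Fin n, (M * N) i.succ (Fin.last n) = 0 := fun i => by
    rw [hMN2]
    change iteratedDeriv n (fun s => v s i) t +
      ∑ j ∈ Finset.range n, a j * iteratedDeriv j (fun s => v s i) t = 0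
    rw [h, neg_add_cancel]
  have hdet : M.det = (M * N).det := by rw [Matrix.det_mul, hN, mul_one]
  have hsub : (M * N).submatrix (Fin.succAbove 0) (Fin.last n).succAbove = jet v t := by
    ext i k
    rw [Matrix.submatrix_apply, Fin.succAbove_last, hMN1]
    rfl
  change M.det = _
  -- The single surviving entry of the last column sits in row 0, which produces the sign (-1)^n.
  rw [hdet, Matrix.det_succ_column _ (Fin.last n), Fin.sum_univ_succ,
    Finset.sum_eq_zero fun i _ => by rw [hs, mul_zero, zero_mul], add_zero, h0, hsub]
  simp [wronskian]

section Companion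

variable {n : ℕ}

lemma IsAGDCoeff.smoothMat_companion {a : ℕ → ℝ → ℝ} (ha : IsAGDCoeff n a) :
    SmoothMat (fun t => companion n fun i => a i t) Set.univ := by
  intro i j
  simp only [companion, Matrix.of_apply]
  split_ifs
  · exact contDiffOn_const
  · exact (ha.smooth i.1).neg.contDiffOn
  · exact contDiffOn_const

lemma trace_companion (a : ℕ → ℝ) : (companion n a).trace = 0 := by
  refine Finset.sum_eq_zero fun i _ => ?_
  simp only [companion, Matrix.diag_apply, Matrix.of_apply]
  rw [if_neg (by omega), if_neg (by omega)]

/-- The vector e_k is constant, and the companion matrix shifts it to e_{k+1} as long as this index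
stays below n. -/
lemma kry_companion [NeZero n] {A : ℝ → Matrix (Fin n) (Fin n) ℝ} {a : ℕ → ℝ → ℝ}
    (hA : ∀ t, A t = companion n fun i => a i t) (k : ℕ) (hk : k < n) :
    kry A (fun _ => Pi.single 0 1) k = fun _ => Pi.single ⟨k, hk⟩ 1 := by
  induction k with
  | zero => rfl
  | succ k ih =>
    funext t
    rw [kry, ih (by omega)]
    beta_reduce
    rw [deriv_const, add_zero, hA, Matrix.mulVec_single_one]
    ext i
    have h1 : ¬(k + 1 = n ∧ i.1 + 1 < n) := by omega
    simp [companion, Matrix.col_apply, h1, Pi.single_apply, Fin.ext_iff]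

lemma kryMat_companion [NeZero n] {A : ℝ → Matrix (Fin n) (Fin n) ℝ} {a : ℕ → ℝ → ℝ}
    (hA : ∀ t, A t = companion n fun i => a i t) (t : ℝ) :
    kryMat A (fun _ => Pi.single 0 1) t = 1 := by
  ext i k
  rw [kryMat, Matrix.of_apply, kry_companion hA k.1 k.2, Matrix.one_apply]
  beta_reduce
  rw [Pi.single_apply]

/-- One more step applies the matrix to the last basis vector and yields its last column. The term
with a (n - 1) may be included because that coefficient is zero. -/
lemma kry_companion_self [NeZero n] {A : ℝ → Matrix (Fin n) (Fin n) ℝ} {a : ℕ → ℝ → ℝ}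
    (hA : ∀ t, A t = companion n fun i => a i t) (ha : ∀ t, a (n - 1) t = 0) (t : ℝ) :
    kry A (fun _ => Pi.single 0 1) n t = -∑ j : Fin n, a j.1 t • Pi.single j 1 := by
  have hn := NeZero.pos n
  obtain ⟨m, rfl⟩ : ∃ m, n = m + 1 := ⟨n - 1, by omega⟩
  rw [kry, kry_companion hA m (by omega)]
  beta_reduce
  rw [deriv_const, add_zero, hA, Matrix.mulVec_single_one]
  ext i
  have h1 : i.1 ≠ m + 1 := i.2.ne
  have h2 : (∑ j : Fin (m + 1), a j.1 t • (Pi.single j 1 : Fin (m + 1) → ℝ)) i = a i.1 t := by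
    simp [Finset.sum_apply, Pi.single_apply]
  rw [Pi.neg_apply, h2]
  by_cases h : i.1 < m
  · simp [companion, Matrix.col_apply, h1, h]
  · have h3 : i.1 = m := by omega
    have h4 := ha t
    rw [Nat.add_sub_cancel] at h4
    simp [companion, Matrix.col_apply, h3, h4]

end Companion

/-! ### The operator of a connection -/

namespace PrincipalBundle

variable {n : ℕ} {C : Type*} [TopologicalSpace C] [ChartedSpace ℝ C] {Q : Type*}
  [MulAction (SL n)ᵐᵒᵖ Q] {P : PrincipalBundle n C Q} {o : Orientation C} {c : ℝ → C}
  {τ : Q → Sphere n} {T : Q → OrientedFlag n}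

lemma Connection.smoothMat_matrix_frame {e : P.LocalSection} (hc : IsCoordinate o c) (he : e.dom = Set.univ)
    (θ : P.Connection) : SmoothMat (fun t => θ.matrix e c t) Set.univ := by
  have h := θ.smoothMat_matrix hc e
  rwa [he, Set.preimage_univ] at h

section Operators

variable [NeZero n] {e : P.LocalSection}

/-- The operator of a connection with companion matrix. -/
lemma Connection.isOperator_of_companion (hc : IsCoordinate o c) (hτ : P.IsSphereMap τ)
    {θ : P.Connection} (he : e.dom = Set.univ)
    (heτ : ∀ x, Represents (Pi.single 0 1) (τ (e.val x))) {a : ℕ → ℝ → ℝ}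
    (ha : IsAGDCoeff n a) (hθ : ∀ t, θ.matrix e c t = companion n fun i => a i t) {L : AGD n o}
    (hL : HasCoefficients L.1 n c a) : θ.IsOperator τ L := by
  intro s hs φ w hw hk u t₀ ht₀
  obtain ⟨k, hk0, hk⟩ := hk
  obtain ⟨T₀, hT₀⟩ := hc.surjective (φ.1.symm t₀)
  obtain ⟨V, f, mu, hf, hVs, htV, hfT, hmu, hmupos, hweq⟩ :=
    exists_eq_smul_frameCurve hc hτ he heτ s φ hw ht₀ hT₀
  set v := frameCurve c e s with hv
  have hfs : ∀ t ∈ V, f t ∈ c ⁻¹' s.dom := fun t ht => by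
    rw [Set.mem_preimage, hf.comm t ht]
    exact hVs ht
  have hO := isOpen_preimage_dom hc s
  have hvsm : ContDiffOn ℝ ∞ v (c ⁻¹' s.dom) := contDiffOn_frameCurve hc he s
  have hfpos : ∀ t ∈ V, 0 < deriv f t := fun t ht => hf.deriv_pos hc ht
  have hWv : ∀ t ∈ c ⁻¹' s.dom, wronskian v t = 1 := fun t ht => by
    rw [wronskian, θ.jet_frameCurve hc he hs ht, Connection.krylov, kryMat_companion hθ, mul_one,
      Matrix.SpecialLinearGroup.det_coe]
  -- This is the factor carrying (1-n)/2-densities from the coordinate c to the chart φ; for this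
  -- weight the Wronskian of n densities is unchanged.
  let lam : ℝ → ℝ := fun t => deriv f t ^ ((1 - (n : ℝ)) / 2)
  have hlam : ContDiffOn ℝ ∞ lam V := fun t ht =>
    (((contDiffOn_deriv hf.isOpen hf.smooth).contDiffAt
      (hf.isOpen.mem_nhds ht)).rpow_const_of_ne (hfpos t ht).ne').contDiffWithinAt
  have hlpos : ∀ t ∈ V, 0 < lam t := fun t ht => Real.rpow_pos_of_pos (hfpos t ht) _
  have hprodn : ∀ t ∈ V, ∏ k ∈ Finset.range n, (lam t * deriv f t ^ k) = 1 := fun t ht => by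
    refine (prod_density_factor (hfpos t ht)).trans ?_
    rw [sub_self, mul_zero, zero_div, Real.rpow_zero]
  -- Since v has Wronskian 1, a constant Wronskian of w forces mu / lam to have constant n-th power.
  -- Being positive, the ratio is itself a constant κ.
  have hkap : ∀ t ∈ V, (mu t / lam t) ^ n = k := fun t ht => by
    have h1 := hk t ⟨hf.subset ht, hVs ht⟩
    rw [wronskian_congr (Filter.eventuallyEq_of_mem (hf.isOpen.mem_nhds ht) hweq),
      wronskian_change hf.isOpen hO hfs hvsm hmu hf.smooth ht, hWv _ (hfs t ht), one_mul] at h1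
    rw [← h1, ← mul_one ((mu t / lam t) ^ n), ← hprodn t ht, ← Finset.card_range n,
      ← Finset.prod_const, Finset.card_range, ← Finset.prod_mul_distrib]
    refine Finset.prod_congr rfl fun j _ => ?_
    rw [← mul_assoc, div_mul_cancel₀ _ (hlpos t ht).ne']
  set κ := mu t₀ / lam t₀ with hκ
  have hκpos : 0 < κ := div_pos (hmupos t₀ htV) (hlpos t₀ htV)
  have hmueq : ∀ t ∈ V, mu t = lam t * κ := fun t ht => by
    have h1 : mu t / lam t = κ := (pow_left_inj₀ (div_pos (hmupos t ht) (hlpos t ht)).le hκpos.le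
      (NeZero.ne n)).1 ((hkap t ht).trans (hkap t₀ htV).symm)
    rw [← h1, mul_div_cancel₀ _ (hlpos t ht).ne']
  let v₁ : ℝ → Fin n → ℝ := fun t => κ • v t
  have hv₁ : ContDiffOn ℝ ∞ v₁ (c ⁻¹' s.dom) :=
    (contDiffOn_const (c := κ)).smul hvsm
  have hwv₁ : ∀ t ∈ V, w t = lam t • v₁ (f t) := fun t ht => by
    rw [hweq t ht, hmueq t ht, mul_smul]
  -- The lift w is now a tuple of densities of the same weight as u, so all n + 1 entries rescale by
  -- the same factor.
  have hcons : ∀ t ∈ V, (Fin.cons (u.1 φ t) (w t) : Fin (n + 1) → ℝ) =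
      lam t • (Fin.cons (hc.dens u (f t)) (v₁ (f t)) : Fin (n + 1) → ℝ) := fun t ht => by
    rw [hwv₁ t ht, hc.density_eq u hf ht]
    ext i
    refine Fin.cases ?_ (fun i => ?_) i
    · simp [lam, mul_comm]
    · simp
  have hconsm : ContDiffOn ℝ ∞
      (fun T => (Fin.cons (hc.dens u T) (v₁ T) : Fin (n + 1) → ℝ)) (c ⁻¹' s.dom) := by
    rw [contDiffOn_pi]
    refine Fin.cases ?_ fun i => ?_
    · simpa using (hc.contDiff_dens u).contDiffOn
    · simpa using contDiffOn_pi.1 hv₁ i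
  have hT₀s : c T₀ ∈ s.dom := by rw [← hfT]; exact hfs t₀ htV
  -- The expression of the n-th Krylov vector through the earlier ones, read in the horizontal
  -- section, is the scalar equation L v = 0 for each component.
  have hode : ∀ i, iteratedDeriv n (fun s => v₁ s i) T₀ =
      -∑ j ∈ Finset.range n, a j T₀ * iteratedDeriv j (fun s => v₁ s i) T₀ := by
    have h1 : ∀ j i, iteratedDeriv j (fun s => v₁ s i) T₀ =
        κ * iteratedDeriv j (fun s => v s i) T₀ := fun j i =>
      iteratedDeriv_const_mul_field κ fun s => v s i
    have h2 : (fun i => iteratedDeriv n (fun s => v s i) T₀) =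
        -∑ j : Fin n, a j.1 T₀ • fun i => iteratedDeriv j.1 (fun s => v s i) T₀ := by
      rw [hv, θ.iteratedDeriv_frameCurve hc he hs n hT₀s, kry_companion_self hθ ha.sub,
        Matrix.mulVec_neg, Matrix.mulVec_sum]
      congr 1
      refine Finset.sum_congr rfl fun j _ => ?_
      rw [Matrix.mulVec_smul, θ.iteratedDeriv_frameCurve hc he hs j.1 hT₀s,
        kry_companion hθ j.1 j.2]
    intro i
    have h3 := congrFun h2 i
    simp only [Pi.neg_apply, Finset.sum_apply, Pi.smul_apply, smul_eq_mul] at h3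
    rw [h1, h3, Fin.sum_univ_eq_sum_range
      (fun j => a j T₀ * iteratedDeriv j (fun s => v s i) T₀), mul_neg, Finset.mul_sum]
    congr 1
    refine Finset.sum_congr rfl fun j _ => ?_
    rw [h1]
    ring
  have hWv₁ : wronskian v₁ T₀ = κ ^ n := by
    have := wronskian_smul hO hvsm (lam := fun _ => κ) contDiffOn_const (t := T₀) hT₀s
    rwa [hWv T₀ hT₀s, mul_one] at this
  have hWw : wronskian w t₀ = wronskian v₁ T₀ := by
    rw [wronskian_congr (Filter.eventuallyEq_of_mem (hf.isOpen.mem_nhds htV) hwv₁),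
      wronskian_change hf.isOpen hO hfs hv₁ hlam hf.smooth htV, hprodn t₀ htV, mul_one, hfT]
  -- With n + 1 entries the factor has exponent (n + 1)/2, as required of a density in the target.
  have hWcons : wronskian (fun t' => (Fin.cons (u.1 φ t') (w t') : Fin (n + 1) → ℝ)) t₀ =
      wronskian (fun T => (Fin.cons (hc.dens u T) (v₁ T) : Fin (n + 1) → ℝ)) T₀ *
        deriv f t₀ ^ ((1 + (n : ℝ)) / 2) := by
    rw [wronskian_congr (Filter.eventuallyEq_of_mem (hf.isOpen.mem_nhds htV) hcons),
      wronskian_change hf.isOpen hO hfs hconsm hlam hf.smooth htV, hfT]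
    congr 1
    refine (prod_density_factor (hfpos t₀ htV)).trans ?_
    congr 1
    push_cast
    ring
  rw [hc.density_eq (L.1 u) hf htV, hfT, hc.hasCoefficients_iff.1 hL, hWcons, hWw,
    wronskian_cons hode, Finset.sum_range_succ, ha.top, one_mul, add_comm]
  have hne : wronskian v₁ T₀ ≠ 0 := by
    rw [hWv₁]
    positivity
  -- The sign in the definition of the operator cancels the one from the Laplace expansion.
  have hsq : ((-1 : ℝ) ^ n) * (-1) ^ n = 1 := by
    rw [← mul_pow, neg_one_mul, neg_neg, one_pow]
  rw [eq_div_iff hne]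
  linear_combination (-(iteratedDeriv n (hc.dens u) T₀ +
    ∑ j ∈ Finset.range n, a j T₀ * iteratedDeriv j (hc.dens u) T₀) * wronskian v₁ T₀ *
      deriv f t₀ ^ ((1 + (n : ℝ)) / 2)) * hsq

lemma Connection.smoothMat_krylov (hc : IsCoordinate o c) (he : e.dom = Set.univ)
    (θ : P.Connection) : SmoothMat (fun t => θ.krylov e c t) Set.univ :=
  smoothMat_kryMat isOpen_univ (θ.smoothMat_matrix_frame hc he) contDiffOn_const

lemma Connection.contDiff_det_krylov_rpow (hc : IsCoordinate o c) (he : e.dom = Set.univ)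
    {θ : P.Connection} (hpos : ∀ t, 0 < (θ.krylov e c t).det) (r : ℝ) :
    ContDiffOn ℝ ∞ (fun t => (θ.krylov e c t).det ^ r) Set.univ := fun t _ =>
  (((θ.smoothMat_krylov hc he).det.contDiffAt Filter.univ_mem).rpow_const_of_ne
    (hpos t).ne').contDiffWithinAt

lemma rpow_neg_inv_pow {x : ℝ} (hx : 0 < x) : (x ^ (-(n : ℝ)⁻¹)) ^ n * x = 1 := by
  have hn : (n : ℝ) ≠ 0 := Nat.cast_ne_zero.2 (NeZero.ne n)
  rw [← Real.rpow_natCast, ← Real.rpow_mul hx.le, neg_mul, inv_mul_cancel₀ hn, Real.rpow_neg_one,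
    inv_mul_cancel₀ hx.ne']

/-- The operator of a nondegenerate connection is unique. -/
lemma Connection.IsOperator.unique (hc : IsCoordinate o c) (hτ : P.IsSphereMap τ)
    {θ : P.Connection} (he : e.dom = Set.univ)
    (heτ : ∀ x, Represents (Pi.single 0 1) (τ (e.val x)))
    (hpos : ∀ t, 0 < (θ.krylov e c t).det) {L L' : AGD n o} (hL : θ.IsOperator τ L)
    (hL' : θ.IsOperator τ L') : L = L' := by
  refine Subtype.ext (LinearMap.ext fun u => hc.density_ext fun T => ?_)
  obtain ⟨s, hs, hT⟩ := θ.exists_isHorizontal hc he T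
  let φ := hc.chart T
  have hφ : ∀ t ∈ φ.1.target, φ.1.symm t = c t := hc.chart_symm T
  have hsub : φ.1.target ∩ φ.1.symm ⁻¹' s.dom ⊆ c ⁻¹' s.dom := fun t ht => by
    have := ht.2
    rwa [Set.mem_preimage, hφ t ht.1] at this
  have hO := isOpen_preimage_dom hc s
  have hv := contDiffOn_frameCurve hc he s
  -- This rescaling gives a lift of Wronskian 1. Its existence near every point is what makes the
  -- defining formula determine L.
  let w : ℝ → Fin n → ℝ := fun t => (θ.krylov e c t).det ^ (-(n : ℝ)⁻¹) • frameCurve c e s t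
  have hmu : ContDiffOn ℝ ∞ (fun t => (θ.krylov e c t).det ^ (-(n : ℝ)⁻¹)) (c ⁻¹' s.dom) :=
    (θ.contDiff_det_krylov_rpow hc he hpos _).mono (Set.subset_univ _)
  have hw : IsLiftOn 𝓘(ℝ, ℝ) (fun t => τ (s.val (φ.1.symm t))) w
      (φ.1.target ∩ φ.1.symm ⁻¹' s.dom) := by
    refine ⟨fun i => ContDiffOn.contMDiffOn ?_, fun t ht => ?_⟩
    · exact (contDiffOn_pi.1 (hmu.smul hv) i).mono hsub
    · beta_reduce
      rw [hφ t ht.1]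
      exact (represents_frameCurve hτ he heτ s (hsub ht)).smul
        (Real.rpow_pos_of_pos (hpos t) _)
  have hW : ∀ t ∈ φ.1.target ∩ φ.1.symm ⁻¹' s.dom, wronskian w t = 1 := fun t ht => by
    refine (wronskian_smul hO hv hmu (hsub ht)).trans ?_
    rw [wronskian, θ.jet_frameCurve hc he hs (hsub ht), Matrix.det_mul,
      Matrix.SpecialLinearGroup.det_coe, one_mul, rpow_neg_inv_pow (hpos t)]
  have hTmem : T ∈ φ.1.target ∩ φ.1.symm ⁻¹' s.dom :=
    ⟨hc.mem_chart_target T, by rw [Set.mem_preimage, hφ T (hc.mem_chart_target T)]; exact hT⟩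
  exact (hL s hs φ w hw ⟨1, one_pos, hW⟩ u T hTmem).trans
    (hL' s hs φ w hw ⟨1, one_pos, hW⟩ u T hTmem).symm

end Operators

/-- A section s is horizontal for u • θ when u⁻¹ ∘ s is horizontal for θ, and τ takes the same
values along both, so the same curves enter the formula. -/
lemma Connection.IsOperator.smul {θ : P.Connection} {L : AGD n o} (h : θ.IsOperator τ L)
    {u : P.gauge} (hu : u ∈ P.gaugeFixing τ) : (u • θ).IsOperator τ L := by
  intro s hs φ w hw hk
  have h1 : ∀ q, τ (u⁻¹.1 q) = τ q := hu
  refine h (s.map u⁻¹) hs φ w ?_ hk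
  change IsLiftOn 𝓘(ℝ, ℝ) (fun t => τ (u⁻¹.1 (s.val (φ.1.symm t)))) w _
  simp only [h1]
  exact hw

end PrincipalBundle

/-! ### The action on the ray of the first basis vector -/

section FirstColumn

variable {n : ℕ} [NeZero n]

lemma IsPosUpper.mulVec_single {b : Matrix (Fin n) (Fin n) ℝ} (hb : IsPosUpper b) :
    b *ᵥ Pi.single 0 1 = b 0 0 • Pi.single 0 1 := by
  rw [Matrix.mulVec_single_one]
  ext i
  by_cases hi : i = 0
  · subst hi
    simp [Matrix.col_apply]
  · simp [Matrix.col_apply, hi, hb.1 i 0 (Fin.pos_iff_ne_zero.2 hi)]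

lemma FlagOver.exists_pos {g : SL n} {x : Sphere n} (h : FlagOver (g : OrientedFlag n) x)
    (hx : Represents (Pi.single 0 1) x) :
    ∃ k : ℝ, 0 < k ∧ g.1 *ᵥ Pi.single 0 1 = k • Pi.single 0 1 := by
  obtain ⟨g', hg', h0⟩ := h
  obtain ⟨k, hk, hk'⟩ := hx.exists_pos_smul (h0 0 rfl)
  have hb : IsPosUpper (g'⁻¹ * g).1 := QuotientGroup.eq.1 hg'
  refine ⟨(g'⁻¹ * g).1 0 0 * k, mul_pos (hb.2 0) hk, ?_⟩
  have h1 : g.1 = g'.1 * (g'⁻¹ * g).1 := by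
    rw [← Matrix.SpecialLinearGroup.coe_mul, mul_inv_cancel_left]
  have h2 : g'.1 *ᵥ Pi.single 0 1 = k • Pi.single 0 1 := by
    rw [Matrix.mulVec_single_one, ← hk']
    rfl
  rw [h1, ← Matrix.mulVec_mulVec, hb.mulVec_single, Matrix.mulVec_smul, h2, smul_smul]

end FirstColumn

namespace PrincipalBundle

variable {n : ℕ} {C : Type*} [TopologicalSpace C] [ChartedSpace ℝ C] {Q : Type*}
  [MulAction (SL n)ᵐᵒᵖ Q] {P : PrincipalBundle n C Q} {o : Orientation C} {c : ℝ → C}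
  {τ : Q → Sphere n} {T T' : Q → OrientedFlag n}

lemma mem_gaugeFixing_of_mem_identity {u : P.gauge} (hu : u ∈ P.gaugeFixingIdentity τ) :
    u ∈ P.gaugeFixing τ := by
  obtain ⟨U, -, rfl, hU, -⟩ := hu
  exact hU 1

/-! ### The action preserves positivity -/

/-- Horizontal sections of u • θ and θ correspond under u and have the same curves, so nondegeneracy
persists and the derived lift T' becomes T' ∘ u⁻¹. A path from 1 to u keeps its homotopy class. -/
lemma smul_mem_positiveConnections {u : P.gauge} (hu : u ∈ P.gaugeFixingIdentity τ)
    {θ : P.Connection} (hθ : θ ∈ P.positiveConnections o τ T) :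
    u • θ ∈ P.positiveConnections o τ T := by
  obtain ⟨hnd, T', hT', hhom⟩ := hθ
  have h1 : ∀ q, τ (u⁻¹.1 q) = τ q := mem_gaugeFixing_of_mem_identity hu
  have h2 : ∀ (s : P.LocalSection) (v : C → Fin n → ℝ),
      IsLiftOn 𝓘(ℝ, ℝ) (fun x => τ ((s.map u⁻¹).val x)) v (s.map u⁻¹).dom ↔
        IsLiftOn 𝓘(ℝ, ℝ) (fun x => τ (s.val x)) v s.dom := fun s v => by
    change IsLiftOn 𝓘(ℝ, ℝ) (fun x => τ (u⁻¹.1 (s.val x))) v s.dom ↔ _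
    simp only [h1]
  refine ⟨fun s hs => ?_, _, fun s hs v hv => ?_, hhom.comp_path hu⟩
  · obtain ⟨v, hv, hpos⟩ := hnd (s.map u⁻¹) hs
    exact ⟨v, (h2 s v).1 hv, hpos⟩
  · exact hT' (s.map u⁻¹) hs v ((h2 s v).2 hv)

lemma IsFlagLift.liftHomotopic_refl (hT : P.IsFlagLift τ T) : P.LiftHomotopic τ T T := by
  refine ⟨fun _ => T, rfl, rfl, fun _ => hT, fun s => ?_⟩
  obtain ⟨g, hg, hgT⟩ := hT.smooth s
  exact ⟨fun z => g z.2, fun i j => (hg i j).comp contMDiff_snd.contMDiffOn fun z hz => hz.2,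
    fun z hz => hgT z.2 hz.2⟩

lemma _root_.DrinfeldSokolov.kry_periodic {A : ℝ → Matrix (Fin n) (Fin n) ℝ} {v : ℝ → Fin n → ℝ}
    (hA : ∀ t, A (t + 1) = A t) (hv : ∀ t, v (t + 1) = v t) (k : ℕ) (t : ℝ) :
    kry A v k (t + 1) = kry A v k t := by
  induction k generalizing t with
  | zero => exact hv t
  | succ k ih =>
    change A (t + 1) *ᵥ kry A v k (t + 1) + deriv (kry A v k) (t + 1) =
      A t *ᵥ kry A v k t + deriv (kry A v k) t
    rw [ih, hA, ← deriv_comp_add_const, funext ih]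

/-- The connection with a given companion matrix. -/
lemma exists_connection_companion {e : P.LocalSection} (hc : IsCoordinate o c) (he : e.dom = Set.univ)
    {a : ℕ → ℝ → ℝ} (ha : IsAGDCoeff n a) :
    ∃ θ : P.Connection, ∀ t, θ.matrix e c t = companion n fun i => a i t :=
  exists_connection hc he ha.smoothMat_companion (fun t => by simp only [ha.periodic])
    fun t => trace_companion _

/-! ### Reduction to companion form -/

section NormalForm

variable [NeZero n] {e : P.LocalSection}

/-- The Krylov matrix is the identity, so the derived lift is T itself and a constant homotopy
suffices. -/
lemma mem_positiveConnections_of_companion (hc : IsCoordinate o c) (hτ : P.IsSphereMap τ)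
    (hT : P.IsFlagLift τ T) (he : e.IsFlagFrame T) {θ : P.Connection} {a : ℕ → ℝ → ℝ}
    (hθ : ∀ t, θ.matrix e c t = companion n fun i => a i t) :
    θ ∈ P.positiveConnections o τ T := by
  have hK : ∀ t, θ.krylov e c t = 1 := kryMat_companion hθ
  refine ⟨θ.isNondegenerate_of_det_krylov_pos hc hτ he.1 (he.represents hT) fun t => ?_, T,
    θ.isDerivedLift_of_spansFlag hc hτ he.1 (he.represents hT) hT fun t => ?_,
    hT.liftHomotopic_refl⟩
  · rw [hK, Matrix.det_one]
    exact one_pos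
  · rw [hK, he.2]
    exact ⟨1, 1, (borel n).one_mem, (mul_one _).symm, rfl⟩

/-- A companion matrix reads only the coefficients of index at most n - 2. These inherit smoothness
and periodicity from the last column of the connection matrix; all others can be redefined freely.
-/
lemma Connection.exists_isAGDCoeff (hc : IsCoordinate o c) (he : e.dom = Set.univ)
    {θ : P.Connection} {a : ℕ → ℝ → ℝ} (hθ : ∀ t, θ.matrix e c t = companion n fun i => a i t) :
    ∃ a', IsAGDCoeff n a' ∧ ∀ t, θ.matrix e c t = companion n fun i => a' i t := by
  have hn := NeZero.pos n
  let l : Fin n := ⟨n - 1, by omega⟩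
  let a' : ℕ → ℝ → ℝ := fun i t =>
    if h : i + 1 < n then -θ.matrix e c t ⟨i, by omega⟩ l else if i = n then 1 else 0
  refine ⟨a', ⟨fun i => ?_, fun i t => ?_, fun t => ?_, fun t => ?_⟩, fun t => ?_⟩
  · by_cases h : i + 1 < n
    · simp only [a', dif_pos h]
      exact contDiffOn_univ.1 ((θ.smoothMat_matrix_frame hc he) ⟨i, by omega⟩ l).neg
    · simp only [a', dif_neg h]
      exact contDiff_const
  · simp only [a', θ.matrix_periodic hc]
  · simp [a']
  · have h1 : ¬(n - 1 + 1 < n) := by omega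
    have h2 : ¬(n - 1 = n) := by omega
    simp only [a', dif_neg h1, if_neg h2]
  · rw [hθ]
    ext i j
    simp only [companion, Matrix.of_apply]
    split_ifs with h1 h2
    · rfl
    · have h4 : n - 1 + 1 = n ∧ i.1 + 1 < n := ⟨by omega, h2.2⟩
      simp [a', hθ, companion, l, h4, i.2.ne]
    · rfl

/-- If `k` spans the flags of a lift homotopic to the standard one, then the gauge transformation
defined by `k` lies in the identity component. -/
lemma frameGauge_mem_gaugeFixingIdentity (hτ : P.IsSphereMap τ) (hT : P.IsFlagLift τ T)
    (he : e.IsFlagFrame T) (hhom : P.LiftHomotopic τ T' T) {k : C → SL n}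
    (hk : SmoothSLOn 𝓘(ℝ, ℝ) k Set.univ)
    (hkT : ∀ x, (k x : OrientedFlag n) = T' (e.val x)) :
    frameGauge he.1 hk ∈ P.gaugeFixingIdentity τ := by
  obtain ⟨F, rfl, rfl, hF, hFs⟩ := hhom
  -- Along the frame the homotopy lifts to g with values in SL(n). At parameter 1 it lies in B, and
  -- at parameter 0 it differs from k by an element of B.
  obtain ⟨g, hg, hgF⟩ := hFs e
  rw [he.1, Set.univ_prod_univ] at hg hgF
  have hgF : ∀ l x, (g (l, x) : OrientedFlag n) = F l (e.val x) := fun l x => hgF (l, x) trivial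
  have hb1 : ∀ x, (g (1, x))⁻¹ ∈ borel n := fun x =>
    (borel n).inv_mem (mk_eq_standardFlag_iff.1 ((hgF 1 x).trans (he.2 x)))
  have hb0 : ∀ x, (g (0, x))⁻¹ * k x ∈ borel n := fun x =>
    QuotientGroup.eq.1 ((hgF 0 x).trans (hkT x).symm)
  -- Paths are parametrized by all of ℝ, while convexity needs weights in [0, 1]; the smooth
  -- transition function reconciles the two.
  let χ := Real.smoothTransition
  let M : ℝ × C → Matrix (Fin n) (Fin n) ℝ := fun z =>
    (1 - χ z.1) • ((g (1, z.2))⁻¹).1 + χ z.1 • ((g (0, z.2))⁻¹ * k z.2).1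
  have hM : ∀ z, IsPosUpper (M z) := fun z => IsPosUpper.convex (hb1 z.2) (hb0 z.2)
    (Real.smoothTransition.nonneg _) (Real.smoothTransition.le_one _)
  -- The lifted homotopy is run backwards and corrected on the right within B, so that H starts at 1
  -- and ends at k. It always represents a flag over τ, which is why it fixes the ray of e₁.
  let H : ℝ → C → SL n := fun l x => g (1 - l, x) * slNormalize (M (l, x))
  have hcst : ∀ r : ℝ, SmoothSLOn (𝓘(ℝ, ℝ).prod 𝓘(ℝ, ℝ)) (fun z : ℝ × C => g (r, z.2)) Set.univ :=
    fun r i j => (hg i j).comp (contMDiff_const.prodMk contMDiff_snd).contMDiffOn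
      fun z _ => trivial
  have hrev : SmoothSLOn (𝓘(ℝ, ℝ).prod 𝓘(ℝ, ℝ)) (fun z : ℝ × C => g (1 - z.1, z.2)) Set.univ :=
    fun i j => (hg i j).comp ((((contDiff_const.sub contDiff_id).contMDiff (n := ∞)
      (f := fun l : ℝ => 1 - l)).comp contMDiff_fst).prodMk contMDiff_snd).contMDiffOn
      fun z _ => trivial
  have hk2 : SmoothSLOn (𝓘(ℝ, ℝ).prod 𝓘(ℝ, ℝ)) (fun z : ℝ × C => k z.2) Set.univ :=
    fun i j => (hk i j).comp contMDiff_snd.contMDiffOn fun z _ => trivial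
  have hχ : ContMDiffOn (𝓘(ℝ, ℝ).prod 𝓘(ℝ, ℝ)) 𝓘(ℝ, ℝ) ∞ (fun z : ℝ × C => χ z.1) Set.univ :=
    (Real.smoothTransition.contDiff.contMDiff.comp contMDiff_fst).contMDiffOn
  have hMs : ∀ i j, ContMDiffOn (𝓘(ℝ, ℝ).prod 𝓘(ℝ, ℝ)) 𝓘(ℝ, ℝ) ∞
      (fun z : ℝ × C => M z i j) Set.univ := fun i j =>
    ((contMDiffOn_const.sub hχ).mul ((hcst 1).inv i j)).add
      (hχ.mul (((hcst 0).inv.mul hk2) i j))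
  have hHs : SmoothSLOn (𝓘(ℝ, ℝ).prod 𝓘(ℝ, ℝ)) (fun z : ℝ × C => H z.1 z.2) Set.univ :=
    hrev.mul (smoothSLOn_slNormalize hMs fun z _ => (hM z).det_pos)
  have hHl : ∀ l, SmoothSLOn 𝓘(ℝ, ℝ) (H l) Set.univ := fun l i j =>
    (hHs i j).comp (f := fun x : C => (l, x)) (contMDiff_const.prodMk contMDiff_id).contMDiffOn
      fun x _ => trivial
  have hH0 : ∀ x, H 0 x = 1 := fun x => by
    have h1 : M (0, x) = ((g (1, x))⁻¹).1 := by
      simp only [M, χ, Real.smoothTransition.zero, sub_zero, one_smul, zero_smul, add_zero]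
    simp only [H]
    rw [h1, slNormalize_coe_SL, sub_zero, mul_inv_cancel]
  have hH1 : ∀ x, H 1 x = k x := fun x => by
    have h1 : M (1, x) = ((g (0, x))⁻¹ * k x).1 := by
      simp only [M, χ, Real.smoothTransition.one, sub_self, one_smul, zero_smul, zero_add]
    simp only [H]
    rw [h1, slNormalize_coe_SL, sub_self, mul_inv_cancel_left]
  refine ⟨fun l => frameGauge he.1 (hHl l), gauge_ext he.1 fun x => ?_,
    gauge_ext he.1 fun x => ?_, fun l => ?_, isSmoothPath_frameGauge he.1 hHl hHs⟩
  · rw [frameGauge_apply, frameMap_frame he.1, hH0, MulOpposite.op_one, one_smul]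
    rfl
  · rw [frameGauge_apply, frameMap_frame he.1, hH1, frameGauge_apply, frameMap_frame he.1]
  · refine frameGauge_mem_gaugeFixing he.1 hτ (he.represents hT) (hHl l) fun x => ?_
    obtain ⟨r, hr, hr'⟩ := FlagOver.exists_pos (g := g (1 - l, x))
      (by rw [hgF]; exact (hF (1 - l)).lift _) (he.represents hT x)
    have hb : IsPosUpper (slNormalize (M (l, x))).1 := (hM (l, x)).slNormalize_mem
    refine ⟨(slNormalize (M (l, x))).1 0 0 * r, mul_pos (hb.2 0) hr, ?_⟩
    simp only [H]
    rw [Matrix.SpecialLinearGroup.coe_mul, ← Matrix.mulVec_mulVec, hb.mulVec_single,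
      Matrix.mulVec_smul, hr', smul_smul]

/-- Every positive connection is brought into companion form by a gauge transformation. -/
lemma exists_smul_eq_companion (hc : IsCoordinate o c) (hτ : P.IsSphereMap τ)
    (hT : P.IsFlagLift τ T) (he : e.IsFlagFrame T) {θ : P.Connection}
    (hθ : θ ∈ P.positiveConnections o τ T) :
    ∃ u ∈ P.gaugeFixingIdentity τ, ∃ a, IsAGDCoeff n a ∧
      ∀ t, (u • θ).matrix e c t = companion n fun i => a i t := by
  obtain ⟨hnd, T', hder, hhom⟩ := hθ
  have heτ := he.represents hT
  have hT' : P.IsFlagLift τ T' := by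
    obtain ⟨F, hF0, -, hF, -⟩ := hhom
    exact hF0 ▸ hF 0
  have hpos : ∀ t, 0 < (θ.krylov e c t).det := θ.det_krylov_pos hc hτ he.1 heτ hnd
  have hspan := hder.spansFlag hc hτ he.1 heτ hT'
  have hA := θ.smoothMat_matrix_frame hc he.1
  -- Scaling the initial vector by φ multiplies the determinant of the Krylov matrix by φ^n, so this
  -- exponent makes it 1.
  let φ : ℝ → ℝ := fun t => (θ.krylov e c t).det ^ (-(n : ℝ)⁻¹)
  have hφ : ContDiffOn ℝ ∞ φ Set.univ := θ.contDiff_det_krylov_rpow hc he.1 hpos _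
  have hφpos : ∀ t, 0 < φ t := fun t => Real.rpow_pos_of_pos (hpos t) _
  let v : ℝ → Fin n → ℝ := fun t => φ t • Pi.single 0 1
  have hv : ContDiffOn ℝ ∞ v Set.univ := hφ.smul contDiffOn_const
  let K : ℝ → Matrix (Fin n) (Fin n) ℝ := kryMat (fun t => θ.matrix e c t) v
  have hK : ∀ t, K t = θ.krylov e c t * chgMat n φ id t := fun t =>
    kryMat_smul isOpen_univ hA contDiffOn_const hφ trivial
  have hdet : ∀ t, (K t).det = 1 := fun t => by
    rw [hK, Matrix.det_mul, det_chgMat_id, mul_comm]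
    exact rpow_neg_inv_pow (hpos t)
  have hKsm : SmoothMat K Set.univ := smoothMat_kryMat isOpen_univ hA hv
  have hkry : ∀ t, θ.krylov e c (t + 1) = θ.krylov e c t := fun t => by
    ext i k
    exact congrFun (kry_periodic (θ.matrix_periodic hc e) (fun _ => rfl) k.1 t) i
  have hvper : ∀ t, v (t + 1) = v t := fun t => by
    simp only [v, φ, hkry]
  have hKper : ∀ t, K (t + 1) = K t := fun t => by
    ext i k
    exact congrFun (kry_periodic (θ.matrix_periodic hc e) hvper k.1 t) i
  let KS : ℝ → SL n := fun t => ⟨K t, hdet t⟩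
  have hKSper : ∀ t, KS (t + 1) = KS t := fun t => Subtype.ext (hKper t)
  let k : C → SL n := hc.desc KS
  have hkc : ∀ t, k (c t) = KS t := hc.desc_apply hKSper
  have hk : SmoothSLOn 𝓘(ℝ, ℝ) k Set.univ := by
    rw [hc.smoothSLOn_iff isOpen_univ]
    intro i j
    refine (hKsm i j).congr fun t _ => ?_
    exact congrArg (fun g : SL n => g.1 i j) (hkc t)
  -- The rescaling acts through a positive triangular factor, so K spans the same flags as the
  -- original Krylov matrix, those of T'.
  have hkT : ∀ x, (k x : OrientedFlag n) = T' (e.val x) := fun x => by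
    obtain ⟨t, rfl⟩ := hc.surjective x
    rw [hkc, ← slNormalize_coe_SL (KS t)]
    refine (spansFlag_iff (by rw [Matrix.SpecialLinearGroup.det_coe]; exact one_pos)).1 ?_
    change SpansFlag (K t) _
    rw [hK, spansFlag_mul_iff (chgMat_isPosUpper (hφpos t) (by simp))]
    exact hspan t
  -- The inverse is taken because the matrix of u • θ in e is the matrix of θ in the frame u⁻¹ e = e
  -- k.
  let u : P.gauge := (frameGauge he.1 hk)⁻¹
  have hu : u ∈ P.gaugeFixingIdentity τ :=
    inv_mem (frameGauge_mem_gaugeFixingIdentity hτ hT he hhom hk hkT)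
  have htr : ∀ t, translation (n := n) (e.val (c t)) ((e.map u⁻¹).val (c t)) = KS t := fun t => by
    have h1 : (e.map u⁻¹).val (c t) = e.val (c t) <• k (c t) := by
      change u⁻¹.1 (e.val (c t)) = _
      rw [inv_inv, frameGauge_apply, frameMap_frame he.1]
    rw [h1, P.translation_smul, hkc]
  have heq : ∀ t, θ.matrix e c t * K t + matDeriv K t = K t * (u • θ).matrix e c t := fun t => by
    have h1 := θ.matrix_transform' hc e (e.map u⁻¹) (t := t) (by rw [he.1]; trivial)
      (by change c t ∈ e.dom; rw [he.1]; trivial)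
    simp only [htr] at h1
    exact h1
  have hn := NeZero.pos n
  -- Column j of A K + K' is column j + 1 of K by construction, and A K + K' equals K times the new
  -- matrix; cancelling K gives a basis vector.
  have hcol : ∀ t (j : Fin n) (hj : j.1 + 1 < n) (i : Fin n),
      (u • θ).matrix e c t i j = if i.1 = j.1 + 1 then 1 else 0 := by
    intro t j hj
    have h1 : K t *ᵥ (fun i => (u • θ).matrix e c t i j) =
        K t *ᵥ Pi.single ⟨j.1 + 1, hj⟩ 1 := by
      rw [Matrix.mulVec_single_one]
      ext i
      have h2 : (K t * (u • θ).matrix e c t) i j = K t i ⟨j.1 + 1, hj⟩ := by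
        rw [← heq, Matrix.add_apply, Matrix.mul_apply]
        change _ = (θ.matrix e c t *ᵥ kry (fun t => θ.matrix e c t) v j.1 t +
          deriv (kry (fun t => θ.matrix e c t) v j.1) t) i
        rw [Pi.add_apply, deriv_pi fun i => (contDiffOn_pi.1 (contDiffOn_kry isOpen_univ hA hv j.1)
          i).diffAt isOpen_univ trivial]
        rfl
      exact h2
    have h3 := congrArg (fun w => ((KS t)⁻¹).1 *ᵥ w) h1
    have h4 : ((KS t)⁻¹).1 * K t = 1 := coe_inv_mul
    simp only [Matrix.mulVec_mulVec] at h3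
    rw [h4, Matrix.one_mulVec, Matrix.one_mulVec] at h3
    intro i
    rw [congrFun h3 i, Pi.single_apply]
    simp only [Fin.ext_iff]
  -- Only the last column is left. Its bottom entry is the trace, because the other diagonal entries
  -- vanish, and so it is zero.
  have hcomp : ∀ t, (u • θ).matrix e c t =
      companion n fun i => if h : i < n then -(u • θ).matrix e c t ⟨i, h⟩ ⟨n - 1, by omega⟩
        else 0 := by
    intro t
    have htrace := (u • θ).trace_matrix (c := c) e t
    ext i j
    simp only [companion, Matrix.of_apply]
    by_cases hj : j.1 + 1 < n
    · have h1 : ¬(j.1 + 1 = n ∧ i.1 + 1 < n) := by omega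
      rw [hcol t j hj i, if_neg h1]
    · have hjn : j = ⟨n - 1, by omega⟩ := Fin.ext (by have := j.2; simp only; omega)
      have h1 : i.1 ≠ j.1 + 1 := by have := i.2; omega
      rw [if_neg h1]
      by_cases hi : i.1 + 1 < n
      · rw [if_pos ⟨by omega, hi⟩, dif_pos i.2, neg_neg, hjn]
      · have hij : i = j := Fin.ext (by omega)
        rw [if_neg (fun h => hi h.2)]
        rw [Matrix.trace, Finset.sum_eq_single j (fun l _ hl => ?_)
          fun h => absurd (Finset.mem_univ j) h] at htrace
        · rw [hij]
          exact htrace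
        · have hl' : l.1 + 1 < n := by
            have := l.2
            have : l.1 ≠ j.1 := fun h => hl (Fin.ext h)
            omega
          rw [Matrix.diag_apply, hcol t l hl' l, if_neg (by omega)]
  obtain ⟨a, ha, ha'⟩ := (u • θ).exists_isAGDCoeff hc he.1 (a := fun i t =>
    if h : i < n then -(u • θ).matrix e c t ⟨i, h⟩ ⟨n - 1, by omega⟩ else 0) hcomp
  exact ⟨u, hu, a, ha, ha'⟩

/-- The stabilizer of a nondegenerate connection in the group of gauge transformations fixing `τ`
is trivial. -/
lemma eq_one_of_smul_eq (hc : IsCoordinate o c) (hτ : P.IsSphereMap τ)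
    (he : e.dom = Set.univ) (heτ : ∀ x, Represents (Pi.single 0 1) (τ (e.val x)))
    {θ : P.Connection} (hθ : θ.IsNondegenerate o τ) {u : P.gauge} (hu : u ∈ P.gaugeFixing τ)
    (huθ : u • θ = θ) : u = 1 := by
  have hpos : ∀ t, 0 < (θ.krylov e c t).det := θ.det_krylov_pos hc hτ he heτ hθ
  have hA := θ.smoothMat_matrix_frame hc he
  have hmem : ∀ x, x ∈ e.dom := fun x => by rw [he]; trivial
  let h : ℝ → SL n := fun t => translation (n := n) (e.val (c t)) ((e.map u⁻¹).val (c t))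
  have hh : SmoothMat (fun t => (h t).1) Set.univ :=
    (smoothMat_translation hc e (e.map u⁻¹)).mono fun t _ => ⟨hmem _, hmem _⟩
  have heq : ∀ t, θ.matrix e c t * (h t).1 + matDeriv (fun t => (h t).1) t =
      (h t).1 * θ.matrix e c t := fun t => by
    have h1 := θ.matrix_transform' hc e (e.map u⁻¹) (t := t) (hmem _) (hmem _)
    rwa [← Connection.matrix_smul, huθ] at h1
  have hcol : ∀ t, ∃ r : ℝ, 0 < r ∧ (h t).1 *ᵥ Pi.single 0 1 = r • Pi.single 0 1 := fun t =>
    exists_pos_of_mem_gaugeFixing hτ (heτ (c t)) hu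
  choose r hr hr' using hcol
  have hrsm : ContDiffOn ℝ ∞ r Set.univ := by
    refine (hh 0 0).congr fun t _ => ?_
    have h1 := congrFun (hr' t) 0
    rw [Matrix.mulVec_single_one] at h1
    simpa [Matrix.col_apply] using h1.symm
  -- Since h commutes with A + d/dt, it carries the Krylov matrix of e₁ to that of h e₁ = r e₁,
  -- which is the former times a triangular matrix with all diagonal entries r.
  have h1 : ∀ t, θ.krylov e c t * chgMat n r id t = (h t).1 * θ.krylov e c t := fun t => by
    have h2 := kryMat_intertwine (t := t) isOpen_univ hA hh (v := fun _ => Pi.single 0 1)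
      contDiffOn_const (fun t _ => heq t) trivial
    simp only [hr'] at h2
    rw [← Connection.krylov] at h2
    rw [← h2]
    exact (kryMat_smul isOpen_univ hA contDiffOn_const hrsm trivial).symm
  -- Comparing determinants gives r^n = 1 with r positive.
  have hr1 : ∀ t, r t = 1 := fun t => by
    have h2 := congrArg Matrix.det (h1 t)
    rw [Matrix.det_mul, Matrix.det_mul, det_chgMat_id, Matrix.SpecialLinearGroup.det_coe,
      one_mul] at h2
    exact (pow_eq_one_iff_of_nonneg (hr t).le (NeZero.ne n)).1
      (mul_left_cancel₀ (hpos t).ne' (h2.trans (mul_one _).symm))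
  have hh1 : ∀ t, h t = 1 := fun t => by
    have h2 : (h t).1 * θ.krylov e c t = θ.krylov e c t := by
      have h3 := kryMat_intertwine (t := t) isOpen_univ hA hh (v := fun _ => Pi.single 0 1)
        contDiffOn_const (fun t _ => heq t) trivial
      simp only [hr', hr1, one_smul] at h3
      exact h3.symm
    have hunit : IsUnit (θ.krylov e c t).det := (hpos t).ne'.isUnit
    apply Subtype.ext
    have h4 := congrArg (fun M => M * (θ.krylov e c t)⁻¹) h2
    simp only [mul_assoc] at h4
    rw [Matrix.mul_nonsing_inv _ hunit, mul_one] at h4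
    exact h4
  have hinv : u⁻¹ = 1 := gauge_ext he fun x => by
    obtain ⟨t, rfl⟩ := hc.surjective x
    rw [gauge_smul_translation u⁻¹ (e.val (c t))]
    have h2 : translation (n := n) (e.val (c t)) (u⁻¹.1 (e.val (c t))) = 1 := hh1 t
    rw [h2, MulOpposite.op_one, one_smul]
    rfl
  exact inv_eq_one.1 hinv

/-- Every positive connection has an associated operator. -/
lemma exists_isOperator (hc : IsCoordinate o c) (hτ : P.IsSphereMap τ) (hT : P.IsFlagLift τ T)
    (he : e.IsFlagFrame T) {θ : P.Connection} (hθ : θ ∈ P.positiveConnections o τ T) :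
    ∃ L : AGD n o, θ.IsOperator τ L := by
  obtain ⟨u, hu, a, ha, hua⟩ := exists_smul_eq_companion hc hτ hT he hθ
  obtain ⟨L, hL⟩ := hc.exists_AGD (NeZero.pos n) ha
  -- The operator of the companion form is also that of θ, since u⁻¹ fixes τ.
  have h := ((u • θ).isOperator_of_companion hc hτ he.1 (he.represents hT) ha hua hL).smul
    (inv_mem (mem_gaugeFixing_of_mem_identity hu))
  rw [inv_smul_smul] at h
  exact ⟨L, h⟩

lemma Connection.IsOperator.unique_of_mem (hc : IsCoordinate o c) (hτ : P.IsSphereMap τ)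
    (hT : P.IsFlagLift τ T) (he : e.IsFlagFrame T) {θ : P.Connection}
    (hθ : θ ∈ P.positiveConnections o τ T) {L L' : AGD n o} (hL : θ.IsOperator τ L)
    (hL' : θ.IsOperator τ L') : L = L' :=
  hL.unique hc hτ he.1 (he.represents hT)
    (θ.det_krylov_pos hc hτ he.1 (he.represents hT) hθ.1) hL'

/-- Positive connections with the same operator are gauge equivalent. -/
lemma exists_smul_eq_of_isOperator (hc : IsCoordinate o c) (hτ : P.IsSphereMap τ)
    (hT : P.IsFlagLift τ T) (he : e.IsFlagFrame T) {θ θ' : P.Connection}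
    (hθ : θ ∈ P.positiveConnections o τ T) (hθ' : θ' ∈ P.positiveConnections o τ T)
    {L : AGD n o} (hL : θ.IsOperator τ L) (hL' : θ'.IsOperator τ L) :
    ∃ u ∈ P.gaugeFixingIdentity τ, u • θ = θ' := by
  have key : ∀ {θ : P.Connection}, θ ∈ P.positiveConnections o τ T → θ.IsOperator τ L →
      ∃ u ∈ P.gaugeFixingIdentity τ, ∃ a, HasCoefficients L.1 n c a ∧
        ∀ t, (u • θ).matrix e c t = companion n fun i => a i t := by
    intro θ hθ hL
    obtain ⟨u, hu, a, ha, hua⟩ := exists_smul_eq_companion hc hτ hT he hθ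
    obtain ⟨L₁, hL₁⟩ := hc.exists_AGD (NeZero.pos n) ha
    have h1 := (u • θ).isOperator_of_companion hc hτ he.1 (he.represents hT) ha hua hL₁
    have h2 : L₁ = L := h1.unique_of_mem hc hτ hT he (smul_mem_positiveConnections hu hθ)
      (hL.smul (mem_gaugeFixing_of_mem_identity hu))
    exact ⟨u, hu, a, h2 ▸ hL₁, hua⟩
  obtain ⟨u, hu, a, ha, hua⟩ := key hθ hL
  obtain ⟨u', hu', a', ha', hua'⟩ := key hθ' hL'
  have h : u • θ = u' • θ' := Connection.ext_matrix hc he.1 fun t => by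
    -- The operator determines its coefficients in the coordinate c, so both companion matrices
    -- agree.
    have h1 := hc.coeff_unique (fun w => hc.hasCoefficients_iff.1 ha w t)
      fun w => hc.hasCoefficients_iff.1 ha' w t
    rw [hua, hua']
    ext i j
    simp only [companion, Matrix.of_apply, h1 i.1 i.2.le]
  exact ⟨u'⁻¹ * u, mul_mem (inv_mem hu') hu, by rw [mul_smul, h, inv_smul_smul]⟩

end NormalForm

end PrincipalBundle

end DrinfeldSokolov

end

/-! ### The quotient map and its global section -/

open DrinfeldSokolov
theorem mainTheorem6 {n : ℕ} (hn : 2 ≤ n)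
    {C : Type*} [TopologicalSpace C] [T2Space C] [CompactSpace C] [ConnectedSpace C]
    [ChartedSpace ℝ C] [IsManifold 𝓘(ℝ, ℝ) ∞ C] (o : DrinfeldSokolov.Orientation C)
    {Q : Type*} [MulAction (SL n)ᵐᵒᵖ Q] (P : PrincipalBundle n C Q)
    (τ : Q → Sphere n) (hτ : P.IsSphereMap τ)
    (τhat : Q → OrientedFlag n) (hτhat : P.IsFlagLift τ τhat) :
    -- the identity component preserves the positive connections, and acts freely on them
    (∀ u ∈ P.gaugeFixingIdentity τ, ∀ θ ∈ P.positiveConnections o τ τhat,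
      u • θ ∈ P.positiveConnections o τ τhat) ∧
    (∀ u ∈ P.gaugeFixingIdentity τ, ∀ θ ∈ P.positiveConnections o τ τhat,
      u • θ = θ → u = 1) ∧
    -- the map to differential operators is well-defined
    ∃ p : P.positiveConnections o τ τhat → AGD n o,
      (∀ θ L, p θ = L ↔ θ.1.IsOperator τ L) ∧
      -- it is the quotient map
      Function.Surjective p ∧
      (∀ θ θ', p θ = p θ' ↔ ∃ u ∈ P.gaugeFixingIdentity τ, u • θ.1 = θ'.1) ∧
      -- there is a global section, given by the companion matrices relative to any
      -- global coordinate and any trivialization of the reduction to `B`, and these exist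
      (∃ c : ℝ → C, IsCoordinate o c) ∧
      (∃ e : P.LocalSection, e.IsFlagFrame τhat) ∧
      ∀ c : ℝ → C, IsCoordinate o c → ∀ e : P.LocalSection, e.IsFlagFrame τhat →
        ∃ σ : AGD n o → P.positiveConnections o τ τhat,
          (∀ L, p (σ L) = L) ∧
          (∀ L, ∃ a : ℕ → ℝ → ℝ, HasCoefficients L.1 n c a ∧
            ∀ t, (σ L).1.matrix e c t = companion n (fun i => a i t)) ∧
          ∀ θ : P.Connection,
            (∃ a : ℕ → ℝ → ℝ, ∀ t, θ.matrix e c t = companion n (fun i => a i t)) →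
              ∃ L, (σ L).1 = θ := by
  have : NeZero n := ⟨by omega⟩
  obtain ⟨c₀, hc₀⟩ := exists_isCoordinate o
  obtain ⟨e₀, he₀⟩ := hτhat.exists_isFlagFrame
  -- The coordinate and frame only serve to establish existence; p is characterized without them and
  -- works for every other choice in the statement about sections.
  choose p hp using fun θ : P.positiveConnections o τ τhat =>
    PrincipalBundle.exists_isOperator hc₀ hτ hτhat he₀ θ.2
  have hp' : ∀ θ L, p θ = L ↔ θ.1.IsOperator τ L := fun θ L =>
    ⟨fun h => h ▸ hp θ, fun h => (hp θ).unique_of_mem hc₀ hτ hτhat he₀ θ.2 h⟩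
  have hσ : ∀ c : ℝ → C, IsCoordinate o c → ∀ e : P.LocalSection, e.IsFlagFrame τhat →
      ∃ σ : AGD n o → P.positiveConnections o τ τhat,
        (∀ L, p (σ L) = L) ∧
        (∀ L, ∃ a : ℕ → ℝ → ℝ, HasCoefficients L.1 n c a ∧
          ∀ t, (σ L).1.matrix e c t = companion n (fun i => a i t)) ∧
        ∀ θ : P.Connection,
          (∃ a : ℕ → ℝ → ℝ, ∀ t, θ.matrix e c t = companion n (fun i => a i t)) →
            ∃ L, (σ L).1 = θ := by
    intro c hc e he
    choose a ha hL using fun L : AGD n o => hc.AGD_exists_coeff L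
    choose σ hσ using fun L : AGD n o =>
      PrincipalBundle.exists_connection_companion (P := P) hc he.1 (ha L)
    refine ⟨fun L => ⟨σ L, PrincipalBundle.mem_positiveConnections_of_companion hc hτ hτhat he
      (hσ L)⟩, fun L => ?_, fun L => ⟨a L, hL L, hσ L⟩, ?_⟩
    · exact (hp' _ _).2 ((σ L).isOperator_of_companion hc hτ he.1 (he.represents hτhat) (ha L)
        (hσ L) (hL L))
    · rintro θ ⟨b, hb⟩
      -- The functions given with θ may be arbitrary in the indices that the matrix does not see, so
      -- they are replaced by genuine operator coefficients.
      obtain ⟨b', hb', hθ⟩ := θ.exists_isAGDCoeff hc he.1 hb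
      obtain ⟨L, hLb⟩ := hc.exists_AGD (NeZero.pos n) hb'
      refine ⟨L, PrincipalBundle.Connection.ext_matrix hc he.1 fun t => ?_⟩
      have h1 := hc.coeff_unique (fun w => hc.hasCoefficients_iff.1 (hL L) w t)
        fun w => hc.hasCoefficients_iff.1 hLb w t
      rw [hσ, hθ]
      ext i j
      simp only [companion, Matrix.of_apply, h1 i.1 i.2.le]
  refine ⟨fun u hu θ hθ => PrincipalBundle.smul_mem_positiveConnections hu hθ,
    fun u hu θ hθ h => PrincipalBundle.eq_one_of_smul_eq hc₀ hτ he₀.1 (he₀.represents hτhat) hθ.1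
      (PrincipalBundle.mem_gaugeFixing_of_mem_identity hu) h,
    p, hp', ?_, fun θ θ' => ⟨fun h => ?_, ?_⟩, ⟨c₀, hc₀⟩, ⟨e₀, he₀⟩, hσ⟩
  · obtain ⟨σ, hσ, -⟩ := hσ c₀ hc₀ e₀ he₀
    exact fun L => ⟨σ L, hσ L⟩
  · exact PrincipalBundle.exists_smul_eq_of_isOperator hc₀ hτ hτhat he₀ θ.2 θ'.2
      ((hp' θ _).1 h) (hp θ')
  · rintro ⟨u, hu, h⟩
    refine ((hp' θ' _).2 ?_).symm
    rw [← h]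
    exact (hp θ).smul (PrincipalBundle.mem_gaugeFixing_of_mem_identity hu)
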